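/- **Setting.** Let $(M,J,\omega)$ be a Kähler manifold with Kähler metric $g(v,w)=\omega(v,Jw)$. Let $K$ be a (not necessarily compact) Lie group with Lie algebra $\mathfrak{k}$ that acts smoothly and holomorphically on $M$, and write $\xi_M(x)=\frac{d}{dt}\big|_{t=0}\exp(-t\xi)\cdot x$ for the vector field generated by $\xi\in\mathfrak{k}$ (so that $\xi\mapsto\xi_M$ is a homomorphism of Lie algebras). Suppose that the action is Hamiltonian, with a smooth moment map $\Phi:M\to\mathfrak{k}^*$ that is equivariant for the coadjoint action and satisfies $-\iota(\xi_M)\omega=d\langle\Phi,\xi\rangle$ for all $\xi\in\mathfrak{k}$. Suppose that $0$ is a regular value of $\Phi$, and let $i:Z=\Phi^{-1}(0)\hookrightarrow M$ be the zero level set, an embedded $K$-invariant submanifold. For $z\in Z$ let $V_z=\{\xi_Z(z):\xi\in\mathfrak{k}\}\subset T_zZ$ be the tangent space of the orbit, $E_z$ the $g$-orthogonal complement of $V_z$ in $T_zZ$, and $Q_z=T_zZ/V_z$. The subspace $E_z$ is $J$-invariant, and the isomorphism $E_z\cong Q_z$ induced by the projection transports $J|_{E_z}$ to a complex structure on $Q_z$.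 Let $Q_z^{*\prime}$ and $Q_z^{*\prime\prime}$ be the $i$- and the $-i$-eigenspace of the complex structure on $Q_z^*\otimes\mathbb{C}$. A form $\beta$ on $Z$ is *horizontal* if $\iota(\xi_Z)\beta=0$ for all $\xi\in\mathfrak{k}$; a horizontal form is induced by a section of $\wedge Q^*$. Let $\Omega^{p,q}_{hor}(Z)$ be the space of smooth complex valued horizontal forms on $Z$ that are induced by sections of $\wedge^pQ^{*\prime}\otimes\wedge^qQ^{*\prime\prime}$ ("horizontal forms of type $(p,q)$"). Let $\xi_1,\dots,\xi_k$ be a basis of $\mathfrak{k}$ with $[\xi_i,\xi_j]=\sum_l c_{ij}^l\,\xi_l$, and let $\theta^1,\dots,\theta^k$ be the smooth $1$-forms on $Z$ with $$\theta^i|_{E}=0,\qquad \theta^i\big((\xi_j)_Z\big)=\delta^i_j .$$ Every form on $Z$ can be written uniquely as $\sum_I\theta^I\wedge h_I$ with horizontal $h_I$, where $I$ runs through the multi-indices $i_1<\dots<i_r$ in $\{1,\dots,k\}$ and $\theta^I=\theta^{i_1}\wedge\dots\wedge\theta^{i_r}$; the *horizontal projection* is $\mathrm{Hor}\big(\sum_I\theta^I\wedge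 h_I\big)=h_\emptyset$. The curvature $2$-forms are $$\mu^l=d\theta^l+\tfrac12\sum_{i,j}c_{ij}^l\,\theta^i\wedge\theta^j,\qquad 1\le l\le k .$$ **Lemma.** (a) If $\alpha$ is a smooth complex valued form of type $(p,q)$ on $M$, then $\mathrm{Hor}(i^*\alpha)\in\Omega^{p,q}_{hor}(Z)$. (b) For all $1\le l\le k$, the curvature form $\mu^l$ is horizontal of type $(1,1)$, that is, $\mu^l\in\Omega^{1,1}_{hor}(Z)$. -/

import Mathlib

set_option linter.unusedSectionVars false
open scoped Manifold ContDiff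

namespace KahlerReduction

section PointwiseAlgebra

variable {T : Type*} [AddCommGroup T] [Module ℝ T]

/-- For a real vector space `T` with an endomorphism `J` (a complex structure), the space
`∧^p T*' ⊗ ∧^q T*''` of complex valued alternating forms of type `(p, q)`, where `T*'` and `T*''`
are the `i`- and the `-i`-eigenspace of `J` on complex valued covectors: the complex span of the
products `a₁ ∧ ⋯ ∧ a_p ∧ b₁ ∧ ⋯ ∧ b_q` with `aᵢ ∈ T*'` and `bᵢ ∈ T*''`. A product of covectors
`c₁ ∧ ⋯ ∧ c_r` is the form `v ↦ det (cᵢ (vⱼ))`. -/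
noncomputable def typePQ (J : T →ₗ[ℝ] T) (p q : ℕ) :
    Submodule ℂ (T [⋀^Fin (p + q)]→ₗ[ℝ] ℂ) :=
  Submodule.span ℂ {α | ∃ (a : Fin p → T →ₗ[ℝ] ℂ) (b : Fin q → T →ₗ[ℝ] ℂ),
    (∀ i v, a i (J v) = Complex.I * a i v) ∧ (∀ i v, b i (J v) = -Complex.I * b i v) ∧
    ∀ v : Fin (p + q) → T,
      α v = Matrix.det (Matrix.of fun i j => (Fin.append a b i) (v j))}

variable [TopologicalSpace T] {F : Type*} [NormedAddCommGroup F] [NormedSpace ℝ F]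

/-- `ι(ξ) β = 0`: by antisymmetry this says that `β` vanishes as soon as one of its arguments
is `ξ`. -/
def IsKilledBy {n : ℕ} (ξ : T) (β : T [⋀^Fin n]→L[ℝ] F) : Prop :=
  ∀ (v : Fin n → T) (j : Fin n), v j = ξ → β v = 0

/-- The exterior product `a ∧ h` of a covector with an `n`-form,
`(a ∧ h)(v₀, …, vₙ) = ∑ᵢ (-1)ⁱ a(vᵢ) h(v₀, …, v̂ᵢ, …, vₙ)`. -/
noncomputable def wedge {n : ℕ} (a : T →L[ℝ] ℝ) (h : T [⋀^Fin n]→L[ℝ] F) :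
    T [⋀^Fin (n + 1)]→L[ℝ] F :=
  { AlternatingMap.alternatizeUncurryFin ((a : T →ₗ[ℝ] ℝ).smulRight h.toAlternatingMap) with
    cont := by
      have h1 : ∀ i : Fin (n + 1), Continuous fun v : Fin (n + 1) → T =>
          (-1 : ℤ) ^ (i : ℕ) • (a (v i) • h (i.removeNth v)) := by
        intro i
        have h2 : Continuous fun v : Fin (n + 1) → T => i.removeNth v :=
          continuous_pi fun j => continuous_apply _
        have h3 : Continuous fun v : Fin (n + 1) → T => a (v i) • h (i.removeNth v) :=
          (a.continuous.comp (continuous_apply i)).smul (h.cont.comp h2)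
        exact h3.const_smul ((-1 : ℤ) ^ (i : ℕ))
      refine (continuous_finsetSum Finset.univ fun i _ => h1 i).congr fun v => ?_
      exact (AlternatingMap.alternatizeUncurryFin_apply
        ((a : T →ₗ[ℝ] ℝ).smulRight h.toAlternatingMap) v).symm }

theorem wedge_apply {n : ℕ} (a : T →L[ℝ] ℝ) (h : T [⋀^Fin n]→L[ℝ] F) (v : Fin (n + 1) → T) :
    wedge a h v = ∑ i : Fin (n + 1), (-1 : ℤ) ^ (i : ℕ) • (a (v i) • h (i.removeNth v)) :=
  AlternatingMap.alternatizeUncurryFin_apply _ v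

/-- A covector as a `1`-form. -/
noncomputable def oneForm (a : T →L[ℝ] F) : T [⋀^Fin 1]→L[ℝ] F :=
  ContinuousAlternatingMap.ofSubsingleton ℝ T F (0 : Fin 1) a

/-- The contraction `ι(ξ) h`. -/
noncomputable def contract {n : ℕ} (ξ : T) (h : T [⋀^Fin (n + 1)]→L[ℝ] F) :
    T [⋀^Fin n]→L[ℝ] F :=
  { h.toAlternatingMap.curryLeft ξ with
    cont := by
      have : Continuous fun v : Fin n → T => h (Matrix.vecCons ξ v) :=
        h.cont.comp (continuous_const.matrixVecCons continuous_id)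
      exact this }

theorem contract_apply {n : ℕ} (ξ : T) (h : T [⋀^Fin (n + 1)]→L[ℝ] F) (v : Fin n → T) :
    contract ξ h v = h (Matrix.vecCons ξ v) := rfl

/-- Exterior forms on `T` that need not be homogeneous, given by their components in the
degrees `0, 1, 2, …`. -/
abbrev MixedForm (T F : Type*) [AddCommGroup T] [Module ℝ T] [TopologicalSpace T]
    [NormedAddCommGroup F] [NormedSpace ℝ F] : Type _ :=
  ∀ n : ℕ, T [⋀^Fin n]→L[ℝ] F

/-- The exterior product of a covector with a form that need not be homogeneous. -/
noncomputable def wedgeMixed (a : T →L[ℝ] ℝ) (h : MixedForm T F) : MixedForm T F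
  | 0 => 0
  | n + 1 => wedge a (h n)

/-- The product `θ^{i₁} ∧ (θ^{i₂} ∧ ⋯ (θ^{i_r} ∧ h))` for the list `i₁, …, i_r`. -/
noncomputable def wedgeList {k : ℕ} (θ : Fin k → T →L[ℝ] ℝ) :
    List (Fin k) → MixedForm T F → MixedForm T F
  | [], h => h
  | i :: l, h => wedgeMixed (θ i) (wedgeList θ l h)

/-- `α = ∑_I θ^I h_I`, where `I` runs through the multi-indices `i₁ < ⋯ < i_r` (in other words,
through the finite subsets of the index set, listed in increasing order), and where every `h_I`
is horizontal, that is, annihilated by the contractions with `ξ₁, …, ξ_k`. -/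
def IsHorizontalDecomposition {k : ℕ} (θ : Fin k → T →L[ℝ] ℝ) (ξ : Fin k → T)
    (α : MixedForm T F) (h : Finset (Fin k) → MixedForm T F) : Prop :=
  (∀ I i n, IsKilledBy (ξ i) (h I n)) ∧ α = ∑ I, wedgeList θ (I.sort (· ≤ ·)) (h I)

/-- The horizontal projection `Hor`: the component `h_∅` of the decomposition
`α = ∑_I θ^I h_I` with horizontal `h_I`. When `θ^i(ξ_j) = δ^i_j`, this decomposition exists
(`exists_isHorizontalDecomposition`) and its component `h_∅` is unique (`hor_eq`). -/
noncomputable def hor {k : ℕ} (θ : Fin k → T →L[ℝ] ℝ) (ξ : Fin k → T)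
    (α : MixedForm T F) : MixedForm T F :=
  Classical.epsilon (fun h => IsHorizontalDecomposition θ ξ α h) ∅

theorem IsKilledBy.sub {n : ℕ} {ξ : T} {α β : T [⋀^Fin n]→L[ℝ] F}
    (hα : IsKilledBy ξ α) (hβ : IsKilledBy ξ β) : IsKilledBy ξ (α - β) := by
  intro v j hv
  simp [hα v j hv, hβ v j hv]

theorem isKilledBy_wedge {n : ℕ} {ξ : T} {a : T →L[ℝ] ℝ} {h : T [⋀^Fin n]→L[ℝ] F}
    (ha : a ξ = 0) (hh : IsKilledBy ξ h) : IsKilledBy ξ (wedge a h) := by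
  intro v j hv
  rw [wedge_apply]
  refine Finset.sum_eq_zero fun i _ => ?_
  by_cases hij : j = i
  · subst hij
    simp [hv, ha]
  · obtain ⟨j', hj'⟩ := Fin.exists_succAbove_eq hij
    rw [hh (i.removeNth v) j' (by simp [Fin.removeNth, hj', hv])]
    simp

theorem isKilledBy_of_cons {n : ℕ} {ξ : T} {h : T [⋀^Fin (n + 1)]→L[ℝ] F}
    (hh : ∀ v, h (Matrix.vecCons ξ v) = 0) : IsKilledBy ξ h := by
  have h0 : ∀ v : Fin (n + 1) → T, v 0 = ξ → h v = 0 := by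
    intro v hv
    have := hh (Matrix.vecTail v)
    rwa [← hv, show Matrix.vecCons (v 0) (Matrix.vecTail v) = v from Matrix.cons_head_tail v] at this
  intro v j hv
  by_cases hj : j = 0
  · subst hj; exact h0 v hv
  · have h1 := h.toAlternatingMap.map_swap v (i := 0) (j := j) (Ne.symm hj)
    have h2 := h0 (v ∘ Equiv.swap 0 j) (by simp [hv])
    have h3 : h (v ∘ Equiv.swap 0 j) = - h v := h1
    rw [h2] at h3
    exact neg_eq_zero.mp h3.symm

theorem wedge_cons {n : ℕ} (ξ : T) (a : T →L[ℝ] ℝ) (h : T [⋀^Fin (n + 1)]→L[ℝ] F)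
    (hh : IsKilledBy ξ h) (v : Fin (n + 1) → T) :
    wedge a h (Matrix.vecCons ξ v) = a ξ • h v := by
  rw [wedge_apply, Fin.sum_univ_succ, Finset.sum_eq_zero]
  · simp
  · intro i _
    rw [hh _ 0]
    · simp
    · simp [Fin.removeNth]

theorem isKilledBy_sub_wedge {n : ℕ} (ξ : T) (a : T →L[ℝ] ℝ) (ha : a ξ = 1)
    (α : T [⋀^Fin (n + 1)]→L[ℝ] F) : IsKilledBy ξ (α - wedge a (contract ξ α)) := by
  apply isKilledBy_of_cons
  intro v
  rw [ContinuousAlternatingMap.sub_apply]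
  cases n with
  | zero =>
    rw [wedge_apply]
    simp [ha, contract_apply]
  | succ n =>
    rw [wedge_cons, ha, one_smul, contract_apply, sub_self]
    intro w j hw
    rw [contract_apply]
    exact α.map_eq_zero_of_eq _ (i := 0) (j := j.succ) (by simp [hw]) (Fin.succ_ne_zero j).symm

theorem wedge_add {n : ℕ} (a : T →L[ℝ] ℝ) (h h' : T [⋀^Fin n]→L[ℝ] F) :
    wedge a (h + h') = wedge a h + wedge a h' := by
  ext v
  simp [wedge_apply, Finset.sum_add_distrib]

theorem wedge_zero {n : ℕ} (a : T →L[ℝ] ℝ) :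
    wedge a (0 : T [⋀^Fin n]→L[ℝ] F) = 0 := by
  ext v
  simp [wedge_apply]

theorem wedgeMixed_sum {ι : Type*} (s : Finset ι) (a : T →L[ℝ] ℝ) (h : ι → MixedForm T F) :
    wedgeMixed a (∑ i ∈ s, h i) = ∑ i ∈ s, wedgeMixed a (h i) := by
  classical
  have hadd : ∀ x y : MixedForm T F, wedgeMixed a (x + y) = wedgeMixed a x + wedgeMixed a y := by
    intro x y
    funext n
    cases n with
    | zero => simp [wedgeMixed]
    | succ n => exact wedge_add _ _ _
  have hzero : wedgeMixed a (0 : MixedForm T F) = 0 := by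
    funext n
    cases n with
    | zero => simp [wedgeMixed]
    | succ n => exact wedge_zero _
  induction s using Finset.induction_on with
  | empty => simp [hzero]
  | insert i s hi ih => rw [Finset.sum_insert hi, Finset.sum_insert hi, hadd, ih]

theorem exists_partial_decomposition {k : ℕ} (θ : Fin k → T →L[ℝ] ℝ) (ξ : Fin k → T)
    (hθ : ∀ i j, θ i (ξ j) = if i = j then 1 else 0) (s : Finset (Fin k)) :
    ∀ α : MixedForm T F, ∃ h : Finset (Fin k) → MixedForm T F,
      α = ∑ I ∈ s.powerset, wedgeList θ (I.sort (· ≤ ·)) (h I) ∧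
      ∀ I, (∀ i ∈ s, ∀ n, IsKilledBy (ξ i) (h I n)) ∧
        ∀ j, (∀ n, IsKilledBy (ξ j) (α n)) → ∀ n, IsKilledBy (ξ j) (h I n) := by
  induction s using Finset.induction_on_min with
  | empty =>
    intro α
    exact ⟨fun _ => α, by simp [wedgeList], fun I => ⟨by simp, fun j hj => hj⟩⟩
  | insert a s hs ih =>
    intro α
    have has : a ∉ s := fun h => lt_irrefl _ (hs a h)
    set γ : MixedForm T F := fun n => contract (ξ a) (α (n + 1)) with hγdef
    set β : MixedForm T F := α - wedgeMixed (θ a) γ with hβdef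
    obtain ⟨hβ, hβ1, hβ2⟩ := ih β
    obtain ⟨hγ, hγ1, hγ2⟩ := ih γ
    have haa : θ a (ξ a) = 1 := by simp [hθ]
    have hγa : ∀ n, IsKilledBy (ξ a) (γ n) := by
      intro n v j hv
      simp only [hγdef, contract_apply]
      exact (α (n + 1)).map_eq_zero_of_eq _ (i := 0) (j := j.succ) (by simp [hv])
        (Fin.succ_ne_zero j).symm
    have hβa : ∀ n, IsKilledBy (ξ a) (β n) := by
      intro n
      cases n with
      | zero => intro v j; exact j.elim0
      | succ n => exact isKilledBy_sub_wedge (ξ a) (θ a) haa (α (n + 1))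
    have hγj : ∀ j, (∀ n, IsKilledBy (ξ j) (α n)) → ∀ n, IsKilledBy (ξ j) (γ n) := by
      intro j hj n v i hv
      exact hj (n + 1) _ i.succ (by simp [hv])
    have hβj : ∀ j, (∀ n, IsKilledBy (ξ j) (α n)) → ∀ n, IsKilledBy (ξ j) (β n) := by
      intro j hj n
      by_cases hja : j = a
      · subst hja; exact hβa n
      cases n with
      | zero => intro v j; exact j.elim0
      | succ n =>
        refine (hj (n + 1)).sub (isKilledBy_wedge ?_ (hγj j hj n))
        rw [hθ]; simp [Ne.symm hja]
    refine ⟨fun I => if a ∈ I then hγ (I.erase a) else hβ I, ?_, ?_⟩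
    · rw [Finset.sum_powerset_insert has]
      have e1 : ∑ I ∈ s.powerset, wedgeList θ (I.sort (· ≤ ·))
          (if a ∈ I then hγ (I.erase a) else hβ I) = β := by
        rw [hβ1]
        refine Finset.sum_congr rfl fun I hI => ?_
        rw [if_neg fun h => has (Finset.mem_powerset.mp hI h)]
      have e2 : ∑ I ∈ s.powerset, wedgeList θ ((insert a I).sort (· ≤ ·))
          (if a ∈ insert a I then hγ ((insert a I).erase a) else hβ (insert a I)) =
          wedgeMixed (θ a) γ := by
        rw [hγ1, wedgeMixed_sum]
        refine Finset.sum_congr rfl fun I hI => ?_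
        have hI' := Finset.mem_powerset.mp hI
        have haI : a ∉ I := fun h => has (hI' h)
        rw [if_pos (Finset.mem_insert_self a I), Finset.erase_insert haI,
          Finset.sort_insert _ (fun b hb => (hs b (hI' hb)).le) haI]
        rfl
      rw [e1, e2, hβdef, sub_add_cancel]
    · intro I
      by_cases haI : a ∈ I
      · simp only [haI, if_true]
        refine ⟨fun i hi n => ?_, fun j hj => (hγ2 _).2 j (hγj j hj)⟩
        rcases Finset.mem_insert.mp hi with rfl | hi
        · exact (hγ2 _).2 _ hγa n
        · exact (hγ2 _).1 i hi n
      · simp only [haI, if_false]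
        refine ⟨fun i hi n => ?_, fun j hj => (hβ2 _).2 j (hβj j hj)⟩
        rcases Finset.mem_insert.mp hi with rfl | hi
        · exact (hβ2 _).2 _ hβa n
        · exact (hβ2 _).1 i hi n

theorem exists_isHorizontalDecomposition {k : ℕ} (θ : Fin k → T →L[ℝ] ℝ) (ξ : Fin k → T)
    (hθ : ∀ i j, θ i (ξ j) = if i = j then 1 else 0) (α : MixedForm T F) :
    ∃ h, IsHorizontalDecomposition θ ξ α h := by
  obtain ⟨h, h1, h2⟩ := exists_partial_decomposition θ ξ hθ Finset.univ α
  refine ⟨h, fun I i n => (h2 I).1 i (Finset.mem_univ i) n, ?_⟩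
  rw [h1, Finset.powerset_univ]

/-- A horizontal form does not change when its arguments are projected along the `ξ_i`. -/
theorem apply_proj_of_isKilledBy {k n : ℕ} (θ : Fin k → T →L[ℝ] ℝ) (ξ : Fin k → T)
    (β : T [⋀^Fin n]→L[ℝ] F) (hβ : ∀ i, IsKilledBy (ξ i) β) (v : Fin n → T) :
    β (fun j => v j - ∑ i, θ i (v j) • ξ i) = β v := by
  classical
  set w : Fin n → T := fun j => v j - ∑ i, θ i (v j) • ξ i with hw
  have key : ∀ s : Finset (Fin n), β (s.piecewise w v) = β v := by
    intro s
    induction s using Finset.induction_on with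
    | empty => simp
    | insert j s hj ih =>
      rw [Finset.piecewise_insert]
      set u := s.piecewise w v with hu
      have huj : u j = v j := by simp [hu, hj]
      have e : β (Function.update u j (w j)) =
          β (Function.update u j (v j)) - ∑ i, θ i (v j) • β (Function.update u j (ξ i)) := by
        have h1 := β.toAlternatingMap.map_update_sub u j (v j) (∑ i, θ i (v j) • ξ i)
        have h2 := β.toAlternatingMap.map_update_sum Finset.univ j
          (fun i => θ i (v j) • ξ i) u
        have h3 : ∀ i, β.toAlternatingMap (Function.update u j (θ i (v j) • ξ i)) =
            θ i (v j) • β.toAlternatingMap (Function.update u j (ξ i)) :=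
          fun i => β.toAlternatingMap.map_update_smul u j _ _
        rw [h2] at h1
        simp only [h3] at h1
        exact h1
      rw [e, ← huj, Function.update_eq_self, ih, Finset.sum_eq_zero, sub_zero]
      intro i _
      rw [hβ i _ j (by simp), smul_zero]
  simpa using key Finset.univ

theorem wedgeList_apply_eq_zero {k : ℕ} (θ : Fin k → T →L[ℝ] ℝ) (i : Fin k) (l : List (Fin k))
    (h : MixedForm T F) (n : ℕ) (v : Fin n → T) (hv : ∀ i j, θ i (v j) = 0) :
    wedgeList θ (i :: l) h n v = 0 := by
  cases n with
  | zero => simp [wedgeList, wedgeMixed]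
  | succ n =>
    change wedge (θ i) (wedgeList θ l h n) v = 0
    rw [wedge_apply]
    simp [hv]

theorem decomposition_empty_apply {k : ℕ} {θ : Fin k → T →L[ℝ] ℝ} {ξ : Fin k → T}
    (hθ : ∀ i j, θ i (ξ j) = if i = j then 1 else 0) {α : MixedForm T F}
    {h : Finset (Fin k) → MixedForm T F} (hh : IsHorizontalDecomposition θ ξ α h)
    (n : ℕ) (v : Fin n → T) :
    h ∅ n v = α n (fun j => v j - ∑ i, θ i (v j) • ξ i) := by
  classical
  set w : Fin n → T := fun j => v j - ∑ i, θ i (v j) • ξ i with hw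
  have hw0 : ∀ i j, θ i (w j) = 0 := by
    intro i j
    simp [hw, hθ]
  have e : α n w = ∑ I, wedgeList θ (I.sort (· ≤ ·)) (h I) n w := by
    conv_lhs => rw [hh.2]
    rw [Finset.sum_apply]
    simp
  rw [e, Finset.sum_eq_single ∅]
  · simp only [Finset.sort_empty, wedgeList]
    exact (apply_proj_of_isKilledBy θ ξ (h ∅ n) (fun i => hh.1 ∅ i n) v).symm
  · intro I _ hI
    have hne : I.sort (· ≤ ·) ≠ [] := by
      intro h0
      apply hI
      rw [← Finset.sort_toFinset I (· ≤ ·), h0]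
      rfl
    obtain ⟨i, l, hil⟩ := List.exists_cons_of_ne_nil hne
    rw [hil]
    exact wedgeList_apply_eq_zero θ i l _ n w hw0
  · simp

/-- The horizontal projection is the component `h_∅` of every horizontal decomposition. -/
theorem hor_eq {k : ℕ} {θ : Fin k → T →L[ℝ] ℝ} {ξ : Fin k → T}
    (hθ : ∀ i j, θ i (ξ j) = if i = j then 1 else 0) {α : MixedForm T F}
    {h : Finset (Fin k) → MixedForm T F} (hh : IsHorizontalDecomposition θ ξ α h) :
    hor θ ξ α = h ∅ := by
  funext n
  ext v
  have hex : IsHorizontalDecomposition θ ξ α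
      (Classical.epsilon (fun h => IsHorizontalDecomposition θ ξ α h)) :=
    Classical.epsilon_spec ⟨h, hh⟩
  rw [hor, decomposition_empty_apply hθ hex, decomposition_empty_apply hθ hh]

end PointwiseAlgebra

section Forms

/-- A differential `n`-form on the manifold `N` (modelled on `E`) with values in `F`, not assumed
to be smooth: an alternating form on every tangent space. -/
abbrev DForm (E : Type*) [NormedAddCommGroup E] [NormedSpace ℝ E]
    (N : Type*) [TopologicalSpace N] [ChartedSpace E N] (n : ℕ)
    (F : Type*) [NormedAddCommGroup F] [NormedSpace ℝ F] : Type _ :=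
  ∀ x : N, TangentSpace 𝓘(ℝ, E) x [⋀^Fin n]→L[ℝ] F

variable {E : Type*} [NormedAddCommGroup E] [NormedSpace ℝ E]
  {N : Type*} [TopologicalSpace N] [ChartedSpace E N]
  {F : Type*} [NormedAddCommGroup F] [NormedSpace ℝ F]

/-- The form `α` in the chart around `x₀`: its pullback by the inverse of the chart. -/
noncomputable def DForm.inChart {n : ℕ} (α : DForm E N n F) (x₀ : N) :
    E → E [⋀^Fin n]→L[ℝ] F :=
  fun y => (α ((extChartAt 𝓘(ℝ, E) x₀).symm y)).compContinuousLinearMap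
    (mfderiv 𝓘(ℝ, E) 𝓘(ℝ, E) (extChartAt 𝓘(ℝ, E) x₀).symm y)

/-- Smoothness of a differential form, in charts. -/
def DForm.IsSmooth {n : ℕ} (α : DForm E N n F) : Prop :=
  ∀ x₀ : N, ContDiffOn ℝ ∞ (α.inChart x₀) (extChartAt 𝓘(ℝ, E) x₀).target

/-- The exterior derivative, computed at `x` in the chart around `x`. -/
noncomputable def DForm.d {n : ℕ} (α : DForm E N n F) : DForm E N (n + 1) F :=
  fun x => (extDeriv (α.inChart x) (extChartAt 𝓘(ℝ, E) x x)).compContinuousLinearMap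
    (mfderiv 𝓘(ℝ, E) 𝓘(ℝ, E) (extChartAt 𝓘(ℝ, E) x) x)

/-- A real form as a complex valued form. -/
noncomputable def DForm.toComplex {n : ℕ} (α : DForm E N n ℝ) : DForm E N n ℂ :=
  fun x => Complex.ofRealCLM.compContinuousAlternatingMap (α x)

/-- The pullback of a form by a map. -/
noncomputable def DForm.pullback {E' : Type*} [NormedAddCommGroup E'] [NormedSpace ℝ E']
    {N' : Type*} [TopologicalSpace N'] [ChartedSpace E' N'] {n : ℕ}
    (f : N' → N) (α : DForm E N n F) : DForm E' N' n F :=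
  fun x => (α (f x)).compContinuousLinearMap (mfderiv 𝓘(ℝ, E') 𝓘(ℝ, E) f x)

end Forms

section Kahler

variable (E : Type*) [NormedAddCommGroup E] [NormedSpace ℝ E]
  (M : Type*) [TopologicalSpace M] [ChartedSpace E M] [IsManifold 𝓘(ℝ, E) ∞ M]

/-- A Kähler structure on a smooth manifold `M`: an integrable almost complex structure `J` and
a closed `2`-form `ω` with `ω(Jv, Jw) = ω(v, w)` and `ω(v, Jv) > 0` for `v ≠ 0`. -/
structure KahlerStructure where
  /-- the almost complex structure -/
  J : ∀ x : M, TangentSpace 𝓘(ℝ, E) x →L[ℝ] TangentSpace 𝓘(ℝ, E) x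
  /-- the Kähler form `ω` -/
  form : DForm E M 2 ℝ
  smooth_J : ContMDiff 𝓘(ℝ, E) (𝓘(ℝ, E).prod 𝓘(ℝ, E →L[ℝ] E)) ∞
    (fun x => Bundle.TotalSpace.mk' (E →L[ℝ] E)
      (E := fun x : M => TangentSpace 𝓘(ℝ, E) x →L[ℝ] TangentSpace 𝓘(ℝ, E) x) x (J x))
  J_J : ∀ x v, J x (J x v) = -v
  /-- Integrability: the Nijenhuis tensor vanishes on all local smooth vector fields. -/
  nijenhuis : ∀ (U : Set M), IsOpen U → ∀ X Y : ∀ x : M, TangentSpace 𝓘(ℝ, E) x,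
    ContMDiffOn 𝓘(ℝ, E) 𝓘(ℝ, E).tangent ∞ (fun x => (⟨x, X x⟩ : TangentBundle 𝓘(ℝ, E) M)) U →
    ContMDiffOn 𝓘(ℝ, E) 𝓘(ℝ, E).tangent ∞ (fun x => (⟨x, Y x⟩ : TangentBundle 𝓘(ℝ, E) M)) U →
    ∀ x ∈ U,
      VectorField.mlieBracket 𝓘(ℝ, E) (fun y => J y (X y)) (fun y => J y (Y y)) x
        - J x (VectorField.mlieBracket 𝓘(ℝ, E) (fun y => J y (X y)) Y x)
        - J x (VectorField.mlieBracket 𝓘(ℝ, E) X (fun y => J y (Y y)) x)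
        - VectorField.mlieBracket 𝓘(ℝ, E) X Y x = 0
  smooth_form : form.IsSmooth
  closed_form : form.d = 0
  compatible : ∀ x v w, form x ![J x v, J x w] = form x ![v, w]
  pos : ∀ x v, v ≠ 0 → 0 < form x ![v, J x v]

variable {E M}

/-- The Kähler metric `g(v, w) = ω(v, J w)`. -/
noncomputable def KahlerStructure.g (S : KahlerStructure E M) (x : M)
    (v w : TangentSpace 𝓘(ℝ, E) x) : ℝ :=
  S.form x ![v, S.J x w]

theorem KahlerStructure.g_symm (S : KahlerStructure E M) (x : M)
    (v w : TangentSpace 𝓘(ℝ, E) x) : S.g x v w = S.g x w v := by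
  unfold KahlerStructure.g
  rw [← S.compatible x v, S.J_J]
  have h1 := (S.form x).toAlternatingMap.map_swap ![S.J x v, -w] (i := 0) (j := 1) (by decide)
  have h2 : (![S.J x v, -w] ∘ Equiv.swap (0 : Fin 2) 1) = ![-w, S.J x v] := by
    funext i; fin_cases i <;> rfl
  rw [h2] at h1
  have h4 : S.form x ![-w, S.J x v] = -S.form x ![S.J x v, -w] := h1
  have h5 : S.form x ![(-1 : ℝ) • w, S.J x v] = (-1 : ℝ) • S.form x ![w, S.J x v] :=
    (S.form x).toAlternatingMap.map_vecCons_smul ![S.J x v] (-1) w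
  rw [neg_one_smul, neg_one_smul] at h5
  linarith

theorem KahlerStructure.g_add_left (S : KahlerStructure E M) (x : M)
    (v v' w : TangentSpace 𝓘(ℝ, E) x) : S.g x (v + v') w = S.g x v w + S.g x v' w :=
  (S.form x).toAlternatingMap.map_vecCons_add ![S.J x w] v v'

theorem KahlerStructure.g_smul_left (S : KahlerStructure E M) (x : M) (r : ℝ)
    (v w : TangentSpace 𝓘(ℝ, E) x) : S.g x (r • v) w = r * S.g x v w :=
  (S.form x).toAlternatingMap.map_vecCons_smul ![S.J x w] r v

theorem KahlerStructure.g_J_J (S : KahlerStructure E M) (x : M)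
    (v w : TangentSpace 𝓘(ℝ, E) x) : S.g x (S.J x v) (S.J x w) = S.g x v w :=
  S.compatible x v (S.J x w)

/-- The differential form `α` is of type `(p, q)` with respect to the complex structure. -/
def KahlerStructure.IsType (S : KahlerStructure E M) (p q : ℕ) (α : DForm E M (p + q) ℂ) : Prop :=
  ∀ x, (α x).toAlternatingMap ∈ typePQ (S.J x : TangentSpace 𝓘(ℝ, E) x →ₗ[ℝ] _) p q

end Kahler

section Action

variable {G : Type*} [NormedAddCommGroup G] [NormedSpace ℝ G]
  {K : Type*} [TopologicalSpace K] [ChartedSpace G K] [Group K]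

/-- The adjoint representation: the derivative of `h ↦ k h k⁻¹` at the identity. -/
noncomputable def Ad (k : K) : GroupLieAlgebra 𝓘(ℝ, G) K →L[ℝ] GroupLieAlgebra 𝓘(ℝ, G) K :=
  mfderiv 𝓘(ℝ, G) 𝓘(ℝ, G) (fun h : K => k * h * k⁻¹) 1

/-- The fundamental vector fields `ξ_N(x) = d/dt|₀ exp(-tξ) · x` of a left action of `K` on `N`,
as a linear map in `ξ`. With this sign, `ξ ↦ ξ_N` is a homomorphism of Lie algebras. -/
noncomputable def fundamentalField {E : Type*} [NormedAddCommGroup E] [NormedSpace ℝ E]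
    {N : Type*} [TopologicalSpace N] [ChartedSpace E N] (act : K → N → N) (x : N) :
    GroupLieAlgebra 𝓘(ℝ, G) K →L[ℝ] TangentSpace 𝓘(ℝ, E) x :=
  mfderiv 𝓘(ℝ, G) 𝓘(ℝ, E) (fun k : K => act k⁻¹ x) 1

end Action

section Reduction

variable {E : Type*} [NormedAddCommGroup E] [NormedSpace ℝ E] [FiniteDimensional ℝ E]
  {M : Type*} [TopologicalSpace M] [ChartedSpace E M] [IsManifold 𝓘(ℝ, E) ∞ M]
  {G : Type*} [NormedAddCommGroup G] [NormedSpace ℝ G] [FiniteDimensional ℝ G]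
  {K : Type*} [TopologicalSpace K] [ChartedSpace G K] [Group K] [LieGroup 𝓘(ℝ, G) ∞ K]
  [MulAction K M] [ContMDiffSMul 𝓘(ℝ, G) 𝓘(ℝ, E) ∞ K M]

/-- The action of `K` on `M` is holomorphic: its elements act by maps whose derivatives commute
with `J`. -/
def IsHolomorphicAction (K : Type*) [Group K] [MulAction K M] (S : KahlerStructure E M) : Prop :=
  ∀ (k : K) (x : M) (v : TangentSpace 𝓘(ℝ, E) x),
    mfderiv 𝓘(ℝ, E) 𝓘(ℝ, E) (fun y : M => k • y) x (S.J x v) =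
      S.J (k • x) (mfderiv 𝓘(ℝ, E) 𝓘(ℝ, E) (fun y : M => k • y) x v)

/-- `Φ` is a moment map for the action of the Lie group `K` on `(M, ω)`. It takes its values in the
dual of the Lie algebra `𝔨 = T₁K`, which is as a normed space the model space `G` of `K`.
It is smooth, equivariant for the coadjoint action, `⟨Φ(k x), ξ⟩ = ⟨Φ(x), Ad(k⁻¹) ξ⟩`, and
it satisfies `-ω(ξ_M, v) = d⟨Φ, ξ⟩(v)`. -/
structure IsMomentMap (K : Type*) [TopologicalSpace K] [ChartedSpace G K] [Group K] [MulAction K M]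
    (S : KahlerStructure E M) (Φ : M → G →L[ℝ] ℝ) : Prop where
  smooth : ContMDiff 𝓘(ℝ, E) 𝓘(ℝ, G →L[ℝ] ℝ) ∞ Φ
  equivariant : ∀ (k : K) (x : M) (ξ : GroupLieAlgebra 𝓘(ℝ, G) K),
    Φ (k • x) ξ = Φ x (Ad k⁻¹ ξ)
  hamilton : ∀ (x : M) (ξ : GroupLieAlgebra 𝓘(ℝ, G) K) (v : TangentSpace 𝓘(ℝ, E) x),
    -S.form x ![fundamentalField (fun (k : K) (y : M) => k • y) x ξ, v] =
      mfderiv 𝓘(ℝ, E) 𝓘(ℝ, ℝ) (fun y => Φ y ξ) x v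

/-- `0` is a regular value of `Φ`. -/
def IsRegularValueZero (Φ : M → G →L[ℝ] ℝ) : Prop :=
  ∀ x, Φ x = 0 → Function.Surjective (mfderiv 𝓘(ℝ, E) 𝓘(ℝ, G →L[ℝ] ℝ) Φ x)

/-- The zero level set `Z = Φ⁻¹(0)`. -/
abbrev ZeroLevel (Φ : M → G →L[ℝ] ℝ) : Type _ := {x : M // Φ x = 0}

/-- A Hamiltonian holomorphic action of the Lie group `K` on the Kähler manifold `M` with moment
map `Φ` such that `0` is a regular value, the level set `Z = Φ⁻¹(0)` being given its structure of
an embedded submanifold of `M`. -/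
structure IsKahlerReduction (E' : Type*) [NormedAddCommGroup E'] [NormedSpace ℝ E']
    (K : Type*) [TopologicalSpace K] [ChartedSpace G K] [Group K]
    [MulAction K M] (S : KahlerStructure E M) (Φ : M → G →L[ℝ] ℝ)
    [ChartedSpace E' (ZeroLevel Φ)] : Prop where
  holomorphic : IsHolomorphicAction K S
  moment : IsMomentMap K S Φ
  regular : IsRegularValueZero (E := E) Φ
  embedded : Manifold.IsSmoothEmbedding 𝓘(ℝ, E') 𝓘(ℝ, E) ∞ (Subtype.val : ZeroLevel Φ → M)

variable {E' : Type*} [NormedAddCommGroup E'] [NormedSpace ℝ E'] [FiniteDimensional ℝ E']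
  {S : KahlerStructure E M} {Φ : M → G →L[ℝ] ℝ} [ChartedSpace E' (ZeroLevel Φ)]
  [IsManifold 𝓘(ℝ, E') ∞ (ZeroLevel Φ)]

theorem IsMomentMap.smul_mem (h : IsMomentMap K S Φ) (k : K) (z : ZeroLevel Φ) :
    Φ (k • z.1) = 0 := by
  ext ξ
  rw [h.equivariant k z.1 ξ, z.2]
  rfl

/-- The action of `K` on the zero level set. -/
def IsMomentMap.act (h : IsMomentMap K S Φ) (k : K) (z : ZeroLevel Φ) : ZeroLevel Φ :=
  ⟨k • z.1, h.smul_mem k z⟩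

/-- The derivative `T_z Z → T_z M` of the inclusion. -/
noncomputable def IsKahlerReduction.inclDeriv (_h : IsKahlerReduction E' K S Φ) (z : ZeroLevel Φ) :
    TangentSpace 𝓘(ℝ, E') z →L[ℝ] TangentSpace 𝓘(ℝ, E) z.1 :=
  mfderiv 𝓘(ℝ, E') 𝓘(ℝ, E) (Subtype.val : ZeroLevel Φ → M) z

/-- The fundamental vector fields `ξ_Z` on the zero level set. -/
noncomputable def IsKahlerReduction.field (h : IsKahlerReduction E' K S Φ) (z : ZeroLevel Φ) :
    GroupLieAlgebra 𝓘(ℝ, G) K →L[ℝ] TangentSpace 𝓘(ℝ, E') z :=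
  fundamentalField h.moment.act z

theorem IsKahlerReduction.inclDeriv_injective (h : IsKahlerReduction E' K S Φ) (z : ZeroLevel Φ) :
    Function.Injective (h.inclDeriv z) := by
  have hemb := h.embedded
  have hz := hemb.isImmersion.isImmersionAt z
  have hone : (1 : WithTop ℕ∞) ≤ ∞ := by exact_mod_cast le_top
  have hne : (∞ : WithTop ℕ∞) ≠ 0 := by simp
  have hd : MDifferentiableAt 𝓘(ℝ, E') 𝓘(ℝ, E') hz.domChart z :=
    (contMDiffAt_of_mem_maximalAtlas hz.domChart_mem_maximalAtlas
      hz.mem_domChart_source).mdifferentiableAt hne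
  have hds : MDifferentiableAt 𝓘(ℝ, E') 𝓘(ℝ, E') hz.domChart.symm (hz.domChart z) :=
    (contMDiffAt_symm_of_mem_maximalAtlas hz.domChart_mem_maximalAtlas
      (hz.domChart.map_source hz.mem_domChart_source)).mdifferentiableAt hne
  have hc : MDifferentiableAt 𝓘(ℝ, E) 𝓘(ℝ, E) hz.codChart z.1 :=
    (contMDiffAt_of_mem_maximalAtlas hz.codChart_mem_maximalAtlas
      hz.mem_codChart_source).mdifferentiableAt hne
  have hι : MDifferentiableAt 𝓘(ℝ, E') 𝓘(ℝ, E) (Subtype.val : ZeroLevel Φ → M) z :=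
    (hemb.contMDiff z).mdifferentiableAt hne
  set pr : E →L[ℝ] E' :=
    (ContinuousLinearMap.fst ℝ E' hz.complement) ∘L (hz.equiv.symm : E →L[ℝ] _) with hpr
  have hprd : MDifferentiableAt 𝓘(ℝ, E) 𝓘(ℝ, E') pr (hz.codChart z.1) :=
    pr.differentiableAt.mdifferentiableAt
  set r : M → ZeroLevel Φ := hz.domChart.symm ∘ (pr ∘ hz.codChart) with hr
  have hev : ∀ y ∈ hz.domChart.source, pr (hz.codChart y.1) = hz.domChart y := by
    intro y hy
    have hmem : hz.domChart y ∈ (hz.domChart.extend 𝓘(ℝ, E')).target := by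
      simpa using hz.domChart.map_source hy
    have h1 := hz.writtenInCharts hmem
    simp only [OpenPartialHomeomorph.extend, Function.comp_apply] at h1
    simp [hy] at h1
    rw [hpr]
    simp [h1]
  have hrz : pr (hz.codChart z.1) = hz.domChart z := hev z hz.mem_domChart_source
  have hr1 : MDifferentiableAt 𝓘(ℝ, E) 𝓘(ℝ, E') (pr ∘ hz.codChart) z.1 := hprd.comp _ hc
  have hr2 : MDifferentiableAt 𝓘(ℝ, E) 𝓘(ℝ, E') r z.1 := by
    refine MDifferentiableAt.comp (g := hz.domChart.symm) z.1 ?_ hr1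
    change MDifferentiableAt _ _ hz.domChart.symm (pr (hz.codChart z.1))
    rw [hrz]; exact hds
  have hid : r ∘ (Subtype.val : ZeroLevel Φ → M) =ᶠ[nhds z] id := by
    filter_upwards [hz.domChart.open_source.mem_nhds hz.mem_domChart_source] with y hy
    simp [hr, hev y hy, hy]
  have hcomp := mfderiv_comp z hr2 hι
  rw [hid.mfderiv_eq, mfderiv_id] at hcomp
  intro v w hvw
  have e1 := DFunLike.congr_fun hcomp v
  have e2 := DFunLike.congr_fun hcomp w
  have e3 : (mfderiv 𝓘(ℝ, E) 𝓘(ℝ, E') r z.1) (h.inclDeriv z v) =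
    (mfderiv 𝓘(ℝ, E) 𝓘(ℝ, E') r z.1) (h.inclDeriv z w) := by rw [hvw]
  exact e1.trans (e3.trans e2.symm)

theorem IsKahlerReduction.inclDeriv_field (h : IsKahlerReduction E' K S Φ) (z : ZeroLevel Φ)
    (ξ : GroupLieAlgebra 𝓘(ℝ, G) K) :
    h.inclDeriv z (h.field z ξ) =
      fundamentalField (fun (k : K) (y : M) => k • y) z.1 ξ := by
  have hne : (∞ : WithTop ℕ∞) ≠ 0 := by simp
  have hz1 : h.moment.act (1 : K)⁻¹ z = z := by
    apply Subtype.ext; simp [IsMomentMap.act]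
  have hM : ContMDiff 𝓘(ℝ, G) 𝓘(ℝ, E) ∞ (fun k : K => k⁻¹ • z.1) := by
    have h1 : ContMDiff 𝓘(ℝ, G) (𝓘(ℝ, G).prod 𝓘(ℝ, E)) ∞ (fun k : K => (k⁻¹, z.1)) :=
      (contMDiff_inv 𝓘(ℝ, G) ∞).prodMk contMDiff_const
    exact (contMDiff_smul (I := 𝓘(ℝ, G)) (I' := 𝓘(ℝ, E)) (n := ∞) (G := K) (M := M)).comp h1
  have hZ : MDifferentiableAt 𝓘(ℝ, G) 𝓘(ℝ, E') (fun k : K => h.moment.act k⁻¹ z) 1 := by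
    refine ContMDiffAt.mdifferentiableAt (n := ∞) ?_ hne
    rw [ContMDiffAt.iff_comp_isImmersionAt (h.embedded.isImmersion.isImmersionAt _)]
    exact ⟨(hM.continuous.subtype_mk _).continuousAt, hM 1⟩
  have hι : MDifferentiableAt 𝓘(ℝ, E') 𝓘(ℝ, E) (Subtype.val : ZeroLevel Φ → M) z :=
    (h.embedded.contMDiff z).mdifferentiableAt hne
  exact (mfderiv_comp_apply_of_eq (f := fun k : K => h.moment.act k⁻¹ z) 1 hι hZ hz1 ξ).symm

theorem IsKahlerReduction.range_inclDeriv (h : IsKahlerReduction E' K S Φ) (z : ZeroLevel Φ)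
    (v : TangentSpace 𝓘(ℝ, E) z.1) (hv : mfderiv 𝓘(ℝ, E) 𝓘(ℝ, G →L[ℝ] ℝ) Φ z.1 v = 0) :
    ∃ w : TangentSpace 𝓘(ℝ, E') z, h.inclDeriv z w = v := by
  have : CompleteSpace E := FiniteDimensional.complete ℝ E
  have hne : (∞ : WithTop ℕ∞) ≠ 0 := by simp
  set φ := extChartAt 𝓘(ℝ, E) z.1 with hφ
  set a : E := φ z.1 with ha
  have hφa : φ.symm a = z.1 := extChartAt_to_inv (I := 𝓘(ℝ, E)) z.1
  have hsymm : ContMDiffAt 𝓘(ℝ, E) 𝓘(ℝ, E) ∞ φ.symm a :=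
    (contMDiffOn_extChartAt_symm z.1).contMDiffAt (extChartAt_target_mem_nhds z.1)
  have hchart : MDifferentiableAt 𝓘(ℝ, E) 𝓘(ℝ, E) φ z.1 :=
    (contMDiffAt_extChartAt (n := 1)).mdifferentiableAt (by simp)
  have hΦz : MDifferentiableAt 𝓘(ℝ, E) 𝓘(ℝ, G →L[ℝ] ℝ) Φ z.1 :=
    (h.moment.smooth z.1).mdifferentiableAt hne
  set B : E →L[ℝ] TangentSpace 𝓘(ℝ, E) z.1 := mfderiv 𝓘(ℝ, E) 𝓘(ℝ, E) φ.symm a with hB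
  set B' : TangentSpace 𝓘(ℝ, E) z.1 →L[ℝ] E := mfderiv 𝓘(ℝ, E) 𝓘(ℝ, E) φ z.1 with hB'
  have hBB' : ∀ u, B (B' u) = u := by
    intro u
    have hid : φ.symm ∘ φ =ᶠ[nhds z.1] id := by
      filter_upwards [extChartAt_source_mem_nhds (I := 𝓘(ℝ, E)) z.1] with y hy
      exact φ.left_inv hy
    have hcomp := mfderiv_comp (g := φ.symm) (f := φ) z.1
      (hsymm.mdifferentiableAt hne) hchart
    rw [hid.mfderiv_eq, mfderiv_id] at hcomp
    exact (DFunLike.congr_fun hcomp u).symm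
  set f : E → (G →L[ℝ] ℝ) := Φ ∘ φ.symm with hf
  have hfa : f a = 0 := by rw [hf, Function.comp_apply, hφa, z.2]
  have hfsm : ContDiffAt ℝ ∞ f a := by
    rw [← contMDiffAt_iff_contDiffAt]
    refine ContMDiffAt.comp a ?_ hsymm
    exact h.moment.smooth _
  have hA : ∀ u, fderiv ℝ f a u = mfderiv 𝓘(ℝ, E) 𝓘(ℝ, G →L[ℝ] ℝ) Φ z.1 (B u) := by
    intro u
    rw [← mfderiv_eq_fderiv]
    exact mfderiv_comp_apply_of_eq a hΦz (hsymm.mdifferentiableAt hne) hφa u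
  set A := fderiv ℝ f a with hAdef
  have hAsurj : Function.Surjective A := by
    intro y
    obtain ⟨u, hu⟩ := h.regular z.1 z.2 y
    refine ⟨B' u, ?_⟩
    rw [hA, hBB']; exact hu
  obtain ⟨R₀, hR₀⟩ := LinearMap.exists_rightInverse_of_surjective (A : E →ₗ[ℝ] (G →L[ℝ] ℝ))
    (LinearMap.range_eq_top.mpr hAsurj)
  set R : (G →L[ℝ] ℝ) →L[ℝ] E := LinearMap.toContinuousLinearMap R₀ with hR
  have hAR : ∀ y, A (R y) = y := fun y => LinearMap.congr_fun hR₀ y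
  set v' : E := B' v with hv'
  have hAv : A v' = 0 := by rw [hA, hBB']; exact hv
  set L : ℝ × (G →L[ℝ] ℝ) →L[ℝ] E :=
    (ContinuousLinearMap.fst ℝ ℝ (G →L[ℝ] ℝ)).smulRight v' +
      R ∘L ContinuousLinearMap.snd ℝ ℝ (G →L[ℝ] ℝ) with hL
  set F : ℝ × (G →L[ℝ] ℝ) → (G →L[ℝ] ℝ) := fun p => f (a + L p) with hF
  have hF0 : HasFDerivAt F (A ∘L L) (0, 0) := by
    have h1 : HasFDerivAt (fun p => a + L p) L (0, 0) := L.hasFDerivAt.const_add a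
    have h2 : HasFDerivAt f A (a + L (0, 0)) := by
      have : a + L (0, 0) = a := by simp [hL]
      rw [this]; exact (hfsm.differentiableAt hne).hasFDerivAt
    exact HasFDerivAt.comp (g := f) (f := fun p => a + L p) (0, 0) h2 h1
  have hFsm : ContDiffAt ℝ ∞ F (0, 0) := by
    have h1 : ContDiffAt ℝ ∞ (fun p => a + L p) ((0, 0) : ℝ × (G →L[ℝ] ℝ)) :=
      contDiffAt_const.add L.contDiff.contDiffAt
    refine ContDiffAt.comp (g := f) _ ?_ h1
    have : a + L (0, 0) = a := by simp [hL]
    rw [this]; exact hfsm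
  have hinr : fderiv ℝ F (0, 0) ∘L .inr ℝ ℝ (G →L[ℝ] ℝ) = ContinuousLinearMap.id ℝ _ := by
    rw [hF0.fderiv]
    refine ContinuousLinearMap.ext fun y => ?_
    change A (L (0, y)) = y
    simp [hL, hAR]
  have hinl : fderiv ℝ F (0, 0) ∘L .inl ℝ ℝ (G →L[ℝ] ℝ) = 0 := by
    rw [hF0.fderiv]
    refine ContinuousLinearMap.ext fun y => ?_
    change A (L (y, 0)) = 0
    simp [hL, hAv]
  have hinv : (fderiv ℝ F (0, 0) ∘L .inr ℝ ℝ (G →L[ℝ] ℝ)).IsInvertible := by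
    rw [hinr]; exact ContinuousLinearMap.isInvertible_equiv (f := ContinuousLinearEquiv.refl ℝ _)
  set s := hFsm.implicitFunction hne hinv with hs
  have hs0 : s 0 = 0 := hFsm.implicitFunction_apply_self hne hinv
  have hssm : ContDiffAt ℝ ∞ s 0 := hFsm.contDiffAt_implicitFunction hne hinv
  have hsd : HasFDerivAt s (0 : ℝ →L[ℝ] (G →L[ℝ] ℝ)) 0 := by
    have := (hFsm.hasStrictFDerivAt_implicitFunction hne hinv).hasFDerivAt
    rw [hinl, ContinuousLinearMap.comp_zero] at this
    simpa using this
  have hsev : ∀ᶠ t in nhds (0 : ℝ), F (t, s t) = F (0, 0) :=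
    hFsm.eventually_apply_implicitFunction hne hinv
  have hF00 : F (0, 0) = 0 := by simp [hF, hL, hfa]
  set e : ℝ → E := fun t => a + L (t, s t) with he
  have he0 : e 0 = a := by simp [he, hL, hs0]
  have hesm : ContDiffAt ℝ ∞ e 0 :=
    contDiffAt_const.add (L.contDiff.contDiffAt.comp _ (contDiffAt_id.prodMk hssm))
  have hed : fderiv ℝ e 0 1 = v' := by
    have h1 : HasFDerivAt e (L ∘L ((ContinuousLinearMap.id ℝ ℝ).prod 0)) 0 := by
      have h2 : HasFDerivAt (fun t : ℝ => (t, s t)) ((ContinuousLinearMap.id ℝ ℝ).prod 0) 0 :=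
        (hasFDerivAt_id 0).prodMk hsd
      exact (L.hasFDerivAt.comp 0 h2).const_add a
    rw [h1.fderiv]
    simp [hL]
  set c : ℝ → M := φ.symm ∘ e with hc
  have hc0 : c 0 = z.1 := by rw [hc, Function.comp_apply, he0, hφa]
  have hsymm' : ContMDiffAt 𝓘(ℝ, E) 𝓘(ℝ, E) ∞ φ.symm (e 0) := by rw [he0]; exact hsymm
  have hcsm : ContMDiffAt 𝓘(ℝ, ℝ) 𝓘(ℝ, E) ∞ c 0 := hsymm'.comp 0 hesm.contMDiffAt
  have hcev : ∀ᶠ t in nhds (0 : ℝ), Φ (c t) = 0 := by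
    filter_upwards [hsev] with t ht
    rw [hF00] at ht
    exact ht
  classical
  set C : ℝ → ZeroLevel Φ := fun t => if ht : Φ (c t) = 0 then ⟨c t, ht⟩ else z with hC
  have hCev : (Subtype.val : ZeroLevel Φ → M) ∘ C =ᶠ[nhds 0] c := by
    filter_upwards [hcev] with t ht
    simp [hC, ht]
  have hC0 : C 0 = z := by
    apply Subtype.ext
    exact hCev.self_of_nhds.trans hc0
  have hCsm' : ContMDiffAt 𝓘(ℝ, ℝ) 𝓘(ℝ, E) ∞ ((Subtype.val : ZeroLevel Φ → M) ∘ C) 0 :=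
    hcsm.congr_of_eventuallyEq hCev
  have hCsm : MDifferentiableAt 𝓘(ℝ, ℝ) 𝓘(ℝ, E') C 0 := by
    refine ContMDiffAt.mdifferentiableAt (n := ∞) ?_ hne
    rw [ContMDiffAt.iff_comp_isImmersionAt (h.embedded.isImmersion.isImmersionAt _)]
    exact ⟨Topology.IsInducing.subtypeVal.continuousAt_iff.mpr hCsm'.continuousAt, hCsm'⟩
  have hι : MDifferentiableAt 𝓘(ℝ, E') 𝓘(ℝ, E) (Subtype.val : ZeroLevel Φ → M) z :=
    (h.embedded.contMDiff z).mdifferentiableAt hne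
  refine ⟨(mfderiv 𝓘(ℝ, ℝ) 𝓘(ℝ, E') C 0 : ℝ →L[ℝ] E') (1 : ℝ), ?_⟩
  have k1 := mfderiv_comp_apply_of_eq (f := C) 0 hι hCsm hC0 (1 : ℝ)
  rw [hCev.mfderiv_eq] at k1
  have k2 := mfderiv_comp_apply_of_eq (f := e) (g := φ.symm) 0
    (hsymm.mdifferentiableAt hne) (hesm.contMDiffAt.mdifferentiableAt hne) he0 (1 : ℝ)
  have k3 : (mfderiv 𝓘(ℝ, ℝ) 𝓘(ℝ, E) e 0 : ℝ →L[ℝ] E) (1 : ℝ) = v' := by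
    rw [mfderiv_eq_fderiv]; exact hed
  exact k1.symm.trans (k2.trans ((congrArg B k3).trans (hBB' v)))

/-- The tangent space `V_z` of the orbit through `z`: all `ξ_Z(z)` with `ξ` in the Lie algebra. -/
noncomputable def IsKahlerReduction.V (h : IsKahlerReduction E' K S Φ) (z : ZeroLevel Φ) :
    Submodule ℝ (TangentSpace 𝓘(ℝ, E') z) :=
  LinearMap.range (h.field z : GroupLieAlgebra 𝓘(ℝ, G) K →ₗ[ℝ] TangentSpace 𝓘(ℝ, E') z)

/-- The Kähler metric restricted to `T_z Z`, as a bilinear form. -/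
noncomputable def IsKahlerReduction.gZ (h : IsKahlerReduction E' K S Φ) (z : ZeroLevel Φ) :
    LinearMap.BilinForm ℝ (TangentSpace 𝓘(ℝ, E') z) :=
  LinearMap.mk₂ ℝ (fun v w => S.g z.1 (h.inclDeriv z v) (h.inclDeriv z w))
    (fun v v' w => by rw [map_add, S.g_add_left])
    (fun r v w => by rw [map_smul, S.g_smul_left, smul_eq_mul])
    (fun v w w' => by rw [map_add, S.g_symm, S.g_add_left, S.g_symm, S.g_symm z.1 (h.inclDeriv z w')])
    (fun r v w => by rw [map_smul, S.g_symm, S.g_smul_left, S.g_symm, smul_eq_mul])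

theorem IsKahlerReduction.gZ_apply (h : IsKahlerReduction E' K S Φ) (z : ZeroLevel Φ)
    (v w : TangentSpace 𝓘(ℝ, E') z) :
    h.gZ z v w = S.g z.1 (h.inclDeriv z v) (h.inclDeriv z w) := rfl

/-- The orthogonal complement `E_z` (here `h.H z`) of `V_z` in `T_z Z`. -/
noncomputable def IsKahlerReduction.H (h : IsKahlerReduction E' K S Φ) (z : ZeroLevel Φ) :
    Submodule ℝ (TangentSpace 𝓘(ℝ, E') z) :=
  (h.gZ z).orthogonal (h.V z)

theorem IsKahlerReduction.isCompl (h : IsKahlerReduction E' K S Φ) (z : ZeroLevel Φ) :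
    IsCompl (h.V z) (h.H z) := by
  have : FiniteDimensional ℝ (TangentSpace 𝓘(ℝ, E') z) :=
    inferInstanceAs (FiniteDimensional ℝ E')
  have hrefl : (h.gZ z).IsRefl := fun v w hvw => by
    rw [h.gZ_apply, S.g_symm]; exact hvw
  refine (LinearMap.BilinForm.isCompl_orthogonal_iff_disjoint hrefl).mpr ?_
  rw [Submodule.disjoint_def]
  intro v hv hv'
  have h0 : S.g z.1 (h.inclDeriv z v) (h.inclDeriv z v) = 0 := hv' v hv
  by_contra hne
  have h1 : h.inclDeriv z v ≠ 0 := by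
    intro h2
    exact hne (h.inclDeriv_injective z (by rw [h2, map_zero]))
  exact (S.pos z.1 _ h1).ne' h0

/-- `E_z` is invariant under `J`. -/
theorem IsKahlerReduction.exists_J (h : IsKahlerReduction E' K S Φ) (z : ZeroLevel Φ)
    (v : h.H z) : ∃ w : h.H z, h.inclDeriv z (w : TangentSpace 𝓘(ℝ, E') z) =
      S.J z.1 (h.inclDeriv z (v : TangentSpace 𝓘(ℝ, E') z)) := by
  have hne : (∞ : WithTop ℕ∞) ≠ 0 := by simp
  have hΦz : MDifferentiableAt 𝓘(ℝ, E) 𝓘(ℝ, G →L[ℝ] ℝ) Φ z.1 :=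
    (h.moment.smooth z.1).mdifferentiableAt hne
  have hι : MDifferentiableAt 𝓘(ℝ, E') 𝓘(ℝ, E) (Subtype.val : ZeroLevel Φ → M) z :=
    (h.embedded.contMDiff z).mdifferentiableAt hne
  let dΦ : TangentSpace 𝓘(ℝ, E) z.1 →L[ℝ] (G →L[ℝ] ℝ) := mfderiv 𝓘(ℝ, E) 𝓘(ℝ, G →L[ℝ] ℝ) Φ z.1
  have hpair : ∀ (ξ : GroupLieAlgebra 𝓘(ℝ, G) K) (u : TangentSpace 𝓘(ℝ, E) z.1),
      S.form z.1 ![h.inclDeriv z (h.field z ξ), u] =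
        -dΦ u ξ := by
    intro ξ u
    have h1 := h.moment.hamilton z.1 ξ u
    have h2 : mfderiv 𝓘(ℝ, E) 𝓘(ℝ, ℝ) (fun y => Φ y ξ) z.1 u =
        dΦ u ξ := by
      let ev : (G →L[ℝ] ℝ) →L[ℝ] ℝ := ContinuousLinearMap.apply ℝ ℝ (ξ : G)
      have h3 := mfderiv_comp_apply (f := Φ) (g := ev) z.1
        (ev.differentiableAt.mdifferentiableAt) hΦz u
      rw [mfderiv_eq_fderiv, ev.fderiv] at h3
      exact h3
    rw [h.inclDeriv_field, ← h2, ← h1, neg_neg]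
  have horth : ∀ ξ : GroupLieAlgebra 𝓘(ℝ, G) K,
      S.g z.1 (h.inclDeriv z (h.field z ξ)) (h.inclDeriv z v.1) = 0 :=
    fun ξ => v.2 _ ⟨ξ, rfl⟩
  have hker : mfderiv 𝓘(ℝ, E) 𝓘(ℝ, G →L[ℝ] ℝ) Φ z.1 (S.J z.1 (h.inclDeriv z v.1)) = 0 := by
    refine ContinuousLinearMap.ext fun ξ => ?_
    have h1 := hpair ξ (S.J z.1 (h.inclDeriv z v.1))
    have h2 : S.form z.1 ![h.inclDeriv z (h.field z ξ), S.J z.1 (h.inclDeriv z v.1)] = 0 :=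
      horth ξ
    rw [h2] at h1
    exact neg_eq_zero.mp h1.symm
  obtain ⟨w, hw⟩ := h.range_inclDeriv z _ hker
  refine ⟨⟨w, ?_⟩, hw⟩
  rintro _ ⟨ξ, rfl⟩
  change S.g z.1 (h.inclDeriv z (h.field z ξ)) (h.inclDeriv z w) = 0
  have htan : dΦ (h.inclDeriv z v.1) = 0 := by
    have h1 := mfderiv_comp_apply (f := (Subtype.val : ZeroLevel Φ → M)) (g := Φ) z hΦz hι v.1
    have h2 : Φ ∘ (Subtype.val : ZeroLevel Φ → M) = fun _ => 0 := by
      funext y; exact y.2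
    rw [h2, mfderiv_const] at h1
    exact h1.symm
  have h3 := hpair ξ (h.inclDeriv z v.1)
  rw [htan] at h3
  have h4 : S.g z.1 (h.inclDeriv z (h.field z ξ)) (S.J z.1 (h.inclDeriv z v.1)) =
      S.form z.1 ![h.inclDeriv z (h.field z ξ), -(h.inclDeriv z v.1)] := by
    rw [KahlerStructure.g, S.J_J]
  have h5 := hpair ξ (-(h.inclDeriv z v.1))
  rw [hw, h4, h5, map_neg]
  have h6 : -(dΦ (h.inclDeriv z v.1)) = 0 := by
    rw [htan, neg_zero]
  have h7 := DFunLike.congr_fun h6 ξ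
  exact neg_eq_zero.mpr h7

/-- The complex structure on `E_z`, the restriction of `J`. -/
noncomputable def IsKahlerReduction.JE (h : IsKahlerReduction E' K S Φ) (z : ZeroLevel Φ) :
    h.H z →ₗ[ℝ] h.H z where
  toFun v := Classical.choose (h.exists_J z v)
  map_add' v w := by
    apply Subtype.ext
    apply h.inclDeriv_injective z
    rw [Classical.choose_spec (h.exists_J z (v + w)), Submodule.coe_add, Submodule.coe_add,
      map_add, map_add, map_add, Classical.choose_spec (h.exists_J z v),
      Classical.choose_spec (h.exists_J z w)]
  map_smul' c v := by
    apply Subtype.ext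
    apply h.inclDeriv_injective z
    rw [Classical.choose_spec (h.exists_J z (c • v)), Submodule.coe_smul, RingHom.id_apply,
      Submodule.coe_smul, map_smul, map_smul, map_smul, Classical.choose_spec (h.exists_J z v)]

theorem IsKahlerReduction.inclDeriv_JE (h : IsKahlerReduction E' K S Φ) (z : ZeroLevel Φ)
    (v : h.H z) : h.inclDeriv z (h.JE z v : TangentSpace 𝓘(ℝ, E') z) =
      S.J z.1 (h.inclDeriv z (v : TangentSpace 𝓘(ℝ, E') z)) :=
  Classical.choose_spec (h.exists_J z v)

/-- The fibre `Q_z = T_z Z / V_z` of the normal bundle of the foliation by orbits. -/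
abbrev IsKahlerReduction.Q (h : IsKahlerReduction E' K S Φ) (z : ZeroLevel Φ) : Type _ :=
  TangentSpace 𝓘(ℝ, E') z ⧸ h.V z

/-- The transverse complex structure on `Q_z`, transported from `E_z` by the isomorphism
`E_z → Q_z` induced by the projection `T_z Z → Q_z`. -/
noncomputable def IsKahlerReduction.JQ (h : IsKahlerReduction E' K S Φ) (z : ZeroLevel Φ) :
    h.Q z →ₗ[ℝ] h.Q z :=
  (Submodule.quotientEquivOfIsCompl _ _ (h.isCompl z)).symm.toLinearMap ∘ₗ h.JE z ∘ₗ
    (Submodule.quotientEquivOfIsCompl _ _ (h.isCompl z)).toLinearMap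

/-- `β ∈ Ω^{p,q}_hor(Z)`: the form `β` is smooth, horizontal, and of type `(p, q)`, that is, it is
induced by a section of `∧^p Q*' ⊗ ∧^q Q*''`, where `Q*'` and `Q*''` are the `i`- and the
`-i`-eigenbundle of the transverse complex structure. -/
structure IsKahlerReduction.IsHorizontalOfType (h : IsKahlerReduction E' K S Φ) (p q : ℕ)
    (β : DForm E' (ZeroLevel Φ) (p + q) ℂ) : Prop where
  smooth : β.IsSmooth
  horizontal : ∀ z ξ, IsKilledBy (h.field z ξ) (β z)
  type : ∀ z, ∃ γ ∈ typePQ (h.JQ z) p q, ∀ v, β z v = γ (fun i => (h.V z).mkQ (v i))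

/-- The connection `1`-forms `θ^1, …, θ^k` on `Z` of the connection given by the orthogonal
complements `E_z` of the orbits, with respect to a basis `ξ_1, …, ξ_k` of the Lie algebra. -/
structure IsKahlerReduction.IsConnection (h : IsKahlerReduction E' K S Φ) {k : ℕ}
    (ξ : Module.Basis (Fin k) ℝ (GroupLieAlgebra 𝓘(ℝ, G) K))
    (θ : Fin k → ∀ z : ZeroLevel Φ, TangentSpace 𝓘(ℝ, E') z →L[ℝ] ℝ) : Prop where
  smooth : ∀ i, DForm.IsSmooth (E := E') (fun z : ZeroLevel Φ => oneForm (θ i z))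
  apply_H : ∀ i z, ∀ v ∈ h.H z, θ i z v = 0
  apply_field : ∀ i j z, θ i z (h.field z (ξ j)) = if i = j then 1 else 0

/-- The horizontal part `Hor(α)` of a form `α` on `Z`. -/
noncomputable def IsKahlerReduction.Hor (h : IsKahlerReduction E' K S Φ) {k : ℕ}
    (ξ : Module.Basis (Fin k) ℝ (GroupLieAlgebra 𝓘(ℝ, G) K))
    (θ : Fin k → ∀ z : ZeroLevel Φ, TangentSpace 𝓘(ℝ, E') z →L[ℝ] ℝ) {n : ℕ}
    (α : DForm E' (ZeroLevel Φ) n ℂ) : DForm E' (ZeroLevel Φ) n ℂ :=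
  fun z => hor (fun i => θ i z) (fun i => h.field z (ξ i)) (Pi.single n (α z)) n

/-- The structure constants of the Lie algebra, `[ξ_i, ξ_j] = ∑_l c_{ij}^l ξ_l`. -/
noncomputable def structureConstant {k : ℕ}
    (ξ : Module.Basis (Fin k) ℝ (GroupLieAlgebra 𝓘(ℝ, G) K)) (i j l : Fin k) : ℝ :=
  ξ.repr ⁅ξ i, ξ j⁆ l

/-- The curvature `2`-forms `μ^l = dθ^l + ½ ∑_{i,j} c_{ij}^l θ^i ∧ θ^j`. -/
noncomputable def curvature {k : ℕ} (ξ : Module.Basis (Fin k) ℝ (GroupLieAlgebra 𝓘(ℝ, G) K))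
    (θ : Fin k → ∀ z : ZeroLevel Φ, TangentSpace 𝓘(ℝ, E') z →L[ℝ] ℝ) (l : Fin k) :
    DForm E' (ZeroLevel Φ) 2 ℝ :=
  fun z => DForm.d (E := E') (fun z : ZeroLevel Φ => oneForm (θ l z)) z +
    (1 / 2 : ℝ) • ∑ i, ∑ j, structureConstant ξ i j l • wedge (θ i z) (oneForm (θ j z))

end Reduction

end KahlerReduction

open KahlerReduction

/-! Everything rests on the projection `P v = v - ∑ θ^i(v) (ξ_i)_Z` of `T_z Z` onto `E_z` along
`V_z`. The terms `θ^I ∧ h_I` with `I ≠ ∅` vanish on `E_z`, so `Hor β` is `β` evaluated on projected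
vectors (`Hor_apply`). For `β = i^*α` this is the pullback of `α` along `Q_z ≅ E_z → T_z M`. That
map is complex linear (`inclDeriv_horLift_JQ`), and complex linear maps preserve types
(`typePQ_compLinearMap`), which gives (a); smoothness holds because `P` is smooth in charts
(`contDiffAt_chartHorProj`).

For (b), horizontality is checked on two kinds of pairs. On two fundamental fields `dθ^l` is minus a
structure constant, because the orbit map carries left invariant fields to fundamental fields
(`d_field_field`), and the quadratic term of the curvature cancels it. On a fundamental field and a
horizontal vector `dθ^l` vanishes, because the group preserves `E` (`mfderiv_act_mem_H`,
`d_field_H`).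

The type of the curvature is decided on `E_z`, where it equals `dθ^l`. For `f = ⟨Φ, η⟩` the `1`-form
`df ∘ J` restricts to `-g(η_Z, ·)` on `Z`, so it annihilates `E`, just as `θ^l` does. Extend
horizontal `w₁, w₂` to local sections of `E` with bracket `b`. Then `dθ^l(w₁, w₂) = -θ^l(b)` and
`d(df ∘ J)(w₁, w₂) = g(η_Z, b)` (`exists_bracket`). Integrability of `J` makes `d(df ∘ J)` invariant
under `J` (`twist_d_J_J`). Hence replacing `w₁, w₂` by `Jw₁, Jw₂` changes `b` only by a vector
orthogonal to every `η_Z`, that is, by a vector of `E_z`, which `θ^l` does not see (`d_JE_JE`).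
Finally, a real `J`-invariant `2`-form is of type `(1, 1)` (`mem_typePQ_one_one`). -/

set_option linter.unusedSectionVars false

open scoped Topology

/-! ### Smooth families of alternating maps on normed spaces -/

section ContDiffForms

variable {V : Type*} [NormedAddCommGroup V] [NormedSpace ℝ V]
  {E₁ : Type*} [NormedAddCommGroup E₁] [NormedSpace ℝ E₁]
  {E₂ : Type*} [NormedAddCommGroup E₂] [NormedSpace ℝ E₂]
  {F : Type*} [NormedAddCommGroup F] [NormedSpace ℝ F]

/-- The normalized antisymmetrization, a continuous left inverse of the inclusion of alternating
maps into multilinear maps. -/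
noncomputable def antisymmetrizeCLM (E₁ F : Type*) [NormedAddCommGroup E₁] [NormedSpace ℝ E₁]
    [NormedAddCommGroup F] [NormedSpace ℝ F] (n : ℕ) :
    ContinuousMultilinearMap ℝ (fun _ : Fin n => E₁) F →L[ℝ] E₁ [⋀^Fin n]→L[ℝ] F where
  toFun f := (n.factorial : ℝ)⁻¹ • ContinuousMultilinearMap.alternatization f
  map_add' f g := by simp
  map_smul' c f := by
    ext v
    simp [ContinuousMultilinearMap.alternatization_apply_apply, Finset.smul_sum, smul_comm c]
  cont := by
    refine Continuous.const_smul (M := ℝ) (g := fun f : ContinuousMultilinearMap ℝ (fun _ : Fin n => E₁) F =>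
      ContinuousMultilinearMap.alternatization f) ?_ _
    rw [ContinuousAlternatingMap.isEmbedding_toContinuousMultilinearMap
      (𝕜 := ℝ) (E := E₁) (F := F) (ι := Fin n) |>.continuous_iff]
    have h : (ContinuousAlternatingMap.toContinuousMultilinearMap ∘
        (fun f : ContinuousMultilinearMap ℝ (fun _ : Fin n => E₁) F =>
          ContinuousMultilinearMap.alternatization f)) =
        fun f => ∑ σ : Equiv.Perm (Fin n), (Equiv.Perm.sign σ : ℤ) •
          ContinuousMultilinearMap.domDomCongrₗᵢ ℝ E₁ F σ f := by
      funext f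
      ext v
      simp [ContinuousMultilinearMap.alternatization_apply_apply, Units.smul_def]
      rfl
    rw [h]
    refine continuous_finsetSum _ fun σ _ => Continuous.const_smul ?_ _
    exact (ContinuousMultilinearMap.domDomCongrₗᵢ ℝ E₁ F σ).continuous

theorem antisymmetrizeCLM_toContinuousMultilinearMap {n : ℕ} (f : E₁ [⋀^Fin n]→L[ℝ] F) :
    antisymmetrizeCLM E₁ F n f.toContinuousMultilinearMap = f := by
  ext v
  have h : (n.factorial : ℝ) ≠ 0 := by exact_mod_cast n.factorial_ne_zero
  have h1 := congrArg (fun g => g v) (AlternatingMap.coe_alternatization f.toAlternatingMap)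
  simp only [MultilinearMap.alternatization_apply] at h1
  change (n.factorial : ℝ)⁻¹ • ContinuousMultilinearMap.alternatization
    f.toContinuousMultilinearMap v = f v
  rw [ContinuousMultilinearMap.alternatization_apply_apply, inv_smul_eq_iff₀ h]
  refine h1.trans ?_
  simp [Nat.cast_smul_eq_nsmul]

/-- For multilinear maps, precomposition depends multilinearly and continuously on the linear maps
and linearly on the form. `antisymmetrizeCLM` carries the resulting smoothness back to alternating
maps, being a continuous linear left inverse of the inclusion. -/
theorem contDiffAt_alternating_comp {n : ℕ} {m : WithTop ℕ∞} {a : V → E₂ [⋀^Fin n]→L[ℝ] F}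
    {L : V → E₁ →L[ℝ] E₂} {v₀ : V} (ha : ContDiffAt ℝ m a v₀) (hL : ContDiffAt ℝ m L v₀) :
    ContDiffAt ℝ m (fun v => (a v).compContinuousLinearMap (L v)) v₀ := by
  have h1 : ContDiffAt ℝ m (fun v =>
      ContinuousMultilinearMap.compContinuousLinearMapContinuousMultilinear ℝ
        (fun _ : Fin n => E₁) (fun _ : Fin n => E₂) F (fun _ => L v)) v₀ :=
    (ContinuousMultilinearMap.contDiff _).contDiffAt.comp v₀ (contDiffAt_pi.2 fun _ => hL)
  have h2 : ContDiffAt ℝ m (fun v => (a v).toContinuousMultilinearMap) v₀ :=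
    (ContinuousAlternatingMap.toContinuousMultilinearMapCLM (𝕜 := ℝ) (E := E₂) (F := F)
      (ι := Fin n) ℝ).contDiff.contDiffAt.comp v₀ ha
  have h3 := (antisymmetrizeCLM E₁ F n).contDiff.contDiffAt.comp v₀ (h1.clm_apply h2)
  refine h3.congr_of_eventuallyEq (Filter.Eventually.of_forall fun v => ?_)
  exact (antisymmetrizeCLM_toContinuousMultilinearMap
    ((a v).compContinuousLinearMap (L v))).symm

theorem minSmoothness_two_le_infty : minSmoothness ℝ 2 ≤ ∞ := by
  rw [minSmoothness_of_isRCLikeNormedField]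
  exact WithTop.coe_le_coe.2 le_top

theorem ContDiffAt.extDeriv {n : ℕ} {a : V → V [⋀^Fin n]→L[ℝ] F} {v₀ : V}
    (ha : ContDiffAt ℝ ∞ a v₀) : ContDiffAt ℝ ∞ (_root_.extDeriv a) v₀ := by
  have h1 : ContDiffAt ℝ ∞ (fderiv ℝ a) v₀ := ha.fderiv_right (by simp)
  exact (ContinuousAlternatingMap.alternatizeUncurryFinCLM ℝ V F).contDiff.contDiffAt.comp v₀ h1

end ContDiffForms

namespace KahlerReduction

/-! ### Exterior derivatives of 1-forms on a normed space -/

section OneForms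

variable {V : Type*} [NormedAddCommGroup V] [NormedSpace ℝ V]
  {F : Type*} [NormedAddCommGroup F] [NormedSpace ℝ F]

theorem oneForm_apply (a : V →L[ℝ] F) (v : Fin 1 → V) : oneForm a v = a (v 0) := rfl

theorem contDiffAt_oneForm_iff {W : Type*} [NormedAddCommGroup W] [NormedSpace ℝ W]
    {m : WithTop ℕ∞} {a : W → V →L[ℝ] F} {w : W} :
    ContDiffAt ℝ m (fun y => oneForm (a y)) w ↔ ContDiffAt ℝ m a w :=
  (ContinuousAlternatingMap.ofSubsingletonLIE (𝕜 := ℝ) (E := V) (F := F)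
    (0 : Fin 1)).toContinuousLinearEquiv.comp_contDiffAt_iff

theorem extDeriv_oneForm_apply {a : V → V →L[ℝ] F} {x : V} (ha : DifferentiableAt ℝ a x)
    (u v : V) : extDeriv (fun y => oneForm (a y)) x ![u, v] =
      fderiv ℝ a x u v - fderiv ℝ a x v u := by
  have h : DifferentiableAt ℝ (fun y => oneForm (a y)) x :=
    (ContinuousAlternatingMap.ofSubsingletonLIE (𝕜 := ℝ) (E := V) (F := F)
      (0 : Fin 1)).toContinuousLinearEquiv.comp_differentiableAt_iff.2 ha
  have h2 : ∀ w : V, fderiv ℝ (fun y => a y w) x = (fderiv ℝ a x).flip w := by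
    intro w
    rw [fderiv_clm_apply ha (differentiableAt_const _)]
    simp
  rw [extDeriv_apply h]
  simp [Fin.sum_univ_two, oneForm_apply, Fin.removeNth, h2, sub_eq_add_neg]

/-- Cartan's formula: the product rule for `a(Y)` and `a(X)` produces, besides the derivatives of
`a`, the two terms that make up `a([X, Y])`. -/
theorem extDeriv_oneForm_apply_fields {a : V → V →L[ℝ] F} {x : V} (ha : DifferentiableAt ℝ a x)
    {X Y : V → V} (hX : DifferentiableAt ℝ X x) (hY : DifferentiableAt ℝ Y x) :
    extDeriv (fun y => oneForm (a y)) x ![X x, Y x] =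
      fderiv ℝ (fun y => a y (Y y)) x (X x) - fderiv ℝ (fun y => a y (X y)) x (Y x) -
        a x (VectorField.lieBracket ℝ X Y x) := by
  rw [extDeriv_oneForm_apply ha, fderiv_clm_apply ha hX, fderiv_clm_apply ha hY,
    VectorField.lieBracket]
  simp
  abel

end OneForms

/-! ### Pulling back forms from a manifold to a normed space -/

section Pullback

variable {E : Type*} [NormedAddCommGroup E] [NormedSpace ℝ E]
  {N : Type*} [TopologicalSpace N] [ChartedSpace E N] [IsManifold 𝓘(ℝ, E) ∞ N]
  {E' : Type*} [NormedAddCommGroup E'] [NormedSpace ℝ E']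
  {N' : Type*} [TopologicalSpace N'] [ChartedSpace E' N']
  {V : Type*} [NormedAddCommGroup V] [NormedSpace ℝ V]
  {F : Type*} [NormedAddCommGroup F] [NormedSpace ℝ F]

/-- The pullback of a form to a normed space, as a function between normed spaces. -/
noncomputable def DForm.pull {n : ℕ} (f : V → N) (α : DForm E N n F) : V → V [⋀^Fin n]→L[ℝ] F :=
  fun v => (α (f v)).compContinuousLinearMap (mfderiv 𝓘(ℝ, V) 𝓘(ℝ, E) f v)

theorem DForm.pull_apply {n : ℕ} (f : V → N) (α : DForm E N n F) (v : V) (w : Fin n → V) :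
    α.pull f v w = α (f v) (fun i => mfderiv 𝓘(ℝ, V) 𝓘(ℝ, E) f v (w i)) := rfl

theorem contMDiffAt_extChartAt_symm_of_mem {x : N} {y : E}
    (hy : y ∈ (extChartAt 𝓘(ℝ, E) x).target) :
    ContMDiffAt 𝓘(ℝ, E) 𝓘(ℝ, E) ∞ (extChartAt 𝓘(ℝ, E) x).symm y :=
  (contMDiffOn_extChartAt_symm x).contMDiffAt ((isOpen_extChartAt_target x).mem_nhds hy)

theorem DForm.pull_congr {n : ℕ} (α : DForm E N n F) {f g : V → N} {v : V} (h : f =ᶠ[𝓝 v] g) :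
    α.pull f v = α.pull g v := by
  -- Every tangent space is the model space by definition, so forms at the points `f v` and `g v`
  -- can be compared there.
  have h1 : (α (f v) : E [⋀^Fin n]→L[ℝ] F) = α (g v) := by
    have h0 : ∀ x y : N, x = y → (α x : E [⋀^Fin n]→L[ℝ] F) = α y := by rintro x _ rfl; rfl
    exact h0 _ _ h.self_of_nhds
  have h2 : (mfderiv 𝓘(ℝ, V) 𝓘(ℝ, E) f v : V →L[ℝ] E) = mfderiv 𝓘(ℝ, V) 𝓘(ℝ, E) g v :=
    h.mfderiv_eq
  have h3 : ∀ (a b : E [⋀^Fin n]→L[ℝ] F) (L M : V →L[ℝ] E), a = b → L = M →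
      a.compContinuousLinearMap L = b.compContinuousLinearMap M := by
    rintro a b L M rfl rfl; rfl
  exact h3 _ _ _ _ h1 h2

theorem DForm.pull_comp {n : ℕ} (α : DForm E N n F) {W : Type*} [NormedAddCommGroup W]
    [NormedSpace ℝ W] {g : W → N} {e : V → W} {v : V}
    (hg : MDifferentiableAt 𝓘(ℝ, W) 𝓘(ℝ, E) g (e v)) (he : DifferentiableAt ℝ e v) :
    α.pull (g ∘ e) v = (α.pull g (e v)).compContinuousLinearMap (fderiv ℝ e v) := by
  have h := mfderiv_comp (I := 𝓘(ℝ, V)) (I' := 𝓘(ℝ, W)) (I'' := 𝓘(ℝ, E)) v hg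
    he.mdifferentiableAt
  rw [mfderiv_eq_fderiv] at h
  exact congrArg (fun L : V →L[ℝ] E =>
    (α (g (e v)) : E [⋀^Fin n]→L[ℝ] F).compContinuousLinearMap L) h

/-- Near `v₀` the map `f` factors through the inverse of any chart around `f v₀`. This reduces
smoothness and exterior derivatives of pullbacks to the normed space statements about `inChart`. -/
theorem eventually_pull_eq {n : ℕ} (α : DForm E N n F) {f : V → N} {v₀ : V} {x : N}
    (hf : ContMDiffAt 𝓘(ℝ, V) 𝓘(ℝ, E) ∞ f v₀) (hx : f v₀ ∈ (extChartAt 𝓘(ℝ, E) x).source) :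
    α.pull f =ᶠ[𝓝 v₀] fun v => (α.inChart x (extChartAt 𝓘(ℝ, E) x (f v))).compContinuousLinearMap
      (fderiv ℝ (fun v => extChartAt 𝓘(ℝ, E) x (f v)) v) := by
  have hne : (∞ : WithTop ℕ∞) ≠ 0 := by simp
  have h1 : ∀ᶠ v in 𝓝 v₀, f v ∈ (extChartAt 𝓘(ℝ, E) x).source :=
    hf.continuousAt.eventually_mem ((isOpen_extChartAt_source x).mem_nhds hx)
  have h2 : ∀ᶠ v in 𝓝 v₀, ContMDiffAt 𝓘(ℝ, V) 𝓘(ℝ, E) 1 f v :=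
    (contMDiffAt_iff_contMDiffAt_nhds (by simp)).1 (hf.of_le (by simp))
  filter_upwards [h1, h2, h1.eventually_nhds] with v hv hd hev
  have hφ : MDifferentiableAt 𝓘(ℝ, E) 𝓘(ℝ, E) (extChartAt 𝓘(ℝ, E) x) (f v) :=
    (contMDiffAt_extChartAt' (n := 1) (by simpa using hv)).mdifferentiableAt (by simp)
  have hs : MDifferentiableAt 𝓘(ℝ, E) 𝓘(ℝ, E) (extChartAt 𝓘(ℝ, E) x).symm
      (extChartAt 𝓘(ℝ, E) x (f v)) :=
    (contMDiffAt_extChartAt_symm_of_mem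
      ((extChartAt 𝓘(ℝ, E) x).map_source hv)).mdifferentiableAt hne
  have hfd : MDifferentiableAt 𝓘(ℝ, V) 𝓘(ℝ, E) f v := hd.mdifferentiableAt (by simp)
  have hfs : f =ᶠ[𝓝 v] (extChartAt 𝓘(ℝ, E) x).symm ∘ (fun v => extChartAt 𝓘(ℝ, E) x (f v)) := by
    filter_upwards [hev] with w hw
    exact ((extChartAt 𝓘(ℝ, E) x).left_inv hw).symm
  rw [α.pull_congr hfs]
  exact α.pull_comp hs (hφ.comp v hfd).differentiableAt

theorem DForm.IsSmooth.contDiffAt_inChart {n : ℕ} {α : DForm E N n F} (hα : α.IsSmooth) {x : N}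
    {y : E} (hy : y ∈ (extChartAt 𝓘(ℝ, E) x).target) : ContDiffAt ℝ ∞ (α.inChart x) y :=
  (hα x).contDiffAt ((isOpen_extChartAt_target x).mem_nhds hy)

theorem contDiffAt_extChartAt_comp {f : V → N} {v₀ : V} {x : N}
    (hf : ContMDiffAt 𝓘(ℝ, V) 𝓘(ℝ, E) ∞ f v₀) (hx : f v₀ ∈ (extChartAt 𝓘(ℝ, E) x).source) :
    ContDiffAt ℝ ∞ (fun v => extChartAt 𝓘(ℝ, E) x (f v)) v₀ := by
  rw [← contMDiffAt_iff_contDiffAt]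
  exact (contMDiffAt_extChartAt' (by simpa using hx)).comp v₀ hf

/-- Smooth forms pull back to smooth forms on a normed space. -/
theorem DForm.IsSmooth.contDiffAt_pull {n : ℕ} {α : DForm E N n F} (hα : α.IsSmooth) {f : V → N}
    {v₀ : V} (hf : ContMDiffAt 𝓘(ℝ, V) 𝓘(ℝ, E) ∞ f v₀) : ContDiffAt ℝ ∞ (α.pull f) v₀ := by
  have hx := mem_extChartAt_source (I := 𝓘(ℝ, E)) (f v₀)
  refine ContDiffAt.congr_of_eventuallyEq ?_ (eventually_pull_eq α hf hx)
  have he := contDiffAt_extChartAt_comp hf hx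
  refine contDiffAt_alternating_comp ?_ (he.fderiv_right (by simp))
  exact ContDiffAt.comp (g := α.inChart (f v₀)) v₀
    (hα.contDiffAt_inChart (mem_extChartAt_target _)) he

/-- The exterior derivative commutes with pullbacks to a normed space. -/
theorem DForm.IsSmooth.extDeriv_pull {n : ℕ} {α : DForm E N n F} (hα : α.IsSmooth) {f : V → N}
    {v₀ : V} (hf : ContMDiffAt 𝓘(ℝ, V) 𝓘(ℝ, E) ∞ f v₀) :
    extDeriv (α.pull f) v₀ = α.d.pull f v₀ := by
  have hx := mem_extChartAt_source (I := 𝓘(ℝ, E)) (f v₀)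
  have he := contDiffAt_extChartAt_comp hf hx
  have hne : (∞ : WithTop ℕ∞) ≠ 0 := by simp
  rw [(eventually_pull_eq α hf hx).extDeriv_eq,
    extDeriv_pullback (F := E) (f := fun v => extChartAt 𝓘(ℝ, E) (f v₀) (f v))
      ((hα.contDiffAt_inChart (mem_extChartAt_target _)).differentiableAt hne) he
      minSmoothness_two_le_infty]
  -- `DForm.d` at `f v₀` is computed in the very chart used for the factorization, so only the chain
  -- rule for the chart after `f` remains.
  have hφ : MDifferentiableAt 𝓘(ℝ, E) 𝓘(ℝ, E) (extChartAt 𝓘(ℝ, E) (f v₀)) (f v₀) :=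
    (contMDiffAt_extChartAt (n := 1)).mdifferentiableAt (by simp)
  have hc := mfderiv_comp (I := 𝓘(ℝ, V)) (I' := 𝓘(ℝ, E)) (I'' := 𝓘(ℝ, E)) v₀ hφ
    (hf.mdifferentiableAt hne)
  have hc' : fderiv ℝ (fun v => extChartAt 𝓘(ℝ, E) (f v₀) (f v)) v₀ =
      (mfderiv 𝓘(ℝ, E) 𝓘(ℝ, E) (extChartAt 𝓘(ℝ, E) (f v₀)) (f v₀)).comp
        (mfderiv 𝓘(ℝ, V) 𝓘(ℝ, E) f v₀) := by
    rw [← hc, mfderiv_eq_fderiv]; rfl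
  rw [hc']
  rfl

/-- The chart in which `d` is computed changes from point to point. Naturality for the inverse of
one fixed chart shows that, throughout this chart, `α.d` is the exterior derivative of `α.inChart
x`. -/
theorem DForm.IsSmooth.d {n : ℕ} {α : DForm E N n F} (hα : α.IsSmooth) : α.d.IsSmooth := by
  intro x y hy
  refine ContDiffAt.contDiffWithinAt ?_
  have h : α.d.inChart x =ᶠ[𝓝 y] extDeriv (α.inChart x) := by
    filter_upwards [(isOpen_extChartAt_target x).mem_nhds hy] with w hw
    exact (hα.extDeriv_pull (contMDiffAt_extChartAt_symm_of_mem hw)).symm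
  exact (ContDiffAt.extDeriv (hα.contDiffAt_inChart hy)).congr_of_eventuallyEq h

/-- Smoothness of a form can be checked on local pullbacks by the inverse charts. -/
theorem DForm.isSmooth_iff_contDiffAt_pull {n : ℕ} {α : DForm E N n F} : α.IsSmooth ↔
    ∀ (x : N) (y : E), y ∈ (extChartAt 𝓘(ℝ, E) x).target →
      ContDiffAt ℝ ∞ (α.pull (extChartAt 𝓘(ℝ, E) x).symm) y :=
  ⟨fun h _ _ hy => h.contDiffAt_inChart hy, fun h x y hy => (h x y hy).contDiffWithinAt⟩

end Pullback

/-! ### Linear algebra of forms of type (p, q) -/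

section TypePQ

variable {T : Type*} [AddCommGroup T] [Module ℝ T] {T' : Type*} [AddCommGroup T'] [Module ℝ T']

/-- Precomposition with a complex linear map preserves the `i`- and the `-i`-eigenspace of
covectors, hence takes the spanning products to spanning products. -/
theorem typePQ_compLinearMap {J : T →ₗ[ℝ] T} {J' : T' →ₗ[ℝ] T'} {L : T' →ₗ[ℝ] T}
    (hL : ∀ v, L (J' v) = J (L v)) {p q : ℕ} {α : T [⋀^Fin (p + q)]→ₗ[ℝ] ℂ}
    (hα : α ∈ typePQ J p q) : α.compLinearMap L ∈ typePQ J' p q := by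
  unfold typePQ at hα
  induction hα using Submodule.span_induction with
  | mem β hβ =>
    obtain ⟨a, b, ha, hb, hβ⟩ := hβ
    refine Submodule.subset_span ⟨fun i => a i ∘ₗ L, fun i => b i ∘ₗ L, ?_, ?_, ?_⟩
    · intro i v
      simp [hL, ha]
    · intro i v
      simp [hL, hb]
    · intro v
      rw [AlternatingMap.compLinearMap_apply, hβ]
      congr 1
      ext i j
      simp only [Matrix.of_apply]
      refine Fin.addCases (fun i => ?_) (fun i => ?_) i
      · simp
      · simp
  | zero => exact Submodule.zero_mem _
  | add β γ _ _ hβ hγ => exact Submodule.add_mem _ hβ hγ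
  | smul c β _ hβ => exact Submodule.smul_mem _ c hβ

/-- A real `2`-form which is invariant under `J` is of type `(1, 1)`. -/
theorem mem_typePQ_one_one [Module.Finite ℝ T] {J : T →ₗ[ℝ] T} (hJ : ∀ v, J (J v) = -v)
    {α : T [⋀^Fin (1 + 1)]→ₗ[ℝ] ℂ} (γ : T →ₗ[ℝ] T →ₗ[ℝ] ℝ)
    (hα : ∀ v, α v = (γ (v 0) (v 1) : ℂ)) (hγ : ∀ u v, γ (J u) (J v) = γ u v) :
    α ∈ typePQ J 1 1 := by
  let e := Module.finBasis ℝ T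
  let lin : (T →ₗ[ℝ] ℝ) → T →ₗ[ℝ] ℂ := fun f => Complex.ofRealCLM.toLinearMap ∘ₗ f
  -- `a f` and `b f` are twice the components of the real covector `f` in the `i`- and the
  -- `-i`-eigenspace.
  let a : (T →ₗ[ℝ] ℝ) → T →ₗ[ℝ] ℂ := fun f => lin f - Complex.I • lin (f ∘ₗ J)
  let b : (T →ₗ[ℝ] ℝ) → T →ₗ[ℝ] ℂ := fun f => lin f + Complex.I • lin (f ∘ₗ J)
  have ha : ∀ f v, a f v = (f v : ℂ) - Complex.I * f (J v) := fun f v => rfl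
  have hb : ∀ f v, b f v = (f v : ℂ) + Complex.I * f (J v) := fun f v => rfl
  let A : Fin (Module.finrank ℝ T) → Fin (1 + 1) → T →ₗ[ℝ] ℂ := fun m =>
    Fin.append (fun _ : Fin 1 => a (e.coord m)) (fun _ : Fin 1 => b (γ (e m)))
  let δ : Fin (Module.finrank ℝ T) → T [⋀^Fin (1 + 1)]→ₗ[ℝ] ℂ := fun m =>
    { ((Matrix.detRowAlternating (n := Fin (1 + 1)) (R := ℂ)).toMultilinearMap.restrictScalars
        ℝ).compLinearMap fun _ => LinearMap.pi (A m) with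
      map_eq_zero_of_eq' := fun v i j hv hij =>
        (Matrix.detRowAlternating (n := Fin (1 + 1)) (R := ℂ)).map_eq_zero_of_eq _
          (by rw [hv]) hij }
  have hδ : ∀ m, δ m ∈ typePQ J 1 1 := by
    intro m
    refine Submodule.subset_span ⟨fun _ => a (e.coord m), fun _ => b (γ (e m)), ?_, ?_, ?_⟩
    · intro _ v
      simp only [ha, hJ, map_neg, Complex.ofReal_neg]
      linear_combination (e.coord m (J v) : ℂ) * Complex.I_mul_I
    · intro _ v
      simp only [hb, hJ, map_neg, Complex.ofReal_neg]
      linear_combination (γ (e m) (J v) : ℂ) * Complex.I_mul_I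
    · intro v
      rw [← Matrix.det_transpose]
      rfl
  -- Write `γ = ∑ e^m ⊗ γ(e_m, ·)` and replace the two factors by `a(e^m)` and `b(γ(e_m, ·))`. By
  -- invariance the sum becomes `2γ(x, y) + 2iγ(x, Jy)`. The second term is symmetric in `x, y` and
  -- disappears on antisymmetrizing; the first one gives `4γ`.
  have hsum : α = (4⁻¹ : ℂ) • ∑ m, δ m := by
    ext v
    have hanti : ∀ x y, γ x y = -γ y x := by
      intro x y
      have h1 := α.map_swap ![x, y] (i := 0) (j := 1) (by decide)
      rw [hα, hα] at h1
      have h2 : γ y x = -γ x y := by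
        have : ((γ y x : ℝ) : ℂ) = -(γ x y : ℝ) := by simpa using h1
        exact_mod_cast this
      linarith
    have hexp : ∀ x y, ∑ m, e.coord m x * γ (e m) y = γ x y := by
      intro x y
      conv_rhs => rw [← e.sum_repr x]
      rw [map_sum, LinearMap.sum_apply]
      simp
    have hdet : ∀ m, δ m v = a (e.coord m) (v 0) * b (γ (e m)) (v 1) -
        a (e.coord m) (v 1) * b (γ (e m)) (v 0) := by
      intro m
      change Matrix.det (Matrix.of fun i j => A m j (v i)) = _
      rw [Matrix.det_fin_two]
      have h0 : A m 0 = a (e.coord m) := rfl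
      have h1 : A m 1 = b (γ (e m)) := rfl
      simp only [Matrix.of_apply, h0, h1]
      ring
    have hab : ∀ x y, ∑ m, a (e.coord m) x * b (γ (e m)) y =
        2 * (γ x y : ℂ) + 2 * Complex.I * (γ x (J y) : ℂ) := by
      intro x y
      have h1 : γ (J x) y = -γ x (J y) := by
        rw [← hγ x (J y), hJ, map_neg, neg_neg]
      have h2 : ∀ m, a (e.coord m) x * b (γ (e m)) y =
          ((e.coord m x * γ (e m) y : ℝ) : ℂ) + Complex.I * ((e.coord m x * γ (e m) (J y) : ℝ) : ℂ)
          - Complex.I * ((e.coord m (J x) * γ (e m) y : ℝ) : ℂ)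
          + ((e.coord m (J x) * γ (e m) (J y) : ℝ) : ℂ) := by
        intro m
        rw [ha, hb]
        push_cast
        linear_combination -(e.coord m (J x) * γ (e m) (J y) : ℂ) * Complex.I_mul_I
      simp only [h2, Finset.sum_add_distrib, Finset.sum_sub_distrib, ← Finset.mul_sum,
        ← Complex.ofReal_sum, hexp]
      rw [hγ, h1]
      push_cast
      ring
    have happly : ∀ s : Finset (Fin (Module.finrank ℝ T)), (∑ m ∈ s, δ m) v = ∑ m ∈ s, δ m v := by
      intro s
      induction s using Finset.induction_on with
      | empty => simp
      | insert m s hm ih => rw [Finset.sum_insert hm, Finset.sum_insert hm, ← ih]; rfl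
    rw [AlternatingMap.smul_apply, happly]
    simp only [hdet, Finset.sum_sub_distrib, hab]
    have h3 : γ (v 1) (J (v 0)) = γ (v 0) (J (v 1)) := by
      rw [hanti, ← hγ (v 0) (J (v 1)), hJ, map_neg]
    rw [hα, h3, hanti (v 1) (v 0)]
    push_cast
    simp only [smul_eq_mul]
    ring
  rw [hsum]
  exact Submodule.smul_mem _ _ (Submodule.sum_mem _ fun m _ => hδ m)

end TypePQ

/-! ### Derivatives of charts and vector fields in charts -/

section Charts

variable {E : Type*} [NormedAddCommGroup E] [NormedSpace ℝ E]
  {N : Type*} [TopologicalSpace N] [ChartedSpace E N] [IsManifold 𝓘(ℝ, E) ∞ N]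

/-- The derivative at `y` of the inverse of the chart around `x`. -/
noncomputable def dSymm (x : N) (y : E) : E →L[ℝ] E :=
  mfderiv 𝓘(ℝ, E) 𝓘(ℝ, E) (extChartAt 𝓘(ℝ, E) x).symm y

/-- The derivative at `z` of the chart around `x`. -/
noncomputable def dChart (x z : N) : E →L[ℝ] E :=
  mfderiv 𝓘(ℝ, E) 𝓘(ℝ, E) (extChartAt 𝓘(ℝ, E) x) z

theorem dChart_comp_dSymm {x : N} {y : E} (hy : y ∈ (extChartAt 𝓘(ℝ, E) x).target) :
    dChart x ((extChartAt 𝓘(ℝ, E) x).symm y) ∘L dSymm x y = ContinuousLinearMap.id ℝ E := by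
  have h := mfderiv_extChartAt_comp_mfderivWithin_extChartAt_symm hy
  rw [modelWithCornersSelf_coe, Set.range_id, mfderivWithin_univ] at h
  exact h

theorem dSymm_comp_dChart {x : N} {y : E} (hy : y ∈ (extChartAt 𝓘(ℝ, E) x).target) :
    dSymm x y ∘L dChart x ((extChartAt 𝓘(ℝ, E) x).symm y) = ContinuousLinearMap.id ℝ E := by
  have h := mfderivWithin_extChartAt_symm_comp_mfderiv_extChartAt hy
  rw [modelWithCornersSelf_coe, Set.range_id, mfderivWithin_univ] at h
  exact h

theorem dChart_dSymm {x : N} {y : E} (hy : y ∈ (extChartAt 𝓘(ℝ, E) x).target) (u : E) :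
    dChart x ((extChartAt 𝓘(ℝ, E) x).symm y) (dSymm x y u) = u :=
  DFunLike.congr_fun (dChart_comp_dSymm hy) u

theorem dSymm_dChart {x : N} {y : E} (hy : y ∈ (extChartAt 𝓘(ℝ, E) x).target) (u : E) :
    dSymm x y (dChart x ((extChartAt 𝓘(ℝ, E) x).symm y) u) = u :=
  DFunLike.congr_fun (dSymm_comp_dChart hy) u

theorem dSymm_self (x : N) : dSymm x (extChartAt 𝓘(ℝ, E) x x) = ContinuousLinearMap.id ℝ E := by
  have h := mfderivWithin_range_extChartAt_symm (I := 𝓘(ℝ, E)) (x := x)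
  rw [modelWithCornersSelf_coe, Set.range_id, mfderivWithin_univ] at h
  exact h

theorem dChart_self (x : N) : dChart x x = ContinuousLinearMap.id ℝ E :=
  mfderiv_extChartAt_self (I := 𝓘(ℝ, E)) (x := x)

/-- The Lie bracket of vector fields, computed in the chart around the base point. -/
theorem mlieBracket_eq_lieBracket {X Y : ∀ z : N, TangentSpace 𝓘(ℝ, E) z} {x : N} {X' Y' : E → E}
    (hX : ∀ᶠ y in 𝓝 (extChartAt 𝓘(ℝ, E) x x),
      (X ((extChartAt 𝓘(ℝ, E) x).symm y) : E) = dSymm x y (X' y))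
    (hY : ∀ᶠ y in 𝓝 (extChartAt 𝓘(ℝ, E) x x),
      (Y ((extChartAt 𝓘(ℝ, E) x).symm y) : E) = dSymm x y (Y' y)) :
    (VectorField.mlieBracket 𝓘(ℝ, E) X Y x : E) =
      VectorField.lieBracket ℝ X' Y' (extChartAt 𝓘(ℝ, E) x x) := by
  have key : ∀ (Z : ∀ z : N, TangentSpace 𝓘(ℝ, E) z) (Z' : E → E),
      (∀ᶠ y in 𝓝 (extChartAt 𝓘(ℝ, E) x x),
        (Z ((extChartAt 𝓘(ℝ, E) x).symm y) : E) = dSymm x y (Z' y)) →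
      (VectorField.mpullbackWithin 𝓘(ℝ, E) 𝓘(ℝ, E) (extChartAt 𝓘(ℝ, E) x).symm Z
        (Set.range 𝓘(ℝ, E)) : E → E) =ᶠ[𝓝 (extChartAt 𝓘(ℝ, E) x x)] Z' := by
    intro Z Z' hZ
    filter_upwards [hZ, extChartAt_target_mem_nhds (I := 𝓘(ℝ, E)) x] with y hy hyt
    rw [VectorField.mpullbackWithin_apply, modelWithCornersSelf_coe, Set.range_id,
      mfderivWithin_univ]
    change (dSymm x y).inverse (Z ((extChartAt 𝓘(ℝ, E) x).symm y) : E) = Z' y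
    rw [hy, ContinuousLinearMap.inverse_eq (dSymm_comp_dChart hyt) (dChart_comp_dSymm hyt),
      dChart_dSymm hyt]
  have hX1 := key X X' hX
  have hY1 := key Y Y' hY
  set A : E → E := VectorField.mpullbackWithin 𝓘(ℝ, E) 𝓘(ℝ, E) (extChartAt 𝓘(ℝ, E) x).symm X
    (Set.range 𝓘(ℝ, E))
  set B : E → E := VectorField.mpullbackWithin 𝓘(ℝ, E) 𝓘(ℝ, E) (extChartAt 𝓘(ℝ, E) x).symm Y
    (Set.range 𝓘(ℝ, E))
  -- At its own base point a chart has derivative the identity, so the bracket in the chart needs no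
  -- correction factor.
  change (dChart (E := E) x x).inverse (VectorField.lieBracketWithin ℝ A B
    ((extChartAt 𝓘(ℝ, E) x).symm ⁻¹' Set.univ ∩ Set.range 𝓘(ℝ, E)) (extChartAt 𝓘(ℝ, E) x x)) = _
  rw [dChart_self, ContinuousLinearMap.inverse_id, Set.preimage_univ, Set.univ_inter,
    modelWithCornersSelf_coe, Set.range_id, VectorField.lieBracketWithin_univ]
  exact hX1.lieBracket_vectorField_eq hY1

/-- The vector field which is constant in the chart around `x`. -/
noncomputable def chartConstField (x : N) (u : E) (z : N) : TangentSpace 𝓘(ℝ, E) z :=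
  dSymm x (extChartAt 𝓘(ℝ, E) x z) u

/-- In the tangent bundle trivialization given by the chart around `x`, this field is the constant
section `u`. Such fields are the test fields for the Nijenhuis condition. -/
theorem contMDiffOn_chartConstField (x : N) (u : E) :
    ContMDiffOn 𝓘(ℝ, E) 𝓘(ℝ, E).tangent ∞
      (fun z => (⟨z, chartConstField x u z⟩ : TangentBundle 𝓘(ℝ, E) N))
      (chartAt E x).source := by
  have h1 : ContMDiffOn 𝓘(ℝ, E) (𝓘(ℝ, E).prod 𝓘(ℝ, E)) ∞ (fun z : N => (z, u))
      (chartAt E x).source := (contMDiff_id.prodMk contMDiff_const).contMDiffOn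
  have h2 := (trivializationAt E (TangentSpace 𝓘(ℝ, E) : N → Type _) x).contMDiffOn_symm
    (IB := 𝓘(ℝ, E)) (n := ∞)
  have h3 : ∀ z ∈ (chartAt E x).source, (z, u) ∈
      (trivializationAt E (TangentSpace 𝓘(ℝ, E) : N → Type _) x).target := by
    intro z hz
    exact (Bundle.Trivialization.mem_target _).2 hz
  refine (h2.comp h1 h3).congr fun z hz => ?_
  have h4 := TangentBundle.symmL_trivializationAt (I := 𝓘(ℝ, E)) hz
  rw [modelWithCornersSelf_coe, Set.range_id, mfderivWithin_univ] at h4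
  have hb : z ∈ (trivializationAt E (TangentSpace 𝓘(ℝ, E) : N → Type _) x).baseSet := hz
  rw [Function.comp_apply]
  have h5 := Bundle.Trivialization.mk_symm
    (trivializationAt E (TangentSpace 𝓘(ℝ, E) : N → Type _) x) hb u
  refine Eq.trans ?_ h5
  congr 1
  have h6 := DFunLike.congr_fun h4 u
  rw [Bundle.Trivialization.symmL_apply _ hb] at h6
  exact h6.symm

end Charts

/-! ### The forms df ∘ J and the Nijenhuis tensor -/

section Twist

variable {E : Type*} [NormedAddCommGroup E] [NormedSpace ℝ E]
  {M : Type*} [TopologicalSpace M] [ChartedSpace E M] [IsManifold 𝓘(ℝ, E) ∞ M]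

namespace KahlerStructure

/-- The complex structure at `z`, as an endomorphism of the model space. -/
noncomputable def Jmodel (S : KahlerStructure E M) (z : M) : E →L[ℝ] E := S.J z

/-- The complex structure in the chart around `x`. -/
noncomputable def chartJ (S : KahlerStructure E M) (x : M) (y : E) : E →L[ℝ] E :=
  dChart x ((extChartAt 𝓘(ℝ, E) x).symm y) ∘L
    S.Jmodel ((extChartAt 𝓘(ℝ, E) x).symm y) ∘L dSymm x y

variable (S : KahlerStructure E M)

theorem Jmodel_Jmodel (x : M) (v : E) : S.Jmodel x (S.Jmodel x v) = -v := S.J_J x v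

theorem dSymm_chartJ {x : M} {y : E} (hy : y ∈ (extChartAt 𝓘(ℝ, E) x).target) (u : E) :
    dSymm x y (S.chartJ x y u) = S.Jmodel ((extChartAt 𝓘(ℝ, E) x).symm y) (dSymm x y u) :=
  dSymm_dChart hy _

theorem chartJ_chartJ {x : M} {y : E} (hy : y ∈ (extChartAt 𝓘(ℝ, E) x).target) (u : E) :
    S.chartJ x y (S.chartJ x y u) = -u := by
  have h : S.chartJ x y (S.chartJ x y u) = dChart x ((extChartAt 𝓘(ℝ, E) x).symm y)
    (S.Jmodel ((extChartAt 𝓘(ℝ, E) x).symm y) (dSymm x y (S.chartJ x y u))) := rfl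
  rw [h, S.dSymm_chartJ hy, S.Jmodel_Jmodel, map_neg, dChart_dSymm hy]

theorem chartJ_self (x : M) : S.chartJ x (extChartAt 𝓘(ℝ, E) x x) = S.Jmodel x := by
  have h : ∀ z, z = x → (dChart x z ∘L S.Jmodel z ∘L
      dSymm x (extChartAt 𝓘(ℝ, E) x x)) = S.Jmodel x := by
    rintro _ rfl
    rw [dChart_self, dSymm_self]
    rfl
  exact h _ (extChartAt_to_inv x)

/-- The trivialization of the endomorphism bundle conjugates by that of the tangent bundle, which is
given by `dChart` and `dSymm`. So `chartJ` is the coordinate expression of the smooth section `J`.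
-/
theorem contDiffAt_chartJ {x : M} {y : E} (hy : y ∈ (extChartAt 𝓘(ℝ, E) x).target) :
    ContDiffAt ℝ ∞ (S.chartJ x) y := by
  have hz : (extChartAt 𝓘(ℝ, E) x).symm y ∈ (chartAt E x).source := by
    simpa using (extChartAt 𝓘(ℝ, E) x).map_target hy
  have h1 := (Bundle.Trivialization.contMDiffAt_section_iff (IB := 𝓘(ℝ, E))
    (trivializationAt (E →L[ℝ] E)
      (fun x : M => TangentSpace 𝓘(ℝ, E) x →L[ℝ] TangentSpace 𝓘(ℝ, E) x) x) ⟨hz, hz⟩).1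
    (S.smooth_J ((extChartAt 𝓘(ℝ, E) x).symm y))
  rw [← contMDiffAt_iff_contDiffAt]
  refine (h1.comp y (contMDiffAt_extChartAt_symm_of_mem hy)).congr_of_eventuallyEq ?_
  filter_upwards [(isOpen_extChartAt_target x).mem_nhds hy] with w hw
  have hw' : (extChartAt 𝓘(ℝ, E) x).symm w ∈ (chartAt E x).source := by
    simpa using (extChartAt 𝓘(ℝ, E) x).map_target hw
  have e1 := TangentBundle.continuousLinearMapAt_trivializationAt (I := 𝓘(ℝ, E)) hw'
  have e2 := TangentBundle.symmL_trivializationAt (I := 𝓘(ℝ, E)) hw'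
  rw [modelWithCornersSelf_coe, Set.range_id, mfderivWithin_univ,
    (extChartAt 𝓘(ℝ, E) x).right_inv hw] at e2
  ext u
  have f1 := DFunLike.congr_fun e2 u
  have f2 := DFunLike.congr_fun e1 (S.J ((extChartAt 𝓘(ℝ, E) x).symm w)
    ((trivializationAt E (TangentSpace 𝓘(ℝ, E) : M → Type _) x).symmL ℝ
      ((extChartAt 𝓘(ℝ, E) x).symm w) u))
  refine Eq.trans ?_ f2.symm
  rw [f1]
  rfl

/-- The `1`-form `df ∘ J`. -/
noncomputable def twist (f : M → ℝ) : DForm E M 1 ℝ :=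
  fun x => oneForm ((mfderiv 𝓘(ℝ, E) 𝓘(ℝ, ℝ) f x : E →L[ℝ] ℝ) ∘L S.Jmodel x)

theorem twist_inChart {f : M → ℝ} (hf : ContMDiff 𝓘(ℝ, E) 𝓘(ℝ, ℝ) ∞ f) {x : M} {y : E}
    (hy : y ∈ (extChartAt 𝓘(ℝ, E) x).target) :
    (S.twist f).inChart x y = oneForm
      (fderiv ℝ (fun y => f ((extChartAt 𝓘(ℝ, E) x).symm y)) y ∘L S.chartJ x y) := by
  have h := mfderiv_comp (I := 𝓘(ℝ, E)) (I' := 𝓘(ℝ, E)) (I'' := 𝓘(ℝ, ℝ)) y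
    ((hf _).mdifferentiableAt (by simp))
    ((contMDiffAt_extChartAt_symm_of_mem hy).mdifferentiableAt (by simp))
  rw [mfderiv_eq_fderiv] at h
  ext v
  change (mfderiv 𝓘(ℝ, E) 𝓘(ℝ, ℝ) f ((extChartAt 𝓘(ℝ, E) x).symm y) : E →L[ℝ] ℝ)
    (S.Jmodel ((extChartAt 𝓘(ℝ, E) x).symm y) (dSymm x y (v 0))) =
    fderiv ℝ (f ∘ (extChartAt 𝓘(ℝ, E) x).symm) y (S.chartJ x y (v 0))
  rw [h, ← S.dSymm_chartJ hy]
  rfl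

theorem contDiffAt_comp_extChartAt_symm {f : M → ℝ} (hf : ContMDiff 𝓘(ℝ, E) 𝓘(ℝ, ℝ) ∞ f) {x : M}
    {y : E} (hy : y ∈ (extChartAt 𝓘(ℝ, E) x).target) :
    ContDiffAt ℝ ∞ (fun y => f ((extChartAt 𝓘(ℝ, E) x).symm y)) y := by
  rw [← contMDiffAt_iff_contDiffAt]
  exact (hf _).comp y (contMDiffAt_extChartAt_symm_of_mem hy)

theorem isSmooth_twist {f : M → ℝ} (hf : ContMDiff 𝓘(ℝ, E) 𝓘(ℝ, ℝ) ∞ f) :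
    (S.twist f).IsSmooth := by
  intro x y hy
  refine ContDiffAt.contDiffWithinAt ?_
  refine ContDiffAt.congr_of_eventuallyEq (contDiffAt_oneForm_iff.2 ?_) (Filter.eventually_of_mem
    ((isOpen_extChartAt_target x).mem_nhds hy) fun w hw => S.twist_inChart hf hw)
  exact ((contDiffAt_comp_extChartAt_symm hf hy).fderiv_right (by simp)).clm_comp
    (S.contDiffAt_chartJ hy)

/-- The vanishing of the Nijenhuis tensor, in a chart. -/
theorem nijenhuis_inChart (x : M) (u v : E) :
    let y := extChartAt 𝓘(ℝ, E) x x
    let J := S.chartJ x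
    fderiv ℝ J y (J y u) v - fderiv ℝ J y (J y v) u +
      J y (fderiv ℝ J y v u) - J y (fderiv ℝ J y u v) = 0 := by
  intro y J
  have hd : DifferentiableAt ℝ J y :=
    (S.contDiffAt_chartJ (mem_extChartAt_target x)).differentiableAt (by simp)
  have h1 : ∀ w : E, ∀ᶠ z in 𝓝 y, (chartConstField x w ((extChartAt 𝓘(ℝ, E) x).symm z) : E) =
      dSymm x z w := by
    intro w
    filter_upwards [extChartAt_target_mem_nhds (I := 𝓘(ℝ, E)) x] with z hz
    simp only [chartConstField]
    rw [(extChartAt 𝓘(ℝ, E) x).right_inv hz]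
  have h2 : ∀ w : E, ∀ᶠ z in 𝓝 y, (S.Jmodel ((extChartAt 𝓘(ℝ, E) x).symm z)
      (chartConstField x w ((extChartAt 𝓘(ℝ, E) x).symm z)) : E) = dSymm x z (J z w) := by
    intro w
    filter_upwards [h1 w, extChartAt_target_mem_nhds (I := 𝓘(ℝ, E)) x] with z hz hzt
    rw [S.dSymm_chartJ hzt]
    exact congrArg _ hz
  have hN := S.nijenhuis (chartAt E x).source (chartAt E x).open_source _ _
    (contMDiffOn_chartConstField x u) (contMDiffOn_chartConstField x v) x (mem_chart_source E x)
  have hfd : ∀ w : E, fderiv ℝ (fun z => J z w) y = (fderiv ℝ J y).flip w := by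
    intro w
    rw [fderiv_clm_apply hd (differentiableAt_const _)]
    simp
  have e1 := mlieBracket_eq_lieBracket (X := fun z => S.J z (chartConstField x u z))
    (Y := fun z => S.J z (chartConstField x v z)) (h2 u) (h2 v)
  have e2 := mlieBracket_eq_lieBracket (X := fun z => S.J z (chartConstField x u z))
    (Y := fun z => chartConstField x v z) (h2 u) (h1 v)
  have e3 := mlieBracket_eq_lieBracket (X := fun z => chartConstField x u z)
    (Y := fun z => S.J z (chartConstField x v z)) (h1 u) (h2 v)
  have e4 := mlieBracket_eq_lieBracket (X := fun z => chartConstField x u z)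
    (Y := fun z => chartConstField x v z) (h1 u) (h1 v)
  have hN' : VectorField.lieBracket ℝ (fun z => J z u) (fun z => J z v) y -
      J y (VectorField.lieBracket ℝ (fun z => J z u) (fun z => v) y) -
      J y (VectorField.lieBracket ℝ (fun z => u) (fun z => J z v) y) -
      VectorField.lieBracket ℝ (fun z => u) (fun z => v) y = 0 := by
    rw [← e1, ← e2, ← e3, ← e4, show J y = S.Jmodel x from S.chartJ_self x]
    exact hN
  -- For fields constant in the chart the bracket `[u, v]` vanishes, and the other three brackets
  -- involve only first derivatives of `J`.
  simp only [VectorField.lieBracket, hfd, fderiv_fun_const] at hN'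
  simp at hN'
  rw [← hN']

/-- The exterior derivative of `df ∘ J` is invariant under `J`. -/
theorem twist_d_J_J {f : M → ℝ} (hf : ContMDiff 𝓘(ℝ, E) 𝓘(ℝ, ℝ) ∞ f) (x : M)
    (u v : E) : (S.twist f).d x ![S.Jmodel x u, S.Jmodel x v] = (S.twist f).d x ![u, v] := by
  set y := extChartAt 𝓘(ℝ, E) x x with hy
  set J := S.chartJ x with hJ
  set g := fun y => f ((extChartAt 𝓘(ℝ, E) x).symm y) with hg
  have hyt : y ∈ (extChartAt 𝓘(ℝ, E) x).target := mem_extChartAt_target x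
  have hgs : ContDiffAt ℝ ∞ g y := contDiffAt_comp_extChartAt_symm hf hyt
  have hdg : DifferentiableAt ℝ (fderiv ℝ g) y :=
    (hgs.fderiv_right (m := ∞) (by simp)).differentiableAt (by simp)
  have hd : DifferentiableAt ℝ J y :=
    (S.contDiffAt_chartJ hyt).differentiableAt (by simp)
  have hform : (S.twist f).inChart x =ᶠ[𝓝 y] fun y => oneForm (fderiv ℝ g y ∘L J y) :=
    Filter.eventually_of_mem ((isOpen_extChartAt_target x).mem_nhds hyt)
      fun w hw => S.twist_inChart hf hw
  have hdx : ∀ a b : E, (S.twist f).d x ![a, b] =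
      extDeriv (fun y => oneForm (fderiv ℝ g y ∘L J y)) y ![a, b] := by
    intro a b
    rw [← hform.extDeriv_eq]
    change extDeriv ((S.twist f).inChart x) y (fun i => dChart x x (![a, b] i)) = _
    rw [dChart_self]
    rfl
  have hsymm : ∀ a b, fderiv ℝ (fderiv ℝ g) y a b = fderiv ℝ (fderiv ℝ g) y b a :=
    (hgs.isSymmSndFDerivAt minSmoothness_two_le_infty).eq
  have hJJ : ∀ a, J y (J y a) = -a := S.chartJ_chartJ hyt
  -- Differentiate `J² = -1`, which holds on the whole chart.
  have hJJ' : ∀ a b, fderiv ℝ J y a (J y b) = -J y (fderiv ℝ J y a b) := by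
    intro a b
    have h1 : (fun z => J z (J z b)) =ᶠ[𝓝 y] fun _ => -b :=
      Filter.eventually_of_mem ((isOpen_extChartAt_target x).mem_nhds hyt)
        fun w hw => S.chartJ_chartJ hw b
    have h2 := h1.fderiv_eq (𝕜 := ℝ)
    rw [fderiv_clm_apply hd (hd.clm_apply (differentiableAt_const _)),
      fderiv_clm_apply hd (differentiableAt_const _)] at h2
    have h3 := DFunLike.congr_fun h2 a
    simp at h3
    rw [add_comm] at h3
    exact eq_neg_of_add_eq_zero_left h3
  have hN := congrArg (J y) (S.nijenhuis_inChart x u v)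
  simp only [map_sub, map_add, map_zero, ← hJ, ← hy, hJJ] at hN
  rw [show S.Jmodel x = J y from (S.chartJ_self x).symm]
  have key : ∀ a b : E, extDeriv (fun y => oneForm (fderiv ℝ g y ∘L J y)) y ![a, b] =
      fderiv ℝ (fderiv ℝ g) y a (J y b) - fderiv ℝ (fderiv ℝ g) y b (J y a) +
        fderiv ℝ g y (fderiv ℝ J y a b - fderiv ℝ J y b a) := by
    intro a b
    rw [extDeriv_oneForm_apply (hdg.clm_comp hd), fderiv_clm_comp hdg hd]
    simp
    ring
  refine (hdx _ _).trans (Eq.trans ?_ (hdx _ _).symm)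
  -- Passing from `u, v` to `Ju, Jv`, the second derivative terms of `g` match by symmetry of the
  -- Hessian and `J² = -1`. The terms with derivatives of `J` match by `hJJ'` and by `hN`, the
  -- Nijenhuis identity with `J` applied to it.
  rw [key, key]
  simp only [hJJ, hJJ', map_neg, map_sub]
  have hN2 := congrArg (fderiv ℝ g y) hN
  simp only [map_sub, map_add, map_neg, map_zero] at hN2
  rw [hsymm (J y u) v, hsymm (J y v) u]
  linarith

end KahlerStructure

end Twist

/-! ### Covector fields and vector fields in coordinates -/

section CovectorFields

variable {E : Type*} [NormedAddCommGroup E] [NormedSpace ℝ E]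
  {N : Type*} [TopologicalSpace N] [ChartedSpace E N] [IsManifold 𝓘(ℝ, E) ∞ N]
  {V : Type*} [NormedAddCommGroup V] [NormedSpace ℝ V]

/-- The pullback of a covector field to a normed space. -/
noncomputable def pullCovector (θ : ∀ z : N, TangentSpace 𝓘(ℝ, E) z →L[ℝ] ℝ) (f : V → N) (v : V) :
    V →L[ℝ] ℝ :=
  (θ (f v) : E →L[ℝ] ℝ) ∘L (mfderiv 𝓘(ℝ, V) 𝓘(ℝ, E) f v : V →L[ℝ] E)

theorem pullCovector_apply (θ : ∀ z : N, TangentSpace 𝓘(ℝ, E) z →L[ℝ] ℝ) (f : V → N) (v w : V) :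
    pullCovector θ f v w = θ (f v) (mfderiv 𝓘(ℝ, V) 𝓘(ℝ, E) f v w) := rfl

theorem contDiffAt_pullCovector {θ : ∀ z : N, TangentSpace 𝓘(ℝ, E) z →L[ℝ] ℝ}
    (hθ : DForm.IsSmooth (E := E) (fun z : N => oneForm (θ z))) {f : V → N} {v : V}
    (hf : ContMDiffAt 𝓘(ℝ, V) 𝓘(ℝ, E) ∞ f v) : ContDiffAt ℝ ∞ (pullCovector θ f) v :=
  contDiffAt_oneForm_iff.1 (hθ.contDiffAt_pull hf)

theorem d_oneForm_mfderiv {θ : ∀ z : N, TangentSpace 𝓘(ℝ, E) z →L[ℝ] ℝ}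
    (hθ : DForm.IsSmooth (E := E) (fun z : N => oneForm (θ z))) {f : V → N} {v : V}
    (hf : ContMDiffAt 𝓘(ℝ, V) 𝓘(ℝ, E) ∞ f v) (u w : V) :
    DForm.d (E := E) (fun z : N => oneForm (θ z)) (f v)
      ![mfderiv 𝓘(ℝ, V) 𝓘(ℝ, E) f v u, mfderiv 𝓘(ℝ, V) 𝓘(ℝ, E) f v w] =
      extDeriv (fun v => oneForm (pullCovector θ f v)) v ![u, w] := by
  have h := hθ.extDeriv_pull hf
  have h1 := congrArg (fun a => a ![u, w]) h
  refine Eq.trans ?_ h1.symm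
  rw [DForm.pull_apply]
  congr 1
  funext i
  fin_cases i <;> rfl

/-- A smooth vector field is smooth in every chart. -/
theorem contDiffAt_dChart_apply {X : ∀ z : N, TangentSpace 𝓘(ℝ, E) z} {x : N} {y : E}
    (hy : y ∈ (extChartAt 𝓘(ℝ, E) x).target)
    (hX : ContMDiffAt 𝓘(ℝ, E) 𝓘(ℝ, E).tangent 1
      (fun z => (⟨z, X z⟩ : TangentBundle 𝓘(ℝ, E) N)) ((extChartAt 𝓘(ℝ, E) x).symm y)) :
    ContDiffAt ℝ 1 (fun w => dChart x ((extChartAt 𝓘(ℝ, E) x).symm w)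
      (X ((extChartAt 𝓘(ℝ, E) x).symm w) : E)) y := by
  have hz : (extChartAt 𝓘(ℝ, E) x).symm y ∈ (chartAt E x).source := by
    simpa using (extChartAt 𝓘(ℝ, E) x).map_target hy
  have h1 := (Bundle.Trivialization.contMDiffAt_section_iff (IB := 𝓘(ℝ, E))
    (trivializationAt E (TangentSpace 𝓘(ℝ, E) : N → Type _) x) hz).1 hX
  rw [← contMDiffAt_iff_contDiffAt]
  refine (h1.comp y ((contMDiffAt_extChartAt_symm_of_mem hy).of_le (by simp))).congr_of_eventuallyEq ?_
  filter_upwards [(isOpen_extChartAt_target x).mem_nhds hy] with w hw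
  have hw' : (extChartAt 𝓘(ℝ, E) x).symm w ∈ (chartAt E x).source := by
    simpa using (extChartAt 𝓘(ℝ, E) x).map_target hw
  have e1 := TangentBundle.continuousLinearMapAt_trivializationAt (I := 𝓘(ℝ, E)) hw'
  have f2 := DFunLike.congr_fun e1 (X ((extChartAt 𝓘(ℝ, E) x).symm w))
  refine Eq.trans f2.symm ?_
  rw [Bundle.Trivialization.continuousLinearMapAt_apply, Bundle.Trivialization.linearMapAt_apply]
  exact if_pos hw'

end CovectorFields

/-! ### The group action on Z and the horizontal subspaces -/

section Action

variable {E : Type*} [NormedAddCommGroup E] [NormedSpace ℝ E] [FiniteDimensional ℝ E]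
  {M : Type*} [TopologicalSpace M] [ChartedSpace E M] [IsManifold 𝓘(ℝ, E) ∞ M]
  {G : Type*} [NormedAddCommGroup G] [NormedSpace ℝ G] [FiniteDimensional ℝ G]
  {K : Type*} [TopologicalSpace K] [ChartedSpace G K] [Group K] [LieGroup 𝓘(ℝ, G) ∞ K]
  [MulAction K M] [ContMDiffSMul 𝓘(ℝ, G) 𝓘(ℝ, E) ∞ K M]
  {E' : Type*} [NormedAddCommGroup E'] [NormedSpace ℝ E'] [FiniteDimensional ℝ E']
  {S : KahlerStructure E M} {Φ : M → G →L[ℝ] ℝ} [ChartedSpace E' (ZeroLevel Φ)]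
  [IsManifold 𝓘(ℝ, E') ∞ (ZeroLevel Φ)]

/-- The derivative of the moment map. -/
noncomputable def momentDeriv (Φ : M → G →L[ℝ] ℝ) (x : M) : E →L[ℝ] G →L[ℝ] ℝ :=
  mfderiv 𝓘(ℝ, E) 𝓘(ℝ, G →L[ℝ] ℝ) Φ x

namespace IsKahlerReduction

variable (h : IsKahlerReduction E' K S Φ)
include h

theorem contMDiffAt_incl (z : ZeroLevel Φ) :
    ContMDiffAt 𝓘(ℝ, E') 𝓘(ℝ, E) ∞ (Subtype.val : ZeroLevel Φ → M) z :=
  h.embedded.contMDiff z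

/-- The action on the zero level set is smooth. -/
theorem contMDiffAt_act {E₀ : Type*} [NormedAddCommGroup E₀] [NormedSpace ℝ E₀] {N : Type*}
    [TopologicalSpace N] [ChartedSpace E₀ N] {k : N → K} {z : N → ZeroLevel Φ} {x : N}
    (hk : ContMDiffAt 𝓘(ℝ, E₀) 𝓘(ℝ, G) ∞ k x) (hz : ContMDiffAt 𝓘(ℝ, E₀) 𝓘(ℝ, E') ∞ z x) :
    ContMDiffAt 𝓘(ℝ, E₀) 𝓘(ℝ, E') ∞ (fun v => h.moment.act (k v) (z v)) x := by
  have h1 : ContMDiffAt 𝓘(ℝ, E₀) 𝓘(ℝ, E) ∞ (fun v => k v • (z v).1) x :=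
    (contMDiff_smul (I := 𝓘(ℝ, G)) (I' := 𝓘(ℝ, E)) (n := ∞) (G := K) (M := M)).contMDiffAt.comp x
      (hk.prodMk ((h.contMDiffAt_incl (z x)).comp x hz))
  -- A continuous map into `Z` is smooth once it is smooth as a map into `M`; continuity is
  -- automatic because `Z` has the subspace topology.
  rw [ContMDiffAt.iff_comp_isImmersionAt (h.embedded.isImmersion.isImmersionAt _)]
  exact ⟨Topology.IsInducing.subtypeVal.continuousAt_iff.mpr h1.continuousAt, h1⟩

theorem act_one (z : ZeroLevel Φ) : h.moment.act (1 : K) z = z :=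
  Subtype.ext (one_smul K z.1)

theorem act_mul (k l : K) (z : ZeroLevel Φ) :
    h.moment.act (k * l) z = h.moment.act k (h.moment.act l z) :=
  Subtype.ext (mul_smul k l z.1)

theorem contMDiff_act_inv (z : ZeroLevel Φ) :
    ContMDiff 𝓘(ℝ, G) 𝓘(ℝ, E') ∞ (fun k : K => h.moment.act k⁻¹ z) := fun k =>
  h.contMDiffAt_act (contMDiff_inv 𝓘(ℝ, G) ∞ k) contMDiffAt_const

theorem contMDiff_act_left (k : K) : ContMDiff 𝓘(ℝ, E') 𝓘(ℝ, E') ∞ (h.moment.act k) := fun _ =>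
  h.contMDiffAt_act contMDiffAt_const contMDiffAt_id

theorem mfderiv_moment_apply (x : M) (ξ : GroupLieAlgebra 𝓘(ℝ, G) K) (u : E) :
    mfderiv 𝓘(ℝ, E) 𝓘(ℝ, ℝ) (fun y => Φ y ξ) x u =
      momentDeriv (E := E) Φ x u ξ := by
  let ev : (G →L[ℝ] ℝ) →L[ℝ] ℝ := ContinuousLinearMap.apply ℝ ℝ (ξ : G)
  have h3 := mfderiv_comp_apply (f := Φ) (g := ev) x
    (ev.differentiableAt.mdifferentiableAt) ((h.moment.smooth x).mdifferentiableAt (by simp)) u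
  rw [mfderiv_eq_fderiv, ev.fderiv] at h3
  exact h3

/-- This is Hamilton's equation applied to `Jv`. It identifies `d⟨Φ, ξ⟩ ∘ J` on `Z` with minus the
metric dual of `ξ_Z`, which is the bridge from the moment map to the connection. -/
theorem gZ_field (z : ZeroLevel Φ) (ξ : GroupLieAlgebra 𝓘(ℝ, G) K)
    (v : TangentSpace 𝓘(ℝ, E') z) :
    h.gZ z (h.field z ξ) v = -mfderiv 𝓘(ℝ, E) 𝓘(ℝ, ℝ) (fun y => Φ y ξ) z.1
      (S.J z.1 (h.inclDeriv z v)) := by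
  rw [gZ_apply, KahlerStructure.g, h.inclDeriv_field]
  exact (neg_eq_iff_eq_neg.1 (h.moment.hamilton z.1 ξ (S.J z.1 (h.inclDeriv z v))))

theorem gZ_field' (z : ZeroLevel Φ) (ξ : GroupLieAlgebra 𝓘(ℝ, G) K)
    (v : TangentSpace 𝓘(ℝ, E') z) :
    h.gZ z (h.field z ξ) v = -momentDeriv (E := E) Φ z.1
      (S.J z.1 (h.inclDeriv z v)) ξ :=
  (h.gZ_field z ξ v).trans (congrArg _ (h.mfderiv_moment_apply z.1 ξ _))

/-- The condition on the right refers only to `dΦ` and `J`. Its behaviour under the group follows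
from equivariance and holomorphy, with no separate argument that the metric is invariant. -/
theorem mem_H_iff {z : ZeroLevel Φ} {v : TangentSpace 𝓘(ℝ, E') z} :
    v ∈ h.H z ↔ momentDeriv (E := E) Φ z.1 (S.J z.1 (h.inclDeriv z v)) = 0 := by
  constructor
  · intro hv
    refine ContinuousLinearMap.ext fun ξ => ?_
    have h1 : h.gZ z (h.field z ξ) v = 0 := hv _ ⟨ξ, rfl⟩
    exact neg_eq_zero.mp ((h.gZ_field' z ξ v).symm.trans h1)
  · rintro hv _ ⟨ξ, rfl⟩
    refine (h.gZ_field' z ξ v).trans (neg_eq_zero.mpr ?_)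
    exact DFunLike.congr_fun hv _

/-- The derivative of a group element maps the horizontal subspaces to each other. -/
theorem mfderiv_act_mem_H (k : K) {z : ZeroLevel Φ} {v : TangentSpace 𝓘(ℝ, E') z}
    (hv : v ∈ h.H z) :
    mfderiv 𝓘(ℝ, E') 𝓘(ℝ, E') (h.moment.act k) z v ∈ h.H (h.moment.act k z) := by
  have hne : (∞ : WithTop ℕ∞) ≠ 0 := by simp
  have hk : ContMDiff 𝓘(ℝ, E) 𝓘(ℝ, E) ∞ (fun x : M => k • x) :=
    (contMDiff_smul (I := 𝓘(ℝ, G)) (I' := 𝓘(ℝ, E)) (n := ∞) (G := K) (M := M)).comp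
      (contMDiff_const.prodMk contMDiff_id)
  have hkz : MDifferentiableAt 𝓘(ℝ, E) 𝓘(ℝ, E) (fun x : M => k • x) z.1 :=
    (hk z.1).mdifferentiableAt hne
  rw [h.mem_H_iff] at hv ⊢
  have e1 : h.inclDeriv (h.moment.act k z) (mfderiv 𝓘(ℝ, E') 𝓘(ℝ, E') (h.moment.act k) z v) =
      mfderiv 𝓘(ℝ, E) 𝓘(ℝ, E) (fun x : M => k • x) z.1 (h.inclDeriv z v) := by
    have a1 := mfderiv_comp_apply (f := h.moment.act k) z
      ((h.contMDiffAt_incl _).mdifferentiableAt hne)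
      ((h.contMDiff_act_left k z).mdifferentiableAt hne) v
    have a2 := mfderiv_comp_apply (f := (Subtype.val : ZeroLevel Φ → M)) z hkz
      ((h.contMDiffAt_incl _).mdifferentiableAt hne) v
    exact a1.symm.trans a2
  rw [e1]
  change momentDeriv (E := E) Φ (k • z.1) (S.J (k • z.1) _) = 0
  rw [← h.holomorphic]
  set u := S.J z.1 (h.inclDeriv z v)
  have a3 := mfderiv_comp_apply (f := fun x : M => k • x) z.1
    ((h.moment.smooth (k • z.1)).mdifferentiableAt hne) hkz u
  refine a3.symm.trans ?_
  -- `C` is the coadjoint action of `k`. Equivariance reads `Φ ∘ k = C ∘ Φ`, so `dΦ` at `k z` kills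
  -- the image of every vector killed by `dΦ` at `z`.
  let C : (G →L[ℝ] ℝ) →L[ℝ] (G →L[ℝ] ℝ) := (ContinuousLinearMap.compL ℝ G G ℝ).flip (Ad k⁻¹)
  have hC : Φ ∘ (fun x : M => k • x) = C ∘ Φ := by
    funext x
    refine ContinuousLinearMap.ext fun ξ => ?_
    exact h.moment.equivariant k x ξ
  rw [hC]
  have a4 := mfderiv_comp_apply (f := Φ) (g := C) z.1 C.differentiableAt.mdifferentiableAt
    ((h.moment.smooth z.1).mdifferentiableAt hne) u
  refine a4.trans ?_
  exact (congrArg (mfderiv 𝓘(ℝ, G →L[ℝ] ℝ) 𝓘(ℝ, G →L[ℝ] ℝ) C (Φ z.1)) hv).trans (map_zero _)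

end IsKahlerReduction

end Action

/-! ### The action map in charts and its partial derivatives -/

section FundamentalFields

variable {E : Type*} [NormedAddCommGroup E] [NormedSpace ℝ E] [FiniteDimensional ℝ E]
  {M : Type*} [TopologicalSpace M] [ChartedSpace E M] [IsManifold 𝓘(ℝ, E) ∞ M]
  {G : Type*} [NormedAddCommGroup G] [NormedSpace ℝ G] [FiniteDimensional ℝ G]
  {K : Type*} [TopologicalSpace K] [ChartedSpace G K] [Group K] [LieGroup 𝓘(ℝ, G) ∞ K]
  [MulAction K M] [ContMDiffSMul 𝓘(ℝ, G) 𝓘(ℝ, E) ∞ K M]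
  {E' : Type*} [NormedAddCommGroup E'] [NormedSpace ℝ E'] [FiniteDimensional ℝ E']
  {S : KahlerStructure E M} {Φ : M → G →L[ℝ] ℝ} [ChartedSpace E' (ZeroLevel Φ)]
  [IsManifold 𝓘(ℝ, E') ∞ (ZeroLevel Φ)]

namespace IsKahlerReduction

variable (h : IsKahlerReduction E' K S Φ)

/-- The action map `(k, z) ↦ k⁻¹ z` in the charts around `1` and `x`. -/
noncomputable def actParam (x : ZeroLevel Φ) (p : G × E') : ZeroLevel Φ :=
  h.moment.act ((extChartAt 𝓘(ℝ, G) (1 : K)).symm p.1)⁻¹ ((extChartAt 𝓘(ℝ, E') x).symm p.2)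

theorem contMDiffAt_actParam {x : ZeroLevel Φ} {p : G × E'}
    (h1 : p.1 ∈ (extChartAt 𝓘(ℝ, G) (1 : K)).target) (h2 : p.2 ∈ (extChartAt 𝓘(ℝ, E') x).target) :
    ContMDiffAt 𝓘(ℝ, G × E') 𝓘(ℝ, E') ∞ (h.actParam x) p := by
  refine h.contMDiffAt_act ?_ ?_
  · refine (contMDiff_inv 𝓘(ℝ, G) ∞ (G := K) _).comp p ?_
    exact ContMDiffAt.comp (g := (extChartAt 𝓘(ℝ, G) (1 : K)).symm) p
      (contMDiffAt_extChartAt_symm_of_mem h1) contDiff_fst.contMDiff.contMDiffAt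
  · exact ContMDiffAt.comp (g := (extChartAt 𝓘(ℝ, E') x).symm) p
      (contMDiffAt_extChartAt_symm_of_mem h2) contDiff_snd.contMDiff.contMDiffAt

theorem actParam_one (x : ZeroLevel Φ) (y : E') :
    h.actParam x (extChartAt 𝓘(ℝ, G) (1 : K) 1, y) = (extChartAt 𝓘(ℝ, E') x).symm y := by
  simp only [actParam]
  rw [extChartAt_to_inv, inv_one, h.act_one]

/-- The fundamental vector field as a map into the model space. -/
noncomputable def fieldModel (z : ZeroLevel Φ) : G →L[ℝ] E' := h.field z

/-- The group direction at the identity: this is the definition of the fundamental field, since the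
chart of `K` has derivative the identity at `1`. -/
theorem mfderiv_actParam_inl {x : ZeroLevel Φ} {y : E'}
    (hy : y ∈ (extChartAt 𝓘(ℝ, E') x).target) (ξ : G) :
    (mfderiv 𝓘(ℝ, G × E') 𝓘(ℝ, E') (h.actParam x) (extChartAt 𝓘(ℝ, G) (1 : K) 1, y) :
      G × E' →L[ℝ] E') (ξ, 0) = h.fieldModel ((extChartAt 𝓘(ℝ, E') x).symm y) ξ := by
  have hne : (∞ : WithTop ℕ∞) ≠ 0 := by simp
  set s₀ := extChartAt 𝓘(ℝ, G) (1 : K) 1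
  have hs : s₀ ∈ (extChartAt 𝓘(ℝ, G) (1 : K)).target := mem_extChartAt_target 1
  have a1 := mfderiv_comp_apply (I := 𝓘(ℝ, G)) (I' := 𝓘(ℝ, G × E')) (I'' := 𝓘(ℝ, E'))
    (g := h.actParam x) (f := fun s : G => (s, y)) s₀
    ((h.contMDiffAt_actParam (p := (s₀, y)) hs hy).mdifferentiableAt hne)
    ((hasFDerivAt_prodMk_left s₀ y).differentiableAt.mdifferentiableAt) ξ
  rw [mfderiv_eq_fderiv (f := fun s : G => (s, y)), (hasFDerivAt_prodMk_left s₀ y).fderiv] at a1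
  have a2 := mfderiv_comp_apply_of_eq (I := 𝓘(ℝ, G)) (I' := 𝓘(ℝ, G)) (I'' := 𝓘(ℝ, E'))
    (g := fun k : K => h.moment.act k⁻¹ ((extChartAt 𝓘(ℝ, E') x).symm y))
    (f := (extChartAt 𝓘(ℝ, G) (1 : K)).symm) s₀
    ((h.contMDiff_act_inv _ (1 : K)).mdifferentiableAt hne)
    ((contMDiffAt_extChartAt_symm_of_mem hs).mdifferentiableAt hne) (extChartAt_to_inv 1) ξ
  refine a1.symm.trans (a2.trans ?_)
  have a3 : (mfderiv 𝓘(ℝ, G) 𝓘(ℝ, G) (extChartAt 𝓘(ℝ, G) (1 : K)).symm s₀ : G →L[ℝ] G) ξ = ξ :=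
    DFunLike.congr_fun (dSymm_self (E := G) (1 : K)) ξ
  exact congrArg (h.fieldModel ((extChartAt 𝓘(ℝ, E') x).symm y)) a3

/-- The space direction, at an arbitrary group parameter: only the derivative of one fixed group
element enters, to which `mfderiv_act_mem_H` applies. -/
theorem mfderiv_actParam_inr {x : ZeroLevel Φ} {s : G} {y : E'}
    (hs : s ∈ (extChartAt 𝓘(ℝ, G) (1 : K)).target)
    (hy : y ∈ (extChartAt 𝓘(ℝ, E') x).target) (w : E') :
    (mfderiv 𝓘(ℝ, G × E') 𝓘(ℝ, E') (h.actParam x) (s, y) : G × E' →L[ℝ] E') (0, w) =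
      (mfderiv 𝓘(ℝ, E') 𝓘(ℝ, E') (h.moment.act ((extChartAt 𝓘(ℝ, G) (1 : K)).symm s)⁻¹)
        ((extChartAt 𝓘(ℝ, E') x).symm y) : E' →L[ℝ] E') (dSymm x y w) := by
  have hne : (∞ : WithTop ℕ∞) ≠ 0 := by simp
  have a1 := mfderiv_comp_apply (I := 𝓘(ℝ, E')) (I' := 𝓘(ℝ, G × E')) (I'' := 𝓘(ℝ, E'))
    (g := h.actParam x) (f := fun y : E' => (s, y)) y
    ((h.contMDiffAt_actParam (p := (s, y)) hs hy).mdifferentiableAt hne)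
    ((hasFDerivAt_prodMk_right s y).differentiableAt.mdifferentiableAt) w
  rw [mfderiv_eq_fderiv (f := fun y : E' => (s, y)), (hasFDerivAt_prodMk_right s y).fderiv] at a1
  have a2 := mfderiv_comp_apply (I := 𝓘(ℝ, E')) (I' := 𝓘(ℝ, E')) (I'' := 𝓘(ℝ, E'))
    (g := h.moment.act ((extChartAt 𝓘(ℝ, G) (1 : K)).symm s)⁻¹)
    (f := (extChartAt 𝓘(ℝ, E') x).symm) y
    ((h.contMDiff_act_left _ _).mdifferentiableAt hne)
    ((contMDiffAt_extChartAt_symm_of_mem hy).mdifferentiableAt hne) w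
  exact a1.symm.trans a2

/-- The fundamental vector field of `ξ` in the chart around `x`. -/
noncomputable def chartField (x : ZeroLevel Φ) (ξ : G) (y : E') : E' :=
  dChart x ((extChartAt 𝓘(ℝ, E') x).symm y) (h.fieldModel ((extChartAt 𝓘(ℝ, E') x).symm y) ξ)

theorem dSymm_chartField {x : ZeroLevel Φ} {y : E'} (hy : y ∈ (extChartAt 𝓘(ℝ, E') x).target)
    (ξ : G) : dSymm x y (h.chartField x ξ y) =
      h.fieldModel ((extChartAt 𝓘(ℝ, E') x).symm y) ξ :=
  dSymm_dChart hy _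

/-- A fundamental field is a partial derivative, along the slice `k = 1`, of the jointly smooth
action map, hence smooth. -/
theorem contDiffAt_chartField {x : ZeroLevel Φ} {y : E'}
    (hy : y ∈ (extChartAt 𝓘(ℝ, E') x).target) (ξ : G) :
    ContDiffAt ℝ ∞ (h.chartField x ξ) y := by
  have hne : (∞ : WithTop ℕ∞) ≠ 0 := by simp
  set s₀ := extChartAt 𝓘(ℝ, G) (1 : K) 1 with hs₀
  have hs : s₀ ∈ (extChartAt 𝓘(ℝ, G) (1 : K)).target := mem_extChartAt_target 1
  have hsrc : ∀ w ∈ (extChartAt 𝓘(ℝ, E') x).target,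
      h.actParam x (s₀, w) ∈ (extChartAt 𝓘(ℝ, E') x).source := by
    intro w hw
    rw [h.actParam_one]
    exact (extChartAt 𝓘(ℝ, E') x).map_target hw
  have h1 : ContDiffAt ℝ ∞ (fun p => extChartAt 𝓘(ℝ, E') x (h.actParam x p)) (s₀, y) :=
    contDiffAt_extChartAt_comp (h.contMDiffAt_actParam (p := (s₀, y)) hs hy) (hsrc y hy)
  have h2 : ContDiffAt ℝ ∞ (fun w => fderiv ℝ
      (fun p => extChartAt 𝓘(ℝ, E') x (h.actParam x p)) (s₀, w) (ξ, 0)) y := by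
    have h3 := h1.fderiv_right (m := ∞) (by simp)
    have h4 := h3.comp y ((contDiff_prodMk_right s₀).contDiffAt (x := y))
    exact h4.clm_apply contDiffAt_const
  refine h2.congr_of_eventuallyEq ?_
  filter_upwards [(isOpen_extChartAt_target x).mem_nhds hy] with w hw
  have hφ : MDifferentiableAt 𝓘(ℝ, E') 𝓘(ℝ, E') (extChartAt 𝓘(ℝ, E') x)
      (h.actParam x (s₀, w)) :=
    (contMDiffAt_extChartAt' (n := 1) (by simpa using hsrc w hw)).mdifferentiableAt (by simp)
  have h5 := mfderiv_comp_apply (I := 𝓘(ℝ, G × E')) (I' := 𝓘(ℝ, E')) (I'' := 𝓘(ℝ, E'))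
    (g := extChartAt 𝓘(ℝ, E') x) (f := h.actParam x) (s₀, w) hφ
    ((h.contMDiffAt_actParam (p := (s₀, w)) hs hw).mdifferentiableAt hne) (ξ, 0)
  rw [mfderiv_eq_fderiv] at h5
  refine Eq.trans ?_ h5.symm
  have h6 : ∀ (z z' : ZeroLevel Φ) (u u' : E'), z = z' → u = u' →
      dChart x z u = dChart x z' u' := by
    rintro z _ u _ rfl rfl; rfl
  exact h6 _ _ _ _ (h.actParam_one x w).symm (h.mfderiv_actParam_inl hw ξ).symm

/-- The left invariant vector field of `ξ` on the group, in the chart around `1`. -/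
noncomputable def chartInvariantField (K : Type*) [TopologicalSpace K] [ChartedSpace G K] [Group K]
    [LieGroup 𝓘(ℝ, G) ∞ K] (ξ : G) (s : G) : G :=
  dChart (1 : K) ((extChartAt 𝓘(ℝ, G) (1 : K)).symm s)
    (mulInvariantVectorField (I := 𝓘(ℝ, G)) (G := K) ξ
      ((extChartAt 𝓘(ℝ, G) (1 : K)).symm s))

end IsKahlerReduction

end FundamentalFields

/-- On constant vectors `dθ(u, w)` is the difference of two such derivatives; in `d_field_H` each of
them vanishes because the coefficient is constant along a line. -/
theorem fderiv_apply_eq_zero_of_eventually_const {V W : Type*} [NormedAddCommGroup V]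
    [NormedSpace ℝ V] [NormedAddCommGroup W] [NormedSpace ℝ W] {a : V → W →L[ℝ] ℝ} {p u : V} {w : W}
    {C : ℝ} (ha : DifferentiableAt ℝ a p) (hC : ∀ᶠ t in 𝓝 (0 : ℝ), a (p + t • u) w = C) :
    fderiv ℝ a p u w = 0 := by
  have h1 : HasDerivAt (fun t : ℝ => p + t • u) u 0 := by
    simpa using ((hasDerivAt_id (0 : ℝ)).smul_const u).const_add p
  have h2 : HasFDerivAt a (fderiv ℝ a p) (p + (0 : ℝ) • u) := by simpa using ha.hasFDerivAt
  have h3 := ((ContinuousLinearMap.apply ℝ ℝ w).hasFDerivAt.comp_hasDerivAt (0 : ℝ)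
    (h2.comp_hasDerivAt (0 : ℝ) h1))
  have h4 : HasDerivAt (fun t : ℝ => a (p + t • u) w) 0 0 :=
    (hasDerivAt_const (0 : ℝ) C).congr_of_eventuallyEq hC
  exact h3.unique h4

/-! ### The exterior derivative of the connection forms on orbit directions -/

section ConnectionForms

variable {E : Type*} [NormedAddCommGroup E] [NormedSpace ℝ E] [FiniteDimensional ℝ E]
  {M : Type*} [TopologicalSpace M] [ChartedSpace E M] [IsManifold 𝓘(ℝ, E) ∞ M]
  {G : Type*} [NormedAddCommGroup G] [NormedSpace ℝ G] [FiniteDimensional ℝ G]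
  {K : Type*} [TopologicalSpace K] [ChartedSpace G K] [Group K] [LieGroup 𝓘(ℝ, G) ∞ K]
  [MulAction K M] [ContMDiffSMul 𝓘(ℝ, G) 𝓘(ℝ, E) ∞ K M]
  {E' : Type*} [NormedAddCommGroup E'] [NormedSpace ℝ E'] [FiniteDimensional ℝ E']
  {S : KahlerStructure E M} {Φ : M → G →L[ℝ] ℝ} [ChartedSpace E' (ZeroLevel Φ)]
  [IsManifold 𝓘(ℝ, E') ∞ (ZeroLevel Φ)]

namespace IsKahlerReduction

variable {h : IsKahlerReduction E' K S Φ} {k : ℕ}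
  {ξ : Module.Basis (Fin k) ℝ (GroupLieAlgebra 𝓘(ℝ, G) K)}
  {θ : Fin k → ∀ z : ZeroLevel Φ, TangentSpace 𝓘(ℝ, E') z →L[ℝ] ℝ}

namespace IsConnection

variable (hθ : h.IsConnection ξ θ)
include hθ

theorem apply_field_repr (l : Fin k) (z : ZeroLevel Φ) (η : GroupLieAlgebra 𝓘(ℝ, G) K) :
    θ l z (h.field z η) = ξ.repr η l := by
  have h1 : (θ l z : TangentSpace 𝓘(ℝ, E') z →ₗ[ℝ] ℝ) ∘ₗ
      (h.field z : GroupLieAlgebra 𝓘(ℝ, G) K →ₗ[ℝ] TangentSpace 𝓘(ℝ, E') z) =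
      ξ.coord l := by
    refine ξ.ext fun j => ?_
    refine (hθ.apply_field l j z).trans ?_
    rw [Module.Basis.coord_apply, Module.Basis.repr_self, Finsupp.single_apply]
    simp only [eq_comm]
  exact LinearMap.congr_fun h1 η

/-- By invariance of the connection, `ι(η_Z) dθ` vanishes on horizontal vectors. -/
theorem d_field_H (l : Fin k) (z : ZeroLevel Φ) (η : G) {w : E'}
    (hw : (w : TangentSpace 𝓘(ℝ, E') z) ∈ h.H z) :
    DForm.d (E := E') (fun z : ZeroLevel Φ => oneForm (θ l z)) z ![h.fieldModel z η, w] = 0 := by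
  set s₀ := extChartAt 𝓘(ℝ, G) (1 : K) 1 with hs₀
  set y₀ := extChartAt 𝓘(ℝ, E') z z with hy₀
  have hs : s₀ ∈ (extChartAt 𝓘(ℝ, G) (1 : K)).target := mem_extChartAt_target 1
  have hy : y₀ ∈ (extChartAt 𝓘(ℝ, E') z).target := mem_extChartAt_target z
  have hz : (extChartAt 𝓘(ℝ, E') z).symm y₀ = z := extChartAt_to_inv z
  have hf := h.contMDiffAt_actParam (p := (s₀, y₀)) hs hy
  have ha : DifferentiableAt ℝ (pullCovector (θ l) (h.actParam z)) (s₀, y₀) :=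
    (contDiffAt_pullCovector (hθ.smooth l) hf).differentiableAt (by simp)
  -- Pull `θ^l` back along `(k, z) ↦ k⁻¹ z` and evaluate on constant vectors of the product; these
  -- commute, so only two derivative terms appear.
  have h1 := d_oneForm_mfderiv (hθ.smooth l) hf (η, (0 : E')) ((0 : G), w)
  rw [extDeriv_oneForm_apply ha] at h1
  have hwy : (dSymm z y₀ w : TangentSpace 𝓘(ℝ, E') ((extChartAt 𝓘(ℝ, E') z).symm y₀)) ∈
      h.H ((extChartAt 𝓘(ℝ, E') z).symm y₀) := by
    have e : ∀ (z' : ZeroLevel Φ) (w' : E'), z' = z → w' = w →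
        (w' : TangentSpace 𝓘(ℝ, E') z') ∈ h.H z' := by
      rintro _ _ rfl rfl; exact hw
    exact e _ _ hz (DFunLike.congr_fun (dSymm_self z) w)
  -- As the group parameter moves, `w` is carried to horizontal vectors, on which `θ^l` is zero.
  have t1 : fderiv ℝ (pullCovector (θ l) (h.actParam z)) (s₀, y₀) (η, (0 : E'))
      ((0 : G), w) = 0 := by
    refine fderiv_apply_eq_zero_of_eventually_const (C := 0) ha ?_
    have hc : Filter.Tendsto (fun t : ℝ => s₀ + t • η) (𝓝 0) (𝓝 s₀) := by
      have : Continuous (fun t : ℝ => s₀ + t • η) := by fun_prop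
      simpa using this.tendsto 0
    filter_upwards [hc ((isOpen_extChartAt_target (1 : K)).mem_nhds hs)] with t ht
    have e : ((s₀, y₀) : G × E') + t • (η, (0 : E')) = (s₀ + t • η, y₀) := by
      simp
    rw [e, pullCovector_apply]
    refine (congrArg (θ l (h.actParam z (s₀ + t • η, y₀)))
      (h.mfderiv_actParam_inr ht hy w)).trans ?_
    exact hθ.apply_H l _ _ (h.mfderiv_act_mem_H _ hwy)
  -- As the point moves, the group direction always maps to the fundamental field of `η`, whose
  -- `θ^l` is a fixed coordinate of `η`.
  have t2 : fderiv ℝ (pullCovector (θ l) (h.actParam z)) (s₀, y₀) ((0 : G), w)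
      (η, (0 : E')) = 0 := by
    refine fderiv_apply_eq_zero_of_eventually_const (C := ξ.repr η l) ha ?_
    have hc : Filter.Tendsto (fun t : ℝ => y₀ + t • w) (𝓝 0) (𝓝 y₀) := by
      have : Continuous (fun t : ℝ => y₀ + t • w) := by fun_prop
      simpa using this.tendsto 0
    filter_upwards [hc ((isOpen_extChartAt_target z).mem_nhds hy)] with t ht
    have e : ((s₀, y₀) : G × E') + t • ((0 : G), w) = (s₀, y₀ + t • w) := by
      simp
    rw [e, pullCovector_apply]
    refine (congrArg (θ l (h.actParam z (s₀, y₀ + t • w)))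
      (h.mfderiv_actParam_inl ht η)).trans ?_
    have e2 : ∀ z' z'' : ZeroLevel Φ, z' = z'' → θ l z' (h.fieldModel z'' η) = ξ.repr η l := by
      rintro z' _ rfl; exact hθ.apply_field_repr l z' η
    exact e2 _ _ (h.actParam_one z _)
  rw [t1, t2, sub_zero] at h1
  have e : ∀ (z' : ZeroLevel Φ) (u v : E'), z' = z → u = h.fieldModel z η → v = w →
      DForm.d (E := E') (fun z : ZeroLevel Φ => oneForm (θ l z)) z' ![u, v] = 0 →
      DForm.d (E := E') (fun z : ZeroLevel Φ => oneForm (θ l z)) z ![h.fieldModel z η, w] = 0 := by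
    rintro _ _ _ rfl rfl rfl h0; exact h0
  refine e _ _ _ ((h.actParam_one z y₀).trans hz) ?_ ?_ h1
  · refine (h.mfderiv_actParam_inl hy η).trans ?_
    rw [hz]
  · refine (h.mfderiv_actParam_inr hs hy w).trans ?_
    have e3 : (extChartAt 𝓘(ℝ, G) (1 : K)).symm s₀ = 1 := extChartAt_to_inv 1
    rw [e3, inv_one]
    have e4 : h.moment.act (1 : K) = id := funext h.act_one
    rw [e4, mfderiv_id]
    exact DFunLike.congr_fun (dSymm_self z) w

-- Since `(g k)⁻¹ z = k⁻¹ (g⁻¹ z)`, the orbit map turns left translation into a change of base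
-- point. So left invariant fields are related to fundamental fields with no sign.
omit hθ in
theorem mfderiv_act_inv_mulInvariantVectorField (z : ZeroLevel Φ) (g : K)
    (η : GroupLieAlgebra 𝓘(ℝ, G) K) :
    mfderiv 𝓘(ℝ, G) 𝓘(ℝ, E') (fun k : K => h.moment.act k⁻¹ z) g (mulInvariantVectorField η g) =
      h.field (h.moment.act g⁻¹ z) η := by
  have hne : (∞ : WithTop ℕ∞) ≠ 0 := by simp
  have a1 := mfderiv_comp_apply_of_eq (I := 𝓘(ℝ, G)) (I' := 𝓘(ℝ, G)) (I'' := 𝓘(ℝ, E'))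
    (g := fun k : K => h.moment.act k⁻¹ z) (f := fun k : K => g * k) (1 : K)
    ((h.contMDiff_act_inv z g).mdifferentiableAt hne)
    ((contMDiff_mul_left (I := 𝓘(ℝ, G)) (n := ∞) (a := g) (1 : K)).mdifferentiableAt hne)
    (mul_one g) η
  have a2 : (fun k : K => h.moment.act k⁻¹ z) ∘ (fun k : K => g * k) =
      fun k : K => h.moment.act k⁻¹ (h.moment.act g⁻¹ z) := by
    funext k
    rw [Function.comp_apply, mul_inv_rev, h.act_mul]
  rw [a2] at a1
  exact a1.symm

/-- The structure equation of the Lie algebra. -/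
theorem d_field_field (l : Fin k) (z : ZeroLevel Φ) (η ζ : GroupLieAlgebra 𝓘(ℝ, G) K) :
    DForm.d (E := E') (fun z : ZeroLevel Φ => oneForm (θ l z)) z ![h.field z η, h.field z ζ] =
      -ξ.repr ⁅η, ζ⁆ l := by
  have hne : (∞ : WithTop ℕ∞) ≠ 0 := by simp
  have hL : LieGroup 𝓘(ℝ, G) (minSmoothness ℝ 3) K := by
    refine LieGroup.of_le (n := ∞) ?_
    rw [minSmoothness_of_isRCLikeNormedField]
    exact WithTop.coe_le_coe.2 le_top
  set s₀ := extChartAt 𝓘(ℝ, G) (1 : K) 1 with hs₀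
  set F : K → ZeroLevel Φ := fun k => h.moment.act k⁻¹ z with hF
  set κ := extChartAt 𝓘(ℝ, G) (1 : K) with hκ
  have hs : s₀ ∈ κ.target := mem_extChartAt_target 1
  have hs1 : κ.symm s₀ = (1 : K) := extChartAt_to_inv 1
  have hF1 : F 1 = z := by rw [hF]; simp only [inv_one]; exact h.act_one z
  have hf : ContMDiffAt 𝓘(ℝ, G) 𝓘(ℝ, E') ∞ (F ∘ κ.symm) s₀ :=
    (h.contMDiff_act_inv z _).comp s₀ (contMDiffAt_extChartAt_symm_of_mem hs)
  have hd : ∀ s ∈ κ.target, ∀ v : G, (mfderiv 𝓘(ℝ, G) 𝓘(ℝ, E') (F ∘ κ.symm) s : G →L[ℝ] E') v =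
      (mfderiv 𝓘(ℝ, G) 𝓘(ℝ, E') F (κ.symm s) : G →L[ℝ] E') (dSymm (1 : K) s v) := fun s hs v =>
    mfderiv_comp_apply (I := 𝓘(ℝ, G)) (I' := 𝓘(ℝ, G)) (I'' := 𝓘(ℝ, E'))
      (g := F) (f := κ.symm) s ((h.contMDiff_act_inv z _).mdifferentiableAt hne)
      ((contMDiffAt_extChartAt_symm_of_mem hs).mdifferentiableAt hne) v
  have hX : ∀ s ∈ κ.target, ∀ η : G, dSymm (1 : K) s (chartInvariantField K η s) =
      mulInvariantVectorField (I := 𝓘(ℝ, G)) (G := K) η (κ.symm s) := fun s hs η =>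
    dSymm_dChart hs _
  have hev : ∀ s ∈ κ.target, ∀ η : G, (mfderiv 𝓘(ℝ, G) 𝓘(ℝ, E') (F ∘ κ.symm) s : G →L[ℝ] E')
      (chartInvariantField (G := G) K η s) = h.fieldModel (F (κ.symm s)) η := by
    intro s hs η
    refine (hd s hs _).trans ?_
    refine (congrArg (mfderiv 𝓘(ℝ, G) 𝓘(ℝ, E') F (κ.symm s)) (hX s hs η)).trans ?_
    exact mfderiv_act_inv_mulInvariantVectorField (h := h) z (κ.symm s) η
  -- The pullback of `θ^l` to the group is constant on left invariant fields, so Cartan's formula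
  -- reduces to its bracket term.
  have hconst : ∀ η : G, (fun s => pullCovector (θ l) (F ∘ κ.symm) s (chartInvariantField K η s))
      =ᶠ[𝓝 s₀] fun _ => ξ.repr η l := by
    intro η
    filter_upwards [(isOpen_extChartAt_target (1 : K)).mem_nhds hs] with s hs
    refine (congrArg (θ l (F (κ.symm s))) (hev s hs η)).trans ?_
    exact hθ.apply_field_repr l _ η
  have hXs : ∀ η : G, DifferentiableAt ℝ (chartInvariantField K η) s₀ := by
    intro η
    refine (contDiffAt_dChart_apply hs ?_).differentiableAt (n := 1) (by simp)
    refine (contMDiff_mulInvariantVectorField (I := 𝓘(ℝ, G)) (G := K) η _).of_le ?_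
    rw [minSmoothness_of_isRCLikeNormedField]
    exact one_le_two
  have ha : DifferentiableAt ℝ (pullCovector (θ l) (F ∘ κ.symm)) s₀ :=
    (contDiffAt_pullCovector (hθ.smooth l) hf).differentiableAt (by simp)
  have h1 := d_oneForm_mfderiv (hθ.smooth l) hf (chartInvariantField K η s₀)
    (chartInvariantField K ζ s₀)
  rw [extDeriv_oneForm_apply_fields ha (hXs η) (hXs ζ), (hconst η).fderiv_eq,
    (hconst ζ).fderiv_eq, fderiv_fun_const] at h1
  -- The bracket of the Lie algebra is by definition the bracket of left invariant fields at `1`.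
  have hbr : VectorField.lieBracket ℝ (chartInvariantField (G := G) K η)
      (chartInvariantField (G := G) K ζ) s₀ = (⁅η, ζ⁆ : GroupLieAlgebra 𝓘(ℝ, G) K) := by
    rw [GroupLieAlgebra.bracket_def]
    refine (mlieBracket_eq_lieBracket (N := K) (x := 1) (X := mulInvariantVectorField η)
      (Y := mulInvariantVectorField ζ) ?_ ?_).symm
    · filter_upwards [(isOpen_extChartAt_target (1 : K)).mem_nhds hs] with s hs
      exact (hX s hs η).symm
    · filter_upwards [(isOpen_extChartAt_target (1 : K)).mem_nhds hs] with s hs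
      exact (hX s hs ζ).symm
  have hds : ∀ η : G, (mfderiv 𝓘(ℝ, G) 𝓘(ℝ, E') (F ∘ κ.symm) s₀ : G →L[ℝ] E') η =
      h.fieldModel (F (κ.symm s₀)) η := by
    intro η
    refine (hd s₀ hs η).trans ?_
    rw [dSymm_self, hs1, hF1]
    rfl
  rw [hbr] at h1
  have h2 : pullCovector (θ l) (F ∘ κ.symm) s₀ (⁅η, ζ⁆ : GroupLieAlgebra 𝓘(ℝ, G) K) = ξ.repr ⁅η, ζ⁆ l := by
    refine (congrArg (θ l (F (κ.symm s₀))) (hds (⁅η, ζ⁆ : GroupLieAlgebra 𝓘(ℝ, G) K))).trans ?_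
    exact hθ.apply_field_repr l _ _
  rw [h2] at h1
  have e : ∀ (z' : ZeroLevel Φ) (u v : E') (c : ℝ), z' = z → u = h.fieldModel z' η →
      v = h.fieldModel z' ζ →
      DForm.d (E := E') (fun z : ZeroLevel Φ => oneForm (θ l z)) z' ![u, v] = c →
      DForm.d (E := E') (fun z : ZeroLevel Φ => oneForm (θ l z)) z ![h.field z η, h.field z ζ] =
        c := by
    rintro _ _ _ _ rfl rfl rfl h0; exact h0
  refine e (F (κ.symm s₀)) _ _ (-ξ.repr ⁅η, ζ⁆ l) ?_ (hev s₀ hs η) (hev s₀ hs ζ)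
    (h1.trans (by simp))
  rw [hs1, hF1]

end IsConnection

end IsKahlerReduction

end ConnectionForms

/-- The exterior derivative of a `1`-form on vector fields that it annihilates, along a map. -/
theorem d_oneForm_of_annihilated {E : Type*} [NormedAddCommGroup E] [NormedSpace ℝ E]
    {N : Type*} [TopologicalSpace N] [ChartedSpace E N] [IsManifold 𝓘(ℝ, E) ∞ N]
    {V : Type*} [NormedAddCommGroup V] [NormedSpace ℝ V]
    {τ : ∀ z : N, TangentSpace 𝓘(ℝ, E) z →L[ℝ] ℝ}
    (hτ : DForm.IsSmooth (E := E) (fun z : N => oneForm (τ z))) {f : V → N} {v : V}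
    (hf : ContMDiffAt 𝓘(ℝ, V) 𝓘(ℝ, E) ∞ f v) {X Y : V → V} (hX : DifferentiableAt ℝ X v)
    (hY : DifferentiableAt ℝ Y v) (hX0 : ∀ᶠ y in 𝓝 v, pullCovector τ f y (X y) = 0)
    (hY0 : ∀ᶠ y in 𝓝 v, pullCovector τ f y (Y y) = 0) :
    DForm.d (E := E) (fun z : N => oneForm (τ z)) (f v)
      ![mfderiv 𝓘(ℝ, V) 𝓘(ℝ, E) f v (X v), mfderiv 𝓘(ℝ, V) 𝓘(ℝ, E) f v (Y v)] =
      -pullCovector τ f v (VectorField.lieBracket ℝ X Y v) := by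
  have ha := (contDiffAt_pullCovector hτ hf).differentiableAt (by simp)
  have hX1 : (fun y => pullCovector τ f y (X y)) =ᶠ[𝓝 v] fun _ => 0 := hX0
  have hY1 : (fun y => pullCovector τ f y (Y y)) =ᶠ[𝓝 v] fun _ => 0 := hY0
  rw [d_oneForm_mfderiv hτ hf, extDeriv_oneForm_apply_fields ha hX hY, hX1.fderiv_eq,
    hY1.fderiv_eq]
  simp

theorem wedge_oneForm_apply {T : Type*} [AddCommGroup T] [Module ℝ T] [TopologicalSpace T]
    (a b : T →L[ℝ] ℝ) (u v : T) :
    wedge a (oneForm b) ![u, v] = a u * b v - a v * b u := by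
  rw [wedge_apply, Fin.sum_univ_two]
  have e1 : oneForm b (Fin.removeNth (0 : Fin 2) ![u, v]) = b v := rfl
  have e2 : oneForm b (Fin.removeNth (1 : Fin 2) ![u, v]) = b u := rfl
  rw [e1, e2]
  simp [sub_eq_add_neg]

/-! ### The horizontal projection and the J-invariance of dθ on E -/

section Curvature

variable {E : Type*} [NormedAddCommGroup E] [NormedSpace ℝ E] [FiniteDimensional ℝ E]
  {M : Type*} [TopologicalSpace M] [ChartedSpace E M] [IsManifold 𝓘(ℝ, E) ∞ M]
  {G : Type*} [NormedAddCommGroup G] [NormedSpace ℝ G] [FiniteDimensional ℝ G]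
  {K : Type*} [TopologicalSpace K] [ChartedSpace G K] [Group K] [LieGroup 𝓘(ℝ, G) ∞ K]
  [MulAction K M] [ContMDiffSMul 𝓘(ℝ, G) 𝓘(ℝ, E) ∞ K M]
  {E' : Type*} [NormedAddCommGroup E'] [NormedSpace ℝ E'] [FiniteDimensional ℝ E']
  {S : KahlerStructure E M} {Φ : M → G →L[ℝ] ℝ} [ChartedSpace E' (ZeroLevel Φ)]
  [IsManifold 𝓘(ℝ, E') ∞ (ZeroLevel Φ)]

theorem structureConstant_swap {k : ℕ} (ξ : Module.Basis (Fin k) ℝ (GroupLieAlgebra 𝓘(ℝ, G) K))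
    (i j l : Fin k) : structureConstant ξ j i l = -structureConstant ξ i j l := by
  have h1 : ⁅ξ j, ξ i⁆ = -⁅ξ i, ξ j⁆ := by
    rw [GroupLieAlgebra.bracket_def, GroupLieAlgebra.bracket_def]
    exact VectorField.mlieBracket_swap_apply
  rw [structureConstant, structureConstant, h1, map_neg]
  rfl

theorem curvature_apply {k : ℕ} (ξ : Module.Basis (Fin k) ℝ (GroupLieAlgebra 𝓘(ℝ, G) K))
    (θ : Fin k → ∀ z : ZeroLevel Φ, TangentSpace 𝓘(ℝ, E') z →L[ℝ] ℝ) (l : Fin k)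
    (z : ZeroLevel Φ) (u v : TangentSpace 𝓘(ℝ, E') z) :
    curvature ξ θ l z ![u, v] =
      DForm.d (E := E') (fun z : ZeroLevel Φ => oneForm (θ l z)) z ![u, v] +
        (1 / 2 : ℝ) * ∑ i, ∑ j, structureConstant ξ i j l *
          (θ i z u * θ j z v - θ i z v * θ j z u) := by
  simp only [curvature, ContinuousAlternatingMap.add_apply, ContinuousAlternatingMap.smul_apply,
    ContinuousAlternatingMap.sum_apply, smul_eq_mul]
  simp only [wedge_oneForm_apply]

namespace IsKahlerReduction

/-- A covector on `Z` as a functional on the model space. -/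
noncomputable def modelCovector {z : ZeroLevel Φ} (a : TangentSpace 𝓘(ℝ, E') z →L[ℝ] ℝ) :
    E' →L[ℝ] ℝ := a

/-- The horizontal projection along the orbits. -/
noncomputable def horProj (h : IsKahlerReduction E' K S Φ) {k : ℕ}
    (ξ : Module.Basis (Fin k) ℝ (GroupLieAlgebra 𝓘(ℝ, G) K))
    (θ : Fin k → ∀ z : ZeroLevel Φ, TangentSpace 𝓘(ℝ, E') z →L[ℝ] ℝ) (z : ZeroLevel Φ) :
    E' →L[ℝ] E' :=
  ContinuousLinearMap.id ℝ E' - ∑ l, (modelCovector (θ l z)).smulRight (h.fieldModel z (ξ l))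

/-- The horizontal projection in the chart around `x`. -/
noncomputable def chartHorProj (h : IsKahlerReduction E' K S Φ) {k : ℕ}
    (ξ : Module.Basis (Fin k) ℝ (GroupLieAlgebra 𝓘(ℝ, G) K))
    (θ : Fin k → ∀ z : ZeroLevel Φ, TangentSpace 𝓘(ℝ, E') z →L[ℝ] ℝ) (x : ZeroLevel Φ) (y : E') :
    E' →L[ℝ] E' :=
  ContinuousLinearMap.id ℝ E' - ∑ l, (pullCovector (θ l) (extChartAt 𝓘(ℝ, E') x).symm y).smulRight
    (h.chartField x (ξ l) y)

variable {h : IsKahlerReduction E' K S Φ} {k : ℕ}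
  {ξ : Module.Basis (Fin k) ℝ (GroupLieAlgebra 𝓘(ℝ, G) K)}
  {θ : Fin k → ∀ z : ZeroLevel Φ, TangentSpace 𝓘(ℝ, E') z →L[ℝ] ℝ}

theorem contMDiff_moment_apply (h : IsKahlerReduction E' K S Φ) (η : G) :
    ContMDiff 𝓘(ℝ, E) 𝓘(ℝ, ℝ) ∞ (fun x => Φ x η) :=
  (ContinuousLinearMap.apply ℝ ℝ η : (G →L[ℝ] ℝ) →L[ℝ] ℝ).contMDiff.comp h.moment.smooth

theorem horProj_apply (z : ZeroLevel Φ) (v : E') :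
    h.horProj ξ θ z v = v - ∑ l, θ l z v • h.fieldModel z (ξ l) := by
  simp only [horProj, sub_apply, sum_apply, ContinuousLinearMap.id_apply]
  rfl

theorem chartHorProj_apply (x : ZeroLevel Φ) (y v : E') :
    h.chartHorProj ξ θ x y v = v - ∑ l, pullCovector (θ l) (extChartAt 𝓘(ℝ, E') x).symm y v •
      h.chartField x (ξ l) y := by
  simp only [chartHorProj, sub_apply, sum_apply, ContinuousLinearMap.id_apply]
  rfl

theorem dSymm_chartHorProj {x : ZeroLevel Φ} {y : E'} (hy : y ∈ (extChartAt 𝓘(ℝ, E') x).target)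
    (v : E') : dSymm x y (h.chartHorProj ξ θ x y v) =
      h.horProj ξ θ ((extChartAt 𝓘(ℝ, E') x).symm y) (dSymm x y v) := by
  rw [chartHorProj_apply, horProj_apply, map_sub, map_sum]
  refine congrArg _ (Finset.sum_congr rfl fun l _ => ?_)
  exact (map_smul (dSymm x y) _ _).trans (congrArg _ (h.dSymm_chartField hy (ξ l)))

namespace IsConnection

variable (hθ : h.IsConnection ξ θ)
include hθ

/-- The projection is built from the smooth forms `θ^l` and the smooth fundamental fields. This
makes `Hor` preserve smoothness and provides local sections of `E` through given vectors. -/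
theorem contDiffAt_chartHorProj {x : ZeroLevel Φ} {y : E'}
    (hy : y ∈ (extChartAt 𝓘(ℝ, E') x).target) : ContDiffAt ℝ ∞ (h.chartHorProj ξ θ x) y := by
  refine contDiffAt_const.sub (ContDiffAt.sum fun l _ => ?_)
  exact (contDiffAt_pullCovector (hθ.smooth l) (contMDiffAt_extChartAt_symm_of_mem hy)).smulRight
    (h.contDiffAt_chartField hy (ξ l))

theorem horProj_eq_self {z : ZeroLevel Φ} {v : E'}
    (hv : (v : TangentSpace 𝓘(ℝ, E') z) ∈ h.H z) : h.horProj ξ θ z v = v := by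
  rw [horProj_apply, Finset.sum_eq_zero, sub_zero]
  intro l _
  have h1 : θ l z v = 0 := hθ.apply_H l z v hv
  rw [h1, zero_smul]

theorem horProj_field (z : ZeroLevel Φ) (η : G) : h.horProj ξ θ z (h.fieldModel z η) = 0 := by
  rw [horProj_apply, sub_eq_zero]
  have e : ∀ l, θ l z (h.fieldModel z η) = ξ.repr η l := fun l => hθ.apply_field_repr l z η
  simp only [e]
  have e2 := congrArg (h.field z) (ξ.sum_repr η)
  rw [map_sum] at e2
  refine e2.symm.trans (Finset.sum_congr rfl fun l _ => ?_)
  exact map_smul (h.field z) _ _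

/-- The projection kills `V_z`, fixes `E_z`, and these two subspaces span `T_z Z`. -/
theorem horProj_mem_H (z : ZeroLevel Φ) (v : E') :
    (h.horProj ξ θ z v : TangentSpace 𝓘(ℝ, E') z) ∈ h.H z := by
  have h1 : ∀ w : TangentSpace 𝓘(ℝ, E') z, w ∈ h.V z ⊔ h.H z := fun w => by
    rw [(h.isCompl z).sup_eq_top]; exact Submodule.mem_top
  obtain ⟨a, ⟨η, rfl⟩, b, hb, hab⟩ := Submodule.mem_sup.1 (h1 v)
  have h2 : h.horProj ξ θ z v = b := by
    refine (congrArg (h.horProj ξ θ z) hab.symm).trans ?_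
    refine (map_add (h.horProj ξ θ z) (h.fieldModel z η) b).trans ?_
    refine (congrArg (· + _) (hθ.horProj_field z η)).trans ?_
    exact (zero_add _).trans (hθ.horProj_eq_self hb)
  rw [h2]
  exact hb

/-- Horizontal vectors at `z` extend to vector fields in the kernel of `θ`; their bracket computes
both `dθ` and the derivative of the twisted differentials of the moment map. -/
theorem exists_bracket (z : ZeroLevel Φ) {w₁ w₂ : E'}
    (hw₁ : (w₁ : TangentSpace 𝓘(ℝ, E') z) ∈ h.H z) (hw₂ : (w₂ : TangentSpace 𝓘(ℝ, E') z) ∈ h.H z) :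
    ∃ b : E', (∀ l, DForm.d (E := E') (fun z : ZeroLevel Φ => oneForm (θ l z)) z ![w₁, w₂] =
        -θ l z b) ∧
      ∀ η : GroupLieAlgebra 𝓘(ℝ, G) K, (S.twist fun x => Φ x η).d z.1
        ![h.inclDeriv z w₁, h.inclDeriv z w₂] = h.gZ z (h.field z η) b := by
  have hne : (∞ : WithTop ℕ∞) ≠ 0 := by simp
  set φ := extChartAt 𝓘(ℝ, E') z with hφ
  set y₀ := φ z with hy₀
  have hy : y₀ ∈ φ.target := mem_extChartAt_target z
  have hz : φ.symm y₀ = z := extChartAt_to_inv z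
  -- Projecting a constant vector of the chart gives a local section of `E`, which takes the value
  -- `w` at the base point when `w` is horizontal (`hW₀`).
  set W : E' → E' → E' := fun w y => h.chartHorProj ξ θ z y w with hW
  have hWd : ∀ w, DifferentiableAt ℝ (W w) y₀ := fun w =>
    ((hθ.contDiffAt_chartHorProj hy).differentiableAt hne).clm_apply
      (differentiableAt_const w)
  have hWH : ∀ w, ∀ y ∈ φ.target, (dSymm z y (W w y) : TangentSpace 𝓘(ℝ, E') (φ.symm y)) ∈
      h.H (φ.symm y) := by
    intro w y hy
    have e := hθ.horProj_mem_H (φ.symm y) (dSymm z y w)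
    rw [← dSymm_chartHorProj hy] at e
    exact e
  have hW₀ : ∀ w : E', (w : TangentSpace 𝓘(ℝ, E') z) ∈ h.H z → W w y₀ = w := by
    intro w hw
    have e : ∀ z' : ZeroLevel Φ, z' = z → h.horProj ξ θ z' w = w := by
      rintro _ rfl; exact hθ.horProj_eq_self hw
    have e2 := dSymm_chartHorProj (h := h) (ξ := ξ) (θ := θ) hy w
    rw [dSymm_self] at e2
    exact e2.trans (e _ hz)
  have hev : ∀ᶠ y in 𝓝 y₀, y ∈ φ.target := (isOpen_extChartAt_target z).mem_nhds hy
  have hf : ContMDiffAt 𝓘(ℝ, E') 𝓘(ℝ, E') ∞ φ.symm y₀ := contMDiffAt_extChartAt_symm_of_mem hy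
  set b : E' := VectorField.lieBracket ℝ (W w₁) (W w₂) y₀ with hb
  refine ⟨b, fun l => ?_, fun η => ?_⟩
  · have h0 : ∀ w, ∀ᶠ y in 𝓝 y₀, pullCovector (θ l) φ.symm y (W w y) = 0 := fun w =>
      hev.mono fun y hy => hθ.apply_H l _ _ (hWH w y hy)
    have h1 := d_oneForm_of_annihilated (hθ.smooth l) hf (hWd w₁) (hWd w₂) (h0 w₁) (h0 w₂)
    -- The point `φ.symm y₀` equals `z` only propositionally, so the base point and the vectors at
    -- it are replaced together.
    have e : ∀ (z' : ZeroLevel Φ) (u v b' : E'), z' = z → u = w₁ → v = w₂ → b' = b →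
        DForm.d (E := E') (fun z : ZeroLevel Φ => oneForm (θ l z)) z' ![u, v] = -θ l z' b' →
        DForm.d (E := E') (fun z : ZeroLevel Φ => oneForm (θ l z)) z ![w₁, w₂] = -θ l z b := by
      rintro _ _ _ _ rfl rfl rfl rfl h0; exact h0
    have hd : ∀ w, dSymm z y₀ w = w := fun w => DFunLike.congr_fun (dSymm_self z) w
    exact e (φ.symm y₀) _ _ (dSymm z y₀ b) hz ((hd _).trans (hW₀ w₁ hw₁))
      ((hd _).trans (hW₀ w₂ hw₂)) (hd b) h1
  · set g : M → ℝ := fun x => Φ x η with hg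
    have hgs : ContMDiff 𝓘(ℝ, E) 𝓘(ℝ, ℝ) ∞ g :=
      h.contMDiff_moment_apply η
    let τ : ∀ x : M, TangentSpace 𝓘(ℝ, E) x →L[ℝ] ℝ := fun x =>
      (mfderiv 𝓘(ℝ, E) 𝓘(ℝ, ℝ) g x : E →L[ℝ] ℝ) ∘L S.Jmodel x
    -- On `Z` the twisted differential is `-g(η_Z, ·)`, so it annihilates the same sections `W` as
    -- `θ` does, and the same bracket `b` computes its derivative.
    have hτ : ∀ (z' : ZeroLevel Φ) (v : TangentSpace 𝓘(ℝ, E') z'),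
        τ z'.1 (h.inclDeriv z' v) = -h.gZ z' (h.field z' η) v := fun z' v =>
      eq_neg_iff_add_eq_zero.2 (by rw [h.gZ_field]; exact add_neg_cancel _)
    have hfι : ContMDiffAt 𝓘(ℝ, E') 𝓘(ℝ, E) ∞ ((Subtype.val : ZeroLevel Φ → M) ∘ φ.symm) y₀ :=
      (h.contMDiffAt_incl _).comp y₀ hf
    have hdf : ∀ y ∈ φ.target, ∀ w : E',
        (mfderiv 𝓘(ℝ, E') 𝓘(ℝ, E) ((Subtype.val : ZeroLevel Φ → M) ∘ φ.symm) y : E' →L[ℝ] E) w =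
          h.inclDeriv (φ.symm y) (dSymm z y w) := fun y hy w =>
      mfderiv_comp_apply (I := 𝓘(ℝ, E')) (I' := 𝓘(ℝ, E')) (I'' := 𝓘(ℝ, E))
        (g := (Subtype.val : ZeroLevel Φ → M)) (f := φ.symm) y
        ((h.contMDiffAt_incl _).mdifferentiableAt hne)
        ((contMDiffAt_extChartAt_symm_of_mem hy).mdifferentiableAt hne) w
    have h0 : ∀ w, ∀ᶠ y in 𝓝 y₀, pullCovector τ ((Subtype.val : ZeroLevel Φ → M) ∘ φ.symm) y
        (W w y) = 0 := fun w => hev.mono fun y hy => by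
      refine (congrArg (τ (φ.symm y).1) (hdf y hy (W w y))).trans ?_
      refine (hτ _ _).trans (neg_eq_zero.2 ?_)
      exact hWH w y hy _ ⟨η, rfl⟩
    have h1 := d_oneForm_of_annihilated (τ := τ) (S.isSmooth_twist hgs) hfι (hWd w₁) (hWd w₂)
      (h0 w₁) (h0 w₂)
    have h2 : pullCovector τ ((Subtype.val : ZeroLevel Φ → M) ∘ φ.symm) y₀ b =
        -h.gZ (φ.symm y₀) (h.field (φ.symm y₀) η) (dSymm z y₀ b) :=
      (congrArg (τ (φ.symm y₀).1) (hdf y₀ hy b)).trans (hτ _ _)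
    have h3 := h1.trans ((congrArg Neg.neg h2).trans (neg_neg _))
    have e : ∀ (z' : ZeroLevel Φ) (u v : E) (u' v' b' : E'), z' = z →
        u = h.inclDeriv z' u' → v = h.inclDeriv z' v' → u' = w₁ → v' = w₂ → b' = b →
        (S.twist g).d z'.1 ![u, v] = h.gZ z' (h.field z' η) b' →
        (S.twist g).d z.1 ![h.inclDeriv z w₁, h.inclDeriv z w₂] = h.gZ z (h.field z η) b := by
      rintro _ _ _ _ _ _ rfl rfl rfl rfl rfl rfl h0; exact h0
    have hd : ∀ w, dSymm z y₀ w = w := fun w => DFunLike.congr_fun (dSymm_self z) w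
    exact e (φ.symm y₀) _ _ (dSymm z y₀ (W w₁ y₀)) (dSymm z y₀ (W w₂ y₀)) (dSymm z y₀ b) hz
      (hdf y₀ hy _) (hdf y₀ hy _) ((hd _).trans (hW₀ w₁ hw₁)) ((hd _).trans (hW₀ w₂ hw₂)) (hd b) h3

/-- The restriction of `dθ` to the horizontal subspaces is `J`-invariant. -/
theorem d_JE_JE (l : Fin k) (z : ZeroLevel Φ) (w₁ w₂ : h.H z) :
    DForm.d (E := E') (fun z : ZeroLevel Φ => oneForm (θ l z)) z
      ![(h.JE z w₁ : TangentSpace 𝓘(ℝ, E') z), h.JE z w₂] =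
    DForm.d (E := E') (fun z : ZeroLevel Φ => oneForm (θ l z)) z
      ![(w₁ : TangentSpace 𝓘(ℝ, E') z), w₂] := by
  obtain ⟨b, hb1, hb2⟩ := hθ.exists_bracket z w₁.2 w₂.2
  obtain ⟨b', hb1', hb2'⟩ := hθ.exists_bracket z (h.JE z w₁).2 (h.JE z w₂).2
  have h1 : ∀ η, h.gZ z (h.field z η) b' = h.gZ z (h.field z η) b := by
    intro η
    have hgs : ContMDiff 𝓘(ℝ, E) 𝓘(ℝ, ℝ) ∞ (fun x => Φ x η) :=
      h.contMDiff_moment_apply η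
    rw [← hb2 η, ← hb2' η, h.inclDeriv_JE, h.inclDeriv_JE]
    exact S.twist_d_J_J hgs z.1 _ _
  -- Two vectors with equal products with all fundamental fields differ by an element of `E_z`,
  -- where `θ^l` vanishes.
  have h2 : ∀ c c' : TangentSpace 𝓘(ℝ, E') z,
      (∀ η, h.gZ z (h.field z η) c' = h.gZ z (h.field z η) c) → θ l z c' = θ l z c := by
    intro c c' hc
    rw [← sub_eq_zero, ← map_sub]
    refine hθ.apply_H l z _ ?_
    rintro _ ⟨η, rfl⟩
    have h3 : h.gZ z (h.field z η) (c' - c) = 0 := by rw [map_sub, hc, sub_self]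
    exact h3
  exact (hb1' l).trans ((congrArg Neg.neg (h2 b b' h1)).trans (hb1 l).symm)

end IsConnection

end IsKahlerReduction

end Curvature

/-! ### 2-forms as bilinear forms -/

section TwoForms

variable {T : Type*} [AddCommGroup T] [Module ℝ T] [TopologicalSpace T]

omit [Module ℝ T] [TopologicalSpace T] in
theorem vec_update_one [DecidableEq (Fin 2)] (u v x : T) : Function.update ![u, v] 1 x = ![u, x] := by
  funext i
  fin_cases i <;> simp

/-- A `2`-form as a bilinear form. -/
noncomputable def twoFormBilin (β : T [⋀^Fin 2]→L[ℝ] ℝ) : LinearMap.BilinForm ℝ T :=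
  LinearMap.mk₂ ℝ (fun u v => β ![u, v])
    (fun u u' v => β.toAlternatingMap.map_vecCons_add ![v] u u')
    (fun r u v => β.toAlternatingMap.map_vecCons_smul ![v] r u)
    (fun u v v' => by
      have h1 := β.toAlternatingMap.map_update_add ![u, v] 1 v v'
      rwa [vec_update_one, vec_update_one, vec_update_one] at h1)
    (fun r u v => by
      have h1 := β.toAlternatingMap.map_update_smul ![u, v] 1 r v
      rwa [vec_update_one, vec_update_one] at h1)

theorem twoFormBilin_apply (β : T [⋀^Fin 2]→L[ℝ] ℝ) (u v : T) :
    twoFormBilin β u v = β ![u, v] := rfl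

end TwoForms

/-! ### Smoothness of pullbacks, wedge products and sums -/

section SmoothForms

variable {E : Type*} [NormedAddCommGroup E] [NormedSpace ℝ E]
  {N : Type*} [TopologicalSpace N] [ChartedSpace E N] [IsManifold 𝓘(ℝ, E) ∞ N]
  {E₁ : Type*} [NormedAddCommGroup E₁] [NormedSpace ℝ E₁]
  {N₁ : Type*} [TopologicalSpace N₁] [ChartedSpace E₁ N₁] [IsManifold 𝓘(ℝ, E₁) ∞ N₁]
  {F : Type*} [NormedAddCommGroup F] [NormedSpace ℝ F]

theorem DForm.IsSmooth.pullback {n : ℕ} {α : DForm E N n F} (hα : α.IsSmooth) {f : N₁ → N}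
    (hf : ContMDiff 𝓘(ℝ, E₁) 𝓘(ℝ, E) ∞ f) :
    DForm.IsSmooth (E := E₁) (DForm.pullback (E' := E₁) f α) := by
  rw [DForm.isSmooth_iff_contDiffAt_pull]
  intro x y hy
  have h1 := hα.contDiffAt_pull ((hf _).comp y (contMDiffAt_extChartAt_symm_of_mem hy))
  refine h1.congr_of_eventuallyEq ?_
  filter_upwards [(isOpen_extChartAt_target x).mem_nhds hy] with w hw
  refine ContinuousAlternatingMap.ext fun v => ?_
  refine congrArg (α (f ((extChartAt 𝓘(ℝ, E₁) x).symm w))) (funext fun i => ?_)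
  exact (mfderiv_comp_apply (I := 𝓘(ℝ, E₁)) (I' := 𝓘(ℝ, E₁)) (I'' := 𝓘(ℝ, E)) w
    ((hf _).mdifferentiableAt (by simp))
    ((contMDiffAt_extChartAt_symm_of_mem hw).mdifferentiableAt (by simp)) (v i)).symm

theorem DForm.IsSmooth.toComplex {n : ℕ} {α : DForm E N n ℝ} (hα : α.IsSmooth) :
    α.toComplex.IsSmooth := fun x =>
  (ContinuousLinearMap.compContinuousAlternatingMapCLM ℝ E ℝ ℂ (Fin n)
    Complex.ofRealCLM).contDiff.comp_contDiffOn (hα x)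

theorem wedge_oneForm_comp {V W : Type*} [NormedAddCommGroup V] [NormedSpace ℝ V]
    [NormedAddCommGroup W] [NormedSpace ℝ W] (a b : V →L[ℝ] ℝ) (L : W →L[ℝ] V) :
    (wedge a (oneForm b)).compContinuousLinearMap L = wedge (a ∘L L) (oneForm (b ∘L L)) := by
  ext v
  rw [ContinuousAlternatingMap.compContinuousLinearMap_apply, wedge_apply, wedge_apply]
  rfl

/-- The form `a ∧ b` is the pullback of the fixed area form on `ℝ × ℝ` by the map `(a, b)`, so
`contDiffAt_alternating_comp` applies. -/
theorem contDiffAt_wedge {V W : Type*} [NormedAddCommGroup V] [NormedSpace ℝ V]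
    [NormedAddCommGroup W] [NormedSpace ℝ W] {a b : W → V →L[ℝ] ℝ} {w : W}
    (ha : ContDiffAt ℝ ∞ a w) (hb : ContDiffAt ℝ ∞ b w) :
    ContDiffAt ℝ ∞ (fun y => wedge (a y) (oneForm (b y))) w := by
  have h1 : (fun y => wedge (a y) (oneForm (b y))) = fun y =>
      (wedge (ContinuousLinearMap.fst ℝ ℝ ℝ)
        (oneForm (ContinuousLinearMap.snd ℝ ℝ ℝ))).compContinuousLinearMap
          ((a y).prod (b y)) := by
    funext y
    rw [wedge_oneForm_comp]
    rfl
  rw [h1]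
  refine contDiffAt_alternating_comp contDiffAt_const ?_
  exact (ContinuousLinearMap.prodₗᵢ ℝ).toContinuousLinearEquiv.contDiff.contDiffAt.comp w
    (ha.prodMk hb)

theorem DForm.IsSmooth.wedge {a b : ∀ z : N, TangentSpace 𝓘(ℝ, E) z →L[ℝ] ℝ}
    (ha : DForm.IsSmooth (E := E) (fun z : N => oneForm (a z)))
    (hb : DForm.IsSmooth (E := E) (fun z : N => oneForm (b z))) :
    DForm.IsSmooth (E := E) (fun z : N => KahlerReduction.wedge (a z) (oneForm (b z))) := by
  rw [DForm.isSmooth_iff_contDiffAt_pull]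
  intro x y hy
  have hf := contMDiffAt_extChartAt_symm_of_mem hy
  refine (contDiffAt_wedge (contDiffAt_pullCovector ha hf)
    (contDiffAt_pullCovector hb hf)).congr_of_eventuallyEq (Filter.Eventually.of_forall fun w => ?_)
  exact wedge_oneForm_comp (V := E) (a _) (b _) _

theorem DForm.IsSmooth.add {n : ℕ} {α β : DForm E N n F} (hα : α.IsSmooth) (hβ : β.IsSmooth) :
    DForm.IsSmooth (E := E) (fun z => α z + β z) := fun x => (hα x).add (hβ x)

theorem DForm.IsSmooth.const_smul {n : ℕ} {α : DForm E N n F} (c : ℝ) (hα : α.IsSmooth) :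
    DForm.IsSmooth (E := E) (fun z => c • α z) := fun x => (hα x).const_smul c

theorem DForm.IsSmooth.sum {n : ℕ} {ι : Type*} (s : Finset ι) {α : ι → DForm E N n F}
    (hα : ∀ i, (α i).IsSmooth) : DForm.IsSmooth (E := E) (fun z => ∑ i ∈ s, α i z) := by
  classical
  induction s using Finset.induction_on with
  | empty =>
    intro x
    exact contDiffOn_const (c := 0)
  | insert i s hi ih =>
    simp only [Finset.sum_insert hi]
    exact (hα i).add ih

end SmoothForms

/-! ### Horizontal forms, their types, and the two parts of the lemma -/

section HorizontalForms

variable {E : Type*} [NormedAddCommGroup E] [NormedSpace ℝ E] [FiniteDimensional ℝ E]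
  {M : Type*} [TopologicalSpace M] [ChartedSpace E M] [IsManifold 𝓘(ℝ, E) ∞ M]
  {G : Type*} [NormedAddCommGroup G] [NormedSpace ℝ G] [FiniteDimensional ℝ G]
  {K : Type*} [TopologicalSpace K] [ChartedSpace G K] [Group K] [LieGroup 𝓘(ℝ, G) ∞ K]
  [MulAction K M] [ContMDiffSMul 𝓘(ℝ, G) 𝓘(ℝ, E) ∞ K M]
  {E' : Type*} [NormedAddCommGroup E'] [NormedSpace ℝ E'] [FiniteDimensional ℝ E']
  {S : KahlerStructure E M} {Φ : M → G →L[ℝ] ℝ} [ChartedSpace E' (ZeroLevel Φ)]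
  [IsManifold 𝓘(ℝ, E') ∞ (ZeroLevel Φ)]

namespace IsKahlerReduction

section Transverse

variable (h : IsKahlerReduction E' K S Φ)

/-- The horizontal representative of a vector in `Q_z`. -/
noncomputable def horLift (z : ZeroLevel Φ) : h.Q z →ₗ[ℝ] TangentSpace 𝓘(ℝ, E') z :=
  (h.H z).subtype ∘ₗ (Submodule.quotientEquivOfIsCompl _ _ (h.isCompl z)).toLinearMap

theorem horLift_mem_H (z : ZeroLevel Φ) (q : h.Q z) : h.horLift z q ∈ h.H z :=
  (Submodule.quotientEquivOfIsCompl _ _ (h.isCompl z) q).2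

theorem horLift_JQ (z : ZeroLevel Φ) (q : h.Q z) :
    h.horLift z (h.JQ z q) = h.JE z ⟨h.horLift z q, h.horLift_mem_H z q⟩ :=
  congrArg Subtype.val ((Submodule.quotientEquivOfIsCompl _ _ (h.isCompl z)).apply_symm_apply _)

theorem JE_JE (z : ZeroLevel Φ) (v : h.H z) : h.JE z (h.JE z v) = -v := by
  apply Subtype.ext
  apply h.inclDeriv_injective z
  rw [h.inclDeriv_JE, h.inclDeriv_JE, S.J_J, Submodule.coe_neg, map_neg]

theorem JQ_JQ (z : ZeroLevel Φ) (q : h.Q z) : h.JQ z (h.JQ z q) = -q := by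
  set e := Submodule.quotientEquivOfIsCompl _ _ (h.isCompl z) with he
  have h1 : ∀ q, e (h.JQ z q) = h.JE z (e q) := fun q => e.apply_symm_apply _
  apply e.injective
  rw [h1, h1, h.JE_JE, map_neg]

/-- The complex structure of `Q_z` is transported from `J` on `E_z`, so lifting and including is
complex linear. This is the source of the type statement in (a). -/
theorem inclDeriv_horLift_JQ (z : ZeroLevel Φ) (q : h.Q z) :
    h.inclDeriv z (h.horLift z (h.JQ z q)) = S.J z.1 (h.inclDeriv z (h.horLift z q)) := by
  rw [h.horLift_JQ, h.inclDeriv_JE]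

theorem horLift_mk_of_mem {z : ZeroLevel Φ} {v : TangentSpace 𝓘(ℝ, E') z} (hv : v ∈ h.H z) :
    h.horLift z ((h.V z).mkQ v) = v :=
  congrArg Subtype.val
    (Submodule.quotientEquivOfIsCompl_apply_mk_right (h.isCompl z) ⟨v, hv⟩)

theorem horLift_mk_field (z : ZeroLevel Φ) (η : GroupLieAlgebra 𝓘(ℝ, G) K) :
    h.horLift z ((h.V z).mkQ (h.field z η)) = 0 := by
  have h1 : (h.V z).mkQ (h.field z η) = 0 := by
    rw [Submodule.mkQ_apply, Submodule.Quotient.mk_eq_zero]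
    exact ⟨η, rfl⟩
  rw [h1, map_zero]

end Transverse

variable {h : IsKahlerReduction E' K S Φ} {k : ℕ}
  {ξ : Module.Basis (Fin k) ℝ (GroupLieAlgebra 𝓘(ℝ, G) K)}
  {θ : Fin k → ∀ z : ZeroLevel Φ, TangentSpace 𝓘(ℝ, E') z →L[ℝ] ℝ}

namespace IsConnection

variable (hθ : h.IsConnection ξ θ)
include hθ

/-- Reconciles two descriptions of the projection onto `E_z`: through the quotient, where the type
is defined, and through `θ`, where smoothness and `Hor` are computed. -/
theorem horLift_mk (z : ZeroLevel Φ) (v : TangentSpace 𝓘(ℝ, E') z) :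
    h.horLift z ((h.V z).mkQ v) = v - ∑ i, θ i z v • h.field z (ξ i) := by
  have h1 : v - ∑ i, θ i z v • h.field z (ξ i) ∈ h.H z := by
    have h2 : ∀ a : TangentSpace 𝓘(ℝ, E') z, a = v - ∑ i, θ i z v • h.field z (ξ i) →
        a ∈ h.H z → v - ∑ i, θ i z v • h.field z (ξ i) ∈ h.H z := by
      rintro _ rfl h0; exact h0
    exact h2 _ (horProj_apply (E' := E') z v) (hθ.horProj_mem_H z v)
  rw [← h.horLift_mk_of_mem h1, map_sub, map_sub, map_sum, map_sum, Finset.sum_eq_zero, sub_zero]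
  intro i _
  rw [map_smul, map_smul, h.horLift_mk_field, smul_zero]

/-- A horizontal form is induced by its restriction to the horizontal subspaces. -/
theorem exists_typePQ_of_horLift {p q : ℕ} {z : ZeroLevel Φ}
    {β : TangentSpace 𝓘(ℝ, E') z [⋀^Fin (p + q)]→L[ℝ] ℂ}
    (hβ : ∀ η, IsKilledBy (h.field z η) β)
    (hγ : β.toAlternatingMap.compLinearMap (h.horLift z) ∈ typePQ (h.JQ z) p q) :
    ∃ γ ∈ typePQ (h.JQ z) p q, ∀ v, β v = γ (fun i => (h.V z).mkQ (v i)) := by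
  refine ⟨_, hγ, fun v => ?_⟩
  rw [AlternatingMap.compLinearMap_apply]
  simp only [hθ.horLift_mk]
  exact (apply_proj_of_isKilledBy (fun i => θ i z) (fun i => h.field z (ξ i)) β
    (fun i => hβ _) v).symm

/-- On horizontal vectors every term `θ^I ∧ h_I` with `I ≠ ∅` vanishes, while `h_∅` does not notice
the projection of its arguments. -/
theorem Hor_apply {n : ℕ} (α : DForm E' (ZeroLevel Φ) n ℂ) (z : ZeroLevel Φ)
    (v : Fin n → TangentSpace 𝓘(ℝ, E') z) :
    h.Hor ξ θ α z v = α z (fun i => h.horLift z ((h.V z).mkQ (v i))) := by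
  have hδ : ∀ i j, θ i z (h.field z (ξ j)) = if i = j then 1 else 0 :=
    fun i j => hθ.apply_field i j z
  obtain ⟨d, hd⟩ := exists_isHorizontalDecomposition (fun i => θ i z)
    (fun i => h.field z (ξ i)) hδ (Pi.single n (α z) : MixedForm _ ℂ)
  rw [Hor, hor_eq hδ hd, decomposition_empty_apply hδ hd, Pi.single_eq_same]
  simp only [hθ.horLift_mk]

theorem isKilledBy_Hor {n : ℕ} (α : DForm E' (ZeroLevel Φ) n ℂ) (z : ZeroLevel Φ)
    (η : GroupLieAlgebra 𝓘(ℝ, G) K) : IsKilledBy (h.field z η) (h.Hor ξ θ α z) := by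
  intro v j hv
  rw [hθ.Hor_apply]
  refine (α z).map_coord_zero j ?_
  rw [hv, h.horLift_mk_field]

/-- In a chart, taking the horizontal part is precomposition with the smooth family `chartHorProj`.
-/
theorem isSmooth_Hor {n : ℕ} {α : DForm E' (ZeroLevel Φ) n ℂ} (hα : α.IsSmooth) :
    (h.Hor ξ θ α).IsSmooth := by
  rw [DForm.isSmooth_iff_contDiffAt_pull]
  intro x y hy
  refine (contDiffAt_alternating_comp (hα.contDiffAt_inChart hy)
    (hθ.contDiffAt_chartHorProj hy)).congr_of_eventuallyEq ?_
  filter_upwards [(isOpen_extChartAt_target x).mem_nhds hy] with w hw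
  refine ContinuousAlternatingMap.ext fun v => ?_
  refine (hθ.Hor_apply α _ _).trans ?_
  refine congrArg (α ((extChartAt 𝓘(ℝ, E') x).symm w)) (funext fun i => ?_)
  refine (hθ.horLift_mk _ _).trans ?_
  refine Eq.trans ?_ (dSymm_chartHorProj hw (v i)).symm
  exact (horProj_apply (E' := E') _ _).symm

/-- The horizontal part of the restriction of a form of type `(p, q)`. -/
theorem isHorizontalOfType_Hor {p q : ℕ} {α : DForm E M (p + q) ℂ} (hα : α.IsSmooth)
    (hpq : S.IsType p q α) : h.IsHorizontalOfType p q
      (h.Hor ξ θ (DForm.pullback (Subtype.val : ZeroLevel Φ → M) α)) where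
  smooth := hθ.isSmooth_Hor (hα.pullback h.embedded.contMDiff)
  horizontal z η := hθ.isKilledBy_Hor _ z η
  type z := by
    refine hθ.exists_typePQ_of_horLift (hθ.isKilledBy_Hor _ z) ?_
    have h1 := typePQ_compLinearMap (L := (h.inclDeriv z : TangentSpace 𝓘(ℝ, E') z →ₗ[ℝ]
      TangentSpace 𝓘(ℝ, E) z.1) ∘ₗ h.horLift z) (h.inclDeriv_horLift_JQ z) (hpq z.1)
    convert h1 using 1
    ext v
    refine (hθ.Hor_apply _ z _).trans ?_
    -- Horizontal lifts are fixed by the projection, so on them `Hor` agrees with the restricted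
    -- form itself.
    have h2 : ∀ q, h.horLift z ((h.V z).mkQ (h.horLift z q)) = h.horLift z q :=
      fun q => h.horLift_mk_of_mem (h.horLift_mem_H z q)
    simp only [h2]
    rfl

/-- Each product in the quadratic term contains a factor `θ^j(w) = 0`, so only `dθ^l` is left, and
invariance of the connection handles it. -/
theorem curvature_field_H (l : Fin k) (z : ZeroLevel Φ) (η : GroupLieAlgebra 𝓘(ℝ, G) K)
    {w : TangentSpace 𝓘(ℝ, E') z} (hw : w ∈ h.H z) :
    curvature ξ θ l z ![h.field z η, w] = 0 := by
  have h1 : ∀ j, θ j z w = 0 := fun j => hθ.apply_H j z w hw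
  have h2 : DForm.d (E := E') (fun z : ZeroLevel Φ => oneForm (θ l z)) z ![h.field z η, w] = 0 :=
    hθ.d_field_H l z η hw
  rw [curvature_apply, h2]
  simp [h1]

/-- The quadratic term equals `½ (c_{ab}^l - c_{ba}^l) = c_{ab}^l`, and `dθ^l` contributes
`-c_{ab}^l`. -/
theorem curvature_field_field (l : Fin k) (z : ZeroLevel Φ) (a b : Fin k) :
    curvature ξ θ l z ![h.field z (ξ a), h.field z (ξ b)] = 0 := by
  rw [curvature_apply, hθ.d_field_field]
  have h1 : ∀ i j, θ i z (h.field z (ξ j)) = if i = j then 1 else 0 :=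
    fun i j => hθ.apply_field i j z
  have h2 : ∑ i, ∑ j, structureConstant ξ i j l *
      (θ i z (h.field z (ξ a)) * θ j z (h.field z (ξ b)) -
        θ i z (h.field z (ξ b)) * θ j z (h.field z (ξ a))) =
      structureConstant ξ a b l - structureConstant ξ b a l := by
    simp [h1, mul_sub, Finset.sum_sub_distrib]
  rw [h2, structureConstant_swap ξ a b l, structureConstant]
  ring

/-- By bilinearity the two preceding cases suffice: every tangent vector is a horizontal one plus a
combination of the `(ξ_i)_Z`. -/
theorem isKilledBy_curvature (l : Fin k) (z : ZeroLevel Φ) (η : GroupLieAlgebra 𝓘(ℝ, G) K) :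
    IsKilledBy (h.field z η) (curvature ξ θ l z) := by
  set B := twoFormBilin (curvature ξ θ l z) with hB
  have h1 : ∀ b, B (h.field z η) (h.field z (ξ b)) = 0 := by
    intro b
    have e : (B.flip (h.field z (ξ b))) ∘ₗ (h.field z : GroupLieAlgebra 𝓘(ℝ, G) K →ₗ[ℝ]
        TangentSpace 𝓘(ℝ, E') z) = 0 :=
      ξ.ext fun a => hθ.curvature_field_field l z a b
    exact LinearMap.congr_fun e η
  have h2 : ∀ w, B (h.field z η) w = 0 := by
    intro w
    have e : w = h.horLift z ((h.V z).mkQ w) + ∑ i, θ i z w • h.field z (ξ i) := by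
      rw [hθ.horLift_mk, sub_add_cancel]
    rw [e, map_add, map_sum]
    have e2 : B (h.field z η) (h.horLift z ((h.V z).mkQ w)) = 0 :=
      hθ.curvature_field_H l z η (h.horLift_mem_H z _)
    rw [e2, zero_add]
    refine Finset.sum_eq_zero fun i _ => ?_
    rw [map_smul, h1, smul_zero]
  refine isKilledBy_of_cons fun v => ?_
  have e : Matrix.vecCons (h.field z η) v = ![h.field z η, v 0] := by
    congr 1
    funext i
    fin_cases i
    rfl
  rw [e]
  exact h2 (v 0)

theorem isSmooth_curvature (l : Fin k) : (curvature ξ θ l).IsSmooth := by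
  refine (DForm.IsSmooth.d (hθ.smooth l)).add ?_
  refine DForm.IsSmooth.const_smul _ ?_
  exact DForm.IsSmooth.sum _ fun i => DForm.IsSmooth.sum _ fun j =>
    ((hθ.smooth i).wedge (hθ.smooth j)).const_smul _

/-- The curvature forms are horizontal of type `(1, 1)`. -/
theorem isHorizontalOfType_curvature (l : Fin k) :
    h.IsHorizontalOfType 1 1 (DForm.toComplex (curvature ξ θ l)) := by
  have hkill : ∀ z η, IsKilledBy (h.field z η) (DForm.toComplex (curvature ξ θ l) z) := by
    intro z η v j hv
    exact (congrArg Complex.ofReal (hθ.isKilledBy_curvature l z η v j hv)).trans Complex.ofReal_zero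
  refine ⟨(hθ.isSmooth_curvature l).toComplex, hkill, fun z => ?_⟩
  refine hθ.exists_typePQ_of_horLift (hkill z) ?_
  have : Module.Finite ℝ (TangentSpace 𝓘(ℝ, E') z) := inferInstanceAs (Module.Finite ℝ E')
  refine mem_typePQ_one_one (h.JQ_JQ z)
    ((twoFormBilin (curvature ξ θ l z)).compl₁₂ (h.horLift z) (h.horLift z)) ?_ ?_
  · intro v
    have e : (fun i => h.horLift z (v i)) = ![h.horLift z (v 0), h.horLift z (v 1)] := by
      funext i
      fin_cases i <;> rfl
    exact congrArg (fun w => (curvature ξ θ l z w : ℂ)) e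
  · intro u v
    simp only [LinearMap.compl₁₂_apply, twoFormBilin_apply]
    have h1 : ∀ j (q : h.Q z), θ j z (h.horLift z q) = 0 :=
      fun j q => hθ.apply_H j z _ (h.horLift_mem_H z q)
    -- On horizontal lifts the quadratic terms drop out, so invariance of the curvature under `J` is
    -- that of `dθ^l`.
    rw [curvature_apply, curvature_apply]
    simp only [h1]
    rw [h.horLift_JQ, h.horLift_JQ, hθ.d_JE_JE]

end IsConnection

end IsKahlerReduction

end HorizontalForms

end KahlerReduction

theorem lemma6p4
    {E : Type*} [NormedAddCommGroup E] [NormedSpace ℝ E] [FiniteDimensional ℝ E]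
    {M : Type*} [TopologicalSpace M] [ChartedSpace E M] [IsManifold 𝓘(ℝ, E) ∞ M]
    {G : Type*} [NormedAddCommGroup G] [NormedSpace ℝ G] [FiniteDimensional ℝ G]
    {K : Type*} [TopologicalSpace K] [ChartedSpace G K] [Group K] [LieGroup 𝓘(ℝ, G) ∞ K]
    [MulAction K M] [ContMDiffSMul 𝓘(ℝ, G) 𝓘(ℝ, E) ∞ K M]
    (S : KahlerStructure E M) (Φ : M → G →L[ℝ] ℝ)
    {E' : Type*} [NormedAddCommGroup E'] [NormedSpace ℝ E'] [FiniteDimensional ℝ E']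
    [ChartedSpace E' (ZeroLevel Φ)] [IsManifold 𝓘(ℝ, E') ∞ (ZeroLevel Φ)]
    (h : IsKahlerReduction E' K S Φ)
    {k : ℕ} (ξ : Module.Basis (Fin k) ℝ (GroupLieAlgebra 𝓘(ℝ, G) K))
    (θ : Fin k → ∀ z : ZeroLevel Φ, TangentSpace 𝓘(ℝ, E') z →L[ℝ] ℝ)
    (hθ : h.IsConnection ξ θ) :
    (∀ (p q : ℕ) (α : DForm E M (p + q) ℂ), α.IsSmooth → S.IsType p q α →
      h.IsHorizontalOfType p q
        (h.Hor ξ θ (DForm.pullback (Subtype.val : ZeroLevel Φ → M) α))) ∧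
    (∀ l : Fin k, h.IsHorizontalOfType 1 1 (DForm.toComplex (curvature ξ θ l))) :=
  ⟨fun _ _ _ hα hpq => hθ.isHorizontalOfType_Hor hα hpq, hθ.isHorizontalOfType_curvature⟩
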